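/- Identify $\mathfrak{su}(2)$ with Euclidean $\mathbb R^3$ through the inner product $\langle\xi,\nu\rangle=-\tfrac12\operatorname{tr}(\xi\nu)$, oriented so that $\xi\times\nu=\tfrac12[\xi,\nu]$ is the vector product, and let $\det$ denote the induced volume form, on $\mathfrak{su}(2)$ and on its quotients by lattices of translations. Let $\Gamma\subset\mathfrak{su}(2)$ be a lattice of rank $3$, let $\Sigma$ be a compact connected oriented smooth surface without boundary, and let $f\colon\Sigma\to\mathfrak{su}(2)/\Gamma$ be a smooth map. (1) For a compact oriented smooth $3$-manifold $B$ with $\partial B=\Sigma$ (as oriented manifolds) and a smooth map $\hat f\colon B\to\mathfrak{su}(2)/\Gamma$ with $\hat f|_{\partial B}=f$, the enclosed volume $$\mathcal V(f):=\int_B\hat f^*\det\ \in\ \mathbb R \bmod \operatorname{vol}(\mathfrak{su}(2)/\Gamma)$$ is independent of the choice of $B$ and $\hat f$: for any two choices $(B_1,\hat f_1)$ and $(B_2,\hat f_2)$, the difference $\int_{B_1}\hat f_1^*\det-\int_{B_2}\hat f_2^*\det$ is an integer multiple of $\operatorname{vol}(\mathfrak{su}(2)/\Gamma)$. (2) Let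 $\underline\Gamma\subset\Gamma$ be a sublattice of rank $2$ and $\pi\colon\mathfrak{su}(2)/\underline\Gamma\to\mathfrak{su}(2)/\Gamma$ the projection. For a compact oriented smooth $3$-manifold $B$ with $\partial B=\Sigma$ and a smooth map $\hat f\colon B\to\mathfrak{su}(2)/\underline\Gamma$ with $\pi\circ\hat f|_{\partial B}=f$ (such a map can exist only if the translational periods of $f$ lie in $\underline\Gamma$), the real number $$\mathcal V(f):=\int_B\hat f^*\det\ \in\ \mathbb R$$ is independent of the choice of $B$ and $\hat f$. -/

import Mathlib

open Set Module
open scoped Manifold ContDiff Topology Matrix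

noncomputable section

/-! ### The Euclidean space `su(2)` -/

/-- The real vector space of trace-free skew-Hermitian complex `2 × 2` matrices. -/
def su2Submodule : Submodule ℝ (Matrix (Fin 2) (Fin 2) ℂ) where
  carrier := {A | Aᴴ = -A ∧ A.trace = 0}
  add_mem' := by
    rintro A B ⟨hA, hA'⟩ ⟨hB, hB'⟩
    refine ⟨?_, ?_⟩
    · rw [Matrix.conjTranspose_add, hA, hB, neg_add]
    · rw [Matrix.trace_add, hA', hB', add_zero]
  zero_mem' := by simp
  smul_mem' := by
    rintro c A ⟨hA, hA'⟩
    refine ⟨?_, ?_⟩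
    · rw [Matrix.conjTranspose_smul, hA, star_trivial, smul_neg]
    · rw [Matrix.trace_smul, hA', smul_zero]

/-- `su(2)`, as a type of its own, so that its topology is the one of the metric `-½ tr`. -/
def su2 : Type := su2Submodule

namespace su2

instance : AddCommGroup su2 := inferInstanceAs (AddCommGroup su2Submodule)
instance : Module ℝ su2 := inferInstanceAs (Module ℝ su2Submodule)

/-- The inclusion of `su(2)` into the complex matrices. -/
def toMatrix : su2 →ₗ[ℝ] Matrix (Fin 2) (Fin 2) ℂ := su2Submodule.subtype

/-- The matrix `x₀ e₀ + x₁ e₁ + x₂ e₂` where `e₀, e₁, e₂` are `-i` times the Pauli matrices. -/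
def ofCoord (x : Fin 3 → ℝ) : su2 :=
  (⟨!![-Complex.I * x 2, -x 1 - Complex.I * x 0; x 1 - Complex.I * x 0, Complex.I * x 2], by
    refine ⟨?_, ?_⟩
    · ext i j
      fin_cases i <;> fin_cases j <;>
        simp [Matrix.conjTranspose_apply, Complex.ext_iff]
    · simp [Matrix.trace_fin_two]⟩ : su2Submodule)

theorem toMatrix_ofCoord (x : Fin 3 → ℝ) : toMatrix (ofCoord x) =
    !![-Complex.I * x 2, -x 1 - Complex.I * x 0; x 1 - Complex.I * x 0, Complex.I * x 2] := rfl

/-- The linear coordinates of `su(2)` with respect to `e₀, e₁, e₂`. -/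
def coord : su2 ≃ₗ[ℝ] (Fin 3 → ℝ) where
  toFun A := ![-(toMatrix A 1 0).im, (toMatrix A 1 0).re, (toMatrix A 1 1).im]
  map_add' A B := by
    ext i; fin_cases i <;> simp [add_comm]
  map_smul' c A := by
    ext i; fin_cases i <;> simp
  invFun := ofCoord
  left_inv := by
    intro A
    have hA : (toMatrix A)ᴴ = -toMatrix A := A.2.1
    have hA' : (toMatrix A).trace = 0 := A.2.2
    have h00 := congrFun (congrFun hA 0) 0
    have h01 := congrFun (congrFun hA 0) 1
    have h11 := congrFun (congrFun hA 1) 1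
    simp only [Matrix.conjTranspose_apply, Matrix.neg_apply, Complex.ext_iff, Complex.star_def,
      Complex.conj_re, Complex.conj_im, Complex.neg_re, Complex.neg_im] at h00 h01 h11
    rw [Matrix.trace_fin_two, Complex.ext_iff] at hA'
    simp only [Complex.add_re, Complex.add_im, Complex.zero_re, Complex.zero_im] at hA'
    apply Subtype.ext
    change toMatrix (ofCoord _) = toMatrix A
    rw [toMatrix_ofCoord]
    ext i j
    fin_cases i <;> fin_cases j <;>
      simp [Complex.ext_iff] <;> (try constructor) <;> linarith
  right_inv x := by
    ext i; fin_cases i <;> simp [toMatrix_ofCoord]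

/-- The Euclidean inner product `⟨ξ, ν⟩ = -½ tr (ξ ν)`. -/
def innerProd (ξ ν : su2) : ℝ := (-(1 / 2) * (toMatrix ξ * toMatrix ν).trace).re

theorem innerProd_eq_coord (ξ ν : su2) :
    innerProd ξ ν = ∑ k, coord ξ k * coord ν k := by
  obtain ⟨x, rfl⟩ := coord.symm.surjective ξ
  obtain ⟨y, rfl⟩ := coord.symm.surjective ν
  rw [LinearEquiv.apply_symm_apply, LinearEquiv.apply_symm_apply, innerProd,
    show toMatrix (coord.symm x) = _ from toMatrix_ofCoord x,
    show toMatrix (coord.symm y) = _ from toMatrix_ofCoord y]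
  simp [Matrix.trace_fin_two, Fin.sum_univ_succ]
  ring

/-- `-½ tr` is a positive definite inner product. -/
@[reducible] def innerCore : InnerProductSpace.Core ℝ su2 where
  inner := innerProd
  conj_inner_symm ξ ν := by
    simp only [innerProd_eq_coord, conj_trivial, mul_comm]
  re_inner_nonneg ξ := by
    simp only [innerProd_eq_coord, RCLike.re_to_real]
    exact Finset.sum_nonneg fun k _ => mul_self_nonneg _
  add_left ξ ν μ := by
    simp only [innerProd_eq_coord, map_add, Pi.add_apply, add_mul, Finset.sum_add_distrib]
  smul_left ξ ν r := by
    simp only [innerProd_eq_coord, map_smul, Pi.smul_apply, smul_eq_mul, conj_trivial, mul_assoc,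
      Finset.mul_sum]
  definite ξ h := by
    rw [innerProd_eq_coord, Finset.sum_eq_zero_iff_of_nonneg fun k _ => mul_self_nonneg _] at h
    apply coord.injective
    ext k
    simpa using h k (Finset.mem_univ k)

instance : NormedAddCommGroup su2 := innerCore.toNormedAddCommGroup
instance : InnerProductSpace ℝ su2 := InnerProductSpace.ofCore innerCore.toCore

theorem inner_eq (ξ ν : su2) : inner ℝ ξ ν = innerProd ξ ν := rfl

instance : FiniteDimensional ℝ su2 := coord.symm.finiteDimensional
instance : MeasurableSpace su2 := borel su2
instance : BorelSpace su2 := ⟨rfl⟩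

/-- The basis of `su(2)` that consists of `-i` times the Pauli matrices. -/
def stdBasis : Basis (Fin 3) ℝ su2 := Basis.ofEquivFun coord

theorem orthonormal_stdBasis : Orthonormal ℝ stdBasis := by
  rw [orthonormal_iff_ite]
  intro i j
  rw [inner_eq, innerProd_eq_coord]
  simp [stdBasis, Pi.single_apply, eq_comm]

/-- The Euclidean volume form `det` of `su(2) ≅ ℝ³`. The orientation is the one for which the
vector product is `ξ × ν = ½ [ξ, ν]`. -/
def det : su2 [⋀^Fin 3]→ₗ[ℝ] ℝ := stdBasis.det

end su2

/-! ### Quotients by a lattice -/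

section Lattice

variable {V : Type*} [NormedAddCommGroup V]
  (Γ : Submodule ℤ V) [DiscreteTopology Γ]

theorem isLocalHomeomorph_mkQ : IsLocalHomeomorph (Γ.mkQ : V → V ⧸ Γ) := by
  have : DiscreteTopology Γ.toAddSubgroup := ‹DiscreteTopology Γ›
  exact (Γ.toAddSubgroup.isAddQuotientCoveringMap_of_comm
    (DiscreteTopology.isDiscrete (s := (Γ.toAddSubgroup : Set V)))).isCoveringMap.isLocalHomeomorph

/-- The manifold structure of `V ⧸ Γ`: its charts are the local inverses of the projection
`V → V ⧸ Γ`. -/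
instance quotientChartedSpace : ChartedSpace V (V ⧸ Γ) :=
  (isLocalHomeomorph_mkQ Γ).chartedSpace Γ.mkQ_surjective

theorem mkQ_chart_symm (e : OpenPartialHomeomorph (V ⧸ Γ) V) (he : e ∈ atlas V (V ⧸ Γ)) (y : V) :
    e.symm y = Γ.mkQ y := by
  obtain ⟨q, rfl⟩ := he
  simp [chartAt_self_eq]

/-- Changes of charts of `V ⧸ Γ` are locally translations, so `V ⧸ Γ` is a smooth manifold. -/
instance quotientIsManifold [NormedSpace ℝ V] : IsManifold 𝓘(ℝ, V) ∞ (V ⧸ Γ) := by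
  apply isManifold_of_contDiffOn
  intro e e' he he'
  simp only [modelWithCornersSelf_coe, modelWithCornersSelf_coe_symm, Function.id_comp,
    Function.comp_id, Set.preimage_id, Set.range_id, Set.inter_univ]
  set c := e.symm.trans e'
  have hmem : ∀ y ∈ c.source, c y - y ∈ Γ := by
    intro y hy
    have h1 : e.symm y ∈ e'.source := by simpa [c] using hy.2
    have h2 : Γ.mkQ (c y) = Γ.mkQ y := by
      rw [← mkQ_chart_symm Γ e' he', ← mkQ_chart_symm Γ e he]
      exact e'.left_inv h1
    rw [← Submodule.Quotient.eq]
    exact h2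
  have hcont : ContinuousOn (fun y => c y - y) c.source := c.continuousOn.sub continuousOn_id
  intro x hx
  have hloc : ∀ᶠ y in 𝓝 x, c y = y + (c x - x) := by
    obtain ⟨U, hU, hUx⟩ := 
      (discreteTopology_subtype_iff'.1 ‹DiscreteTopology Γ›) (c x - x) (hmem x hx)
    have hca := hcont.continuousAt (c.open_source.mem_nhds hx)
    have hxU : c x - x ∈ U := by
      have : c x - x ∈ U ∩ Γ := by rw [hUx]; rfl
      exact this.1
    filter_upwards [hca.preimage_mem_nhds (hU.mem_nhds hxU), c.open_source.mem_nhds hx] with y hy hys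
    have : c y - y ∈ U ∩ (Γ : Set V) := ⟨hy, hmem y hys⟩
    rw [hUx] at this
    have h : c y - y = c x - x := this
    rw [← h]; abel
  exact ((contDiffAt_id.add contDiffAt_const).congr_of_eventuallyEq hloc).contDiffWithinAt
end Lattice

/-! ### Oriented manifolds and integration of forms of top degree -/

/-- The atlas of `M` is oriented: all changes of charts have positive Jacobian determinant. -/
class OrientedAtlas {E H : Type*} [NormedAddCommGroup E] [NormedSpace ℝ E] [TopologicalSpace H]
    (I : ModelWithCorners ℝ E H) (M : Type*) [TopologicalSpace M] [ChartedSpace H M] : Prop where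
  det_pos : ∀ e ∈ atlas H M, ∀ e' ∈ atlas H M, ∀ y ∈ (I.extendCoordChange e e').source,
    0 < (fderivWithin ℝ (I.extendCoordChange e e') (range I) y).det

section Integral

variable {n : ℕ} {H : Type*} [TopologicalSpace H]
  (I : ModelWithCorners ℝ (EuclideanSpace ℝ (Fin n)) H)
  {M : Type*} [TopologicalSpace M] [ChartedSpace H M]

/-- The coefficient of `dx₁ ∧ ⋯ ∧ dxₙ` in the expression of the `n`-form `η` in the chart at `p`. -/
def formCoeff (η : ∀ x : M, TangentSpace I x [⋀^Fin n]→ₗ[ℝ] ℝ) (p : M)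
    (y : EuclideanSpace ℝ (Fin n)) : ℝ :=
  η ((extChartAt I p).symm y) fun i =>
    mfderivWithin 𝓘(ℝ, EuclideanSpace ℝ (Fin n)) I (extChartAt I p).symm (range I) y
      (EuclideanSpace.single i 1)

/-- The integral `∑ₚ ∫ ρₚ η` of the `n`-form `η`, for a partition of unity `ρ` subordinate to the
charts; each summand is computed in the chart at `p`. -/
def formIntegralWith (ρ : SmoothPartitionOfUnity M I M univ)
    (η : ∀ x : M, TangentSpace I x [⋀^Fin n]→ₗ[ℝ] ℝ) : ℝ :=
  ∑ᶠ p : M, ∫ y in (extChartAt I p).target, ρ p ((extChartAt I p).symm y) * formCoeff I η p y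

/-- The integral of an `n`-form over a compact `n`-manifold `M` with an oriented atlas. It is
computed with some smooth partition of unity subordinate to the charts; for a continuous form
the value is the same for all of them. -/
def formIntegral [IsManifold I ∞ M] [T2Space M] [CompactSpace M] [OrientedAtlas I M]
    (η : ∀ x : M, TangentSpace I x [⋀^Fin n]→ₗ[ℝ] ℝ) : ℝ :=
  formIntegralWith I (SmoothPartitionOfUnity.exists_isSubordinate_chartAt_source I M).choose η

end Integral

/-! ### Manifolds with prescribed boundary and enclosed volume -/

/-- `ι` identifies the surface `S` with the boundary of `B`, as oriented manifolds: `ι` is a smooth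
bijection from `S` onto `∂B`, and the outward vector `-e₀` (in a half-space chart of `B`) followed
by the image under `dι` of an oriented basis of the tangent plane of `S` is an oriented basis of the
tangent space of `B`. In particular `dι` is injective. -/
structure IsOrientedBoundary {S B : Type*}
    [TopologicalSpace S] [ChartedSpace (EuclideanSpace ℝ (Fin 2)) S]
    [TopologicalSpace B] [ChartedSpace (EuclideanHalfSpace 3) B] (ι : S → B) : Prop where
  contMDiff : ContMDiff (𝓡 2) (𝓡∂ 3) ∞ ι
  injective : Function.Injective ι
  range_eq : range ι = (𝓡∂ 3).boundary B
  oriented : ∀ p : S, 0 < (EuclideanSpace.basisFun (Fin 3) ℝ).toBasis.det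
    ![-EuclideanSpace.single 0 1,
      mfderiv (𝓡 2) (𝓡∂ 3) ι p (EuclideanSpace.single 0 1 : EuclideanSpace ℝ (Fin 2)),
      mfderiv (𝓡 2) (𝓡∂ 3) ι p (EuclideanSpace.single 1 1 : EuclideanSpace ℝ (Fin 2))]

universe u v

/-- A compact oriented 3-manifold `B` with boundary `S`. -/
structure Filling (S : Type u) [TopologicalSpace S]
    [ChartedSpace (EuclideanSpace ℝ (Fin 2)) S] where
  B : Type v
  [topologicalSpace : TopologicalSpace B]
  [chartedSpace : ChartedSpace (EuclideanHalfSpace 3) B]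
  [isManifold : IsManifold (𝓡∂ 3) ∞ B]
  [t2Space : T2Space B]
  [compactSpace : CompactSpace B]
  [orientedAtlas : OrientedAtlas (𝓡∂ 3) B]
  /-- The identification of `S` with the boundary of `B`. -/
  incl : S → B
  isOrientedBoundary : IsOrientedBoundary incl

namespace Filling

variable {S : Type u} [TopologicalSpace S] [ChartedSpace (EuclideanSpace ℝ (Fin 2)) S]

attribute [instance] topologicalSpace chartedSpace isManifold t2Space compactSpace orientedAtlas

variable (F : Filling.{u, v} S) (Γ : Submodule ℤ su2) [DiscreteTopology Γ]

/-- The pullback 3-form `g* det` of the volume form along `g : B → su(2) ⧸ Γ`; the tangent spaces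
of `su(2) ⧸ Γ` are `su(2)`. -/
def pullbackDet (g : F.B → su2 ⧸ Γ) (x : F.B) : TangentSpace (𝓡∂ 3) x [⋀^Fin 3]→ₗ[ℝ] ℝ :=
  su2.det.compLinearMap
    (show TangentSpace (𝓡∂ 3) x →L[ℝ] su2 from mfderiv (𝓡∂ 3) 𝓘(ℝ, su2) g x).toLinearMap

/-- The enclosed volume `∫_B g* det`. -/
def volume (g : F.B → su2 ⧸ Γ) : ℝ := formIntegral (𝓡∂ 3) (F.pullbackDet Γ g)

end Filling

end

/-! In the coordinates `x₀, x₁, x₂` of a basis `b` of `su2`, the volume form is `det b` times `dx₀ ∧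
dx₁ ∧ dx₂`, so everything reduces to integrals of pullbacks `g*(Ψ dx₀ ∧ dx₁ ∧ dx₂)` for functions
`Ψ` on the quotient (`weightedForm`, `Filling.volume_eq`). If `Ψ = ∂ᵢΦ` with `Φ` a function on the
quotient, this form is the pullback of `d(Φ dxᵢ₊₁ ∧ dxᵢ₊₂)`. Stokes' theorem
(`formIntegral_wedgeForm`) turns its integral into one over the surface that involves only the
boundary values, so two fillings give the same result (`formIntegral_weightedForm_fderiv`). The two
fillings are never glued together.

Rank 3: take `b` to be a lattice basis and `Ψ` a product `h₀(x₀) h₁(x₁) h₂(x₂)` of functions of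
period 1. A factor of mean zero has a periodic primitive, so the form is then exact. Replacing the
factors one by one by their means shows that the difference of the two weighted integrals is `∏ ∫hᵢ`
times the difference for `Ψ = 1` (`formIntegral_weightedForm_sub_eq_mul`). By Sard's theorem
(`volume_irregular_values`) some `v` is a regular value of both maps. If the `hᵢ` are concentrated
near the coordinates of `v`, each weighted integral is an integer, the signed count of preimages of
`v`, times `∏ ∫hᵢ` (`exists_degree`). Hence the unweighted integrals differ by an integer, and `det
b` is the covolume up to sign.

Rank 2: the sublattice does not span, so a nonzero linear functional vanishing on it descends to the
quotient and makes the volume form itself exact there (`Filling.volume_eq_of_finrank_eq_two`). The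
boundary values agree only modulo the larger lattice. On the connected surface they differ by a
constant translation, which leaves the volume unchanged. -/

section

open MeasureTheory

/-! ### Derivatives read in extended charts -/

section Charts

variable {E : Type*} [NormedAddCommGroup E] [NormedSpace ℝ E] {H : Type*} [TopologicalSpace H]
  {I : ModelWithCorners ℝ E H} {M : Type*} [TopologicalSpace M] [ChartedSpace H M]

variable (I) in
/-- The derivative of the inverse of the extended chart at `p`, with the tangent space of `M`
identified with the model space. -/
noncomputable def chartFrame (p : M) (y : E) : E →L[ℝ] E :=
  mfderivWithin 𝓘(ℝ, E) I (extChartAt I p).symm (range I) y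

variable {E' : Type*} [NormedAddCommGroup E'] [NormedSpace ℝ E'] {H' : Type*} [TopologicalSpace H']
  {I' : ModelWithCorners ℝ E' H'} {N : Type*} [TopologicalSpace N] [ChartedSpace H' N]

variable (I I') in
/-- The derivative `mfderiv`, with the tangent spaces identified with the model spaces. -/
noncomputable def modelDeriv (g : M → N) (x : M) : E →L[ℝ] E' := mfderiv I I' g x

theorem mdifferentiableWithinAt_extChartAt_symm_range [IsManifold I ∞ M] {p : M} {y : E}
    (hy : y ∈ (extChartAt I p).target) :
    MDifferentiableWithinAt 𝓘(ℝ, E) I (extChartAt I p).symm (range I) y :=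
  (contMDiffWithinAt_extChartAt_symm_range (n := ∞) p hy).mdifferentiableWithinAt (by simp)

theorem uniqueMDiffWithinAt_range_of_mem_target {p : M} {y : E}
    (hy : y ∈ (extChartAt I p).target) : UniqueMDiffWithinAt 𝓘(ℝ, E) (range I) y :=
  I.uniqueMDiffOn y (extChartAt_target_subset_range p hy)

theorem mfderivWithin_comp_extChartAt_symm [IsManifold I ∞ M] {p : M} {y : E}
    (hy : y ∈ (extChartAt I p).target) {G : M → N}
    (hG : MDifferentiableAt I I' G ((extChartAt I p).symm y)) :
    (mfderivWithin 𝓘(ℝ, E) I' (G ∘ (extChartAt I p).symm) (range I) y : E →L[ℝ] E') =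
      ContinuousLinearMap.comp (modelDeriv I I' G ((extChartAt I p).symm y))
        (chartFrame I p y) :=
  mfderiv_comp_mfderivWithin _ hG (mdifferentiableWithinAt_extChartAt_symm_range hy)
    (uniqueMDiffWithinAt_range_of_mem_target hy)

theorem differentiableWithinAt_comp_extChartAt_symm [IsManifold I ∞ M] {p : M} {y : E}
    (hy : y ∈ (extChartAt I p).target) {G : M → E'}
    (hG : MDifferentiableAt I 𝓘(ℝ, E') G ((extChartAt I p).symm y)) :
    DifferentiableWithinAt ℝ (G ∘ (extChartAt I p).symm) (range I) y :=
  (hG.comp_mdifferentiableWithinAt y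
    (mdifferentiableWithinAt_extChartAt_symm_range hy)).differentiableWithinAt

theorem fderivWithin_comp_extChartAt_symm [IsManifold I ∞ M] {p : M} {y : E}
    (hy : y ∈ (extChartAt I p).target) {G : M → E'}
    (hG : MDifferentiableAt I 𝓘(ℝ, E') G ((extChartAt I p).symm y)) :
    fderivWithin ℝ (G ∘ (extChartAt I p).symm) (range I) y =
      ContinuousLinearMap.comp
        (modelDeriv I 𝓘(ℝ, E') G ((extChartAt I p).symm y))
        (chartFrame I p y) := by
  rw [← mfderivWithin_comp_extChartAt_symm hy hG, mfderivWithin_eq_fderivWithin]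

theorem extChartAt_eventually_symm_mem {p : M} {y : E} (hy : y ∈ (extChartAt I p).target)
    {U : Set M} (hU : U ∈ 𝓝 ((extChartAt I p).symm y)) :
    ∀ᶠ z in 𝓝[range I] y, (extChartAt I p).symm z ∈ U :=
  ((continuousOn_extChartAt_symm p y hy).mono_of_mem_nhdsWithin
    (extChartAt_target_mem_nhdsWithin_of_mem hy)) hU

end Charts

/-! ### Change of variables for integrals of top-degree forms -/

section Integration

variable {n : ℕ} {H : Type*} [TopologicalSpace H]
  {I : ModelWithCorners ℝ (EuclideanSpace ℝ (Fin n)) H}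
  {M : Type*} [TopologicalSpace M] [ChartedSpace H M]

theorem measurableSet_extChartAt_target (p : M) : MeasurableSet (extChartAt I p).target := by
  rw [extChartAt_target]
  exact ((I.continuous_symm.isOpen_preimage _ (chartAt H p).open_target).measurableSet).inter
    I.isClosed_range.measurableSet

theorem measurableSet_target_inter_symm_preimage (p : M) {U : Set M} (hU : IsOpen U) :
    MeasurableSet ((extChartAt I p).target ∩ (extChartAt I p).symm ⁻¹' U) := by
  obtain ⟨u, hu, h⟩ := (continuousOn_iff'.1 (continuousOn_extChartAt_symm (I := I) p)) U hU
  rw [inter_comm, h]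
  exact hu.measurableSet.inter (measurableSet_extChartAt_target p)

theorem formCoeff_eq (η : ∀ x : M, TangentSpace I x [⋀^Fin n]→ₗ[ℝ] ℝ) (p : M)
    (y : EuclideanSpace ℝ (Fin n)) :
    formCoeff I η p y = η ((extChartAt I p).symm y) fun i =>
      chartFrame I p y (EuclideanSpace.single i 1) := rfl

theorem alternatingMap_sum_apply {ι E : Type*} [AddCommGroup E] [Module ℝ E] (s : Finset ι)
    (η : ι → E [⋀^Fin n]→ₗ[ℝ] ℝ) (v : Fin n → E) : (∑ j ∈ s, η j) v = ∑ j ∈ s, η j v := by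
  classical
  induction s using Finset.induction_on with
  | empty => simp
  | insert a s ha ih => rw [Finset.sum_insert ha, Finset.sum_insert ha, AlternatingMap.add_apply, ih]

theorem formCoeff_sum {ι : Type*} (s : Finset ι)
    (η : ι → ∀ x : M, TangentSpace I x [⋀^Fin n]→ₗ[ℝ] ℝ) (p : M) (y : EuclideanSpace ℝ (Fin n)) :
    formCoeff I (fun x => ∑ j ∈ s, η j x) p y = ∑ j ∈ s, formCoeff I (η j) p y :=
  alternatingMap_sum_apply s (fun j => η j ((extChartAt I p).symm y)) _

theorem formCoeff_smul (c : M → ℝ) (η : ∀ x : M, TangentSpace I x [⋀^Fin n]→ₗ[ℝ] ℝ) (p : M)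
    (y : EuclideanSpace ℝ (Fin n)) :
    formCoeff I (fun x => c x • η x) p y = c ((extChartAt I p).symm y) * formCoeff I η p y := rfl

theorem formCoeff_of_eq_zero {η : ∀ x : M, TangentSpace I x [⋀^Fin n]→ₗ[ℝ] ℝ} {p : M}
    {y : EuclideanSpace ℝ (Fin n)} (h : η ((extChartAt I p).symm y) = 0) :
    formCoeff I η p y = 0 := by
  rw [formCoeff_eq, h]; rfl

/-- The summands of `formIntegralWith` are integrable. -/
def FormIntegrable (ρ : SmoothPartitionOfUnity M I M univ)
    (η : ∀ x : M, TangentSpace I x [⋀^Fin n]→ₗ[ℝ] ℝ) : Prop :=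
  ∀ p : M, IntegrableOn (fun y => ρ p ((extChartAt I p).symm y) * formCoeff I η p y)
    (extChartAt I p).target

/-- Local finiteness on a compact space; it makes the `finsum` in `formIntegralWith` an honest
finite sum. -/
theorem finite_nonzero_partition [CompactSpace M] (ρ : SmoothPartitionOfUnity M I M univ) :
    {p | ρ p ≠ 0}.Finite := by
  refine (ρ.locallyFinite.finite_nonempty_of_compact).subset fun p hp => ?_
  by_contra h
  rw [Set.mem_ofPred_eq, Set.not_nonempty_iff_eq_empty, Function.support_eq_empty_iff] at h
  exact hp (by ext x; exact congrFun h x)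

theorem formIntegralWith_eq_sum [CompactSpace M] (ρ : SmoothPartitionOfUnity M I M univ)
    (η : ∀ x : M, TangentSpace I x [⋀^Fin n]→ₗ[ℝ] ℝ) :
    formIntegralWith I ρ η = ∑ p ∈ (finite_nonzero_partition ρ).toFinset,
      ∫ y in (extChartAt I p).target, ρ p ((extChartAt I p).symm y) * formCoeff I η p y := by
  refine finsum_eq_sum_of_support_subset _ fun p hp => ?_
  simp only [Finite.coe_toFinset, mem_ofPred_eq]
  rintro h
  simp [h] at hp

theorem sum_partition_eq_one [CompactSpace M] (ρ : SmoothPartitionOfUnity M I M univ) (x : M) :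
    ∑ p ∈ (finite_nonzero_partition ρ).toFinset, ρ p x = 1 := by
  rw [← ρ.sum_eq_one (mem_univ x)]
  refine (finsum_eq_sum_of_support_subset _ fun p hp => ?_).symm
  simp only [Finite.coe_toFinset, mem_ofPred_eq]
  rintro h
  simp [h] at hp

theorem formIntegralWith_finset_sum [CompactSpace M] {ι : Type*}
    (ρ : SmoothPartitionOfUnity M I M univ) (s : Finset ι)
    (η : ι → ∀ x : M, TangentSpace I x [⋀^Fin n]→ₗ[ℝ] ℝ)
    (h : ∀ j ∈ s, FormIntegrable ρ (η j)) :
    formIntegralWith I ρ (fun x => ∑ j ∈ s, η j x) = ∑ j ∈ s, formIntegralWith I ρ (η j) := by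
  simp only [formIntegralWith_eq_sum]
  rw [Finset.sum_comm]
  refine Finset.sum_congr rfl fun p _ => ?_
  rw [← integral_finsetSum _ fun j hj => h j hj p]
  refine integral_congr_ae (Filter.Eventually.of_forall fun y => ?_)
  simp only [formCoeff_sum, Finset.mul_sum]

theorem formIntegralWith_smul [CompactSpace M]
    (ρ : SmoothPartitionOfUnity M I M univ) (c : ℝ)
    (η : ∀ x : M, TangentSpace I x [⋀^Fin n]→ₗ[ℝ] ℝ) :
    formIntegralWith I ρ (fun x => c • η x) = c * formIntegralWith I ρ η := by
  simp only [formIntegralWith_eq_sum, Finset.mul_sum]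
  refine Finset.sum_congr rfl fun p _ => ?_
  rw [← integral_const_mul]
  refine integral_congr_ae (Filter.Eventually.of_forall fun y => ?_)
  simp only [formCoeff_smul]; ring

/-- **Change of variables** for a form that is, on an open set `U` and up to the sign `ε`, the
pullback of the form `h dx₁ ∧ ⋯ ∧ dxₙ` along an injective map `κ`, and vanishes off `U`. -/
theorem formIntegralWith_eq_integral_image [IsManifold I ∞ M] [CompactSpace M]
    {ρ : SmoothPartitionOfUnity M I M univ}
    (hρ : ρ.IsSubordinate fun x => (chartAt H x).source)
    {η : ∀ x : M, TangentSpace I x [⋀^Fin n]→ₗ[ℝ] ℝ} (hη : FormIntegrable ρ η)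
    {U : Set M} (hU : IsOpen U) {κ : M → EuclideanSpace ℝ (Fin n)} (hinj : InjOn κ U)
    (hκ : ∀ x ∈ U, MDifferentiableAt I 𝓘(ℝ, EuclideanSpace ℝ (Fin n)) κ x)
    {ε : ℝ} (hε : ε = 1 ∨ ε = -1) {h : EuclideanSpace ℝ (Fin n) → ℝ}
    (hsign : ∀ p, ∀ y ∈ (extChartAt I p).target, (extChartAt I p).symm y ∈ U →
      0 < ε * (fderivWithin ℝ (κ ∘ (extChartAt I p).symm) (range I) y).det)
    (hcoeff : ∀ p, ∀ y ∈ (extChartAt I p).target, (extChartAt I p).symm y ∈ U →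
      formCoeff I η p y = h (κ ((extChartAt I p).symm y)) *
        (fderivWithin ℝ (κ ∘ (extChartAt I p).symm) (range I) y).det)
    (hzero : ∀ x ∉ U, η x = 0) :
    formIntegralWith I ρ η = ε * ∫ z in κ '' U, h z := by
  classical
  set T := (finite_nonzero_partition ρ).toFinset with hT
  set s : M → Set (EuclideanSpace ℝ (Fin n)) := fun p =>
    (extChartAt I p).target ∩ (extChartAt I p).symm ⁻¹' U with hs
  have hsm : ∀ p, MeasurableSet (s p) := fun p => measurableSet_target_inter_symm_preimage p hU
  set k : M → EuclideanSpace ℝ (Fin n) → EuclideanSpace ℝ (Fin n) :=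
    fun p => κ ∘ (extChartAt I p).symm with hk
  have hkinj : ∀ p, InjOn (k p) (s p) := by
    intro p y hy z hz hyz
    exact (extChartAt I p).symm.injOn hy.1 hz.1 (hinj hy.2 hz.2 hyz)
  have hkd : ∀ p, ∀ y ∈ s p,
      HasFDerivWithinAt (k p) (fderivWithin ℝ (k p) (range I) y) (s p) y := by
    intro p y hy
    exact (differentiableWithinAt_comp_extChartAt_symm hy.1
      (hκ _ hy.2)).hasFDerivWithinAt.mono fun z hz => extChartAt_target_subset_range p hz.1
  have hρ0 : ∀ p x, x ∉ (extChartAt I p).source → ρ p x = 0 := by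
    intro p x hx
    by_contra h0
    exact hx ((extChartAt_source I p).symm ▸ hρ p (subset_closure h0))
  have himage : ∀ p, k p '' s p = κ '' (U ∩ (extChartAt I p).source) := by
    intro p
    ext z
    constructor
    · rintro ⟨y, hy, rfl⟩
      exact ⟨_, ⟨hy.2, (extChartAt I p).map_target hy.1⟩, rfl⟩
    · rintro ⟨x, hx, rfl⟩
      refine ⟨extChartAt I p x, ⟨(extChartAt I p).map_source hx.2, ?_⟩, ?_⟩
      · simp only [mem_preimage, (extChartAt I p).left_inv hx.2]; exact hx.1
      · simp only [hk, Function.comp, (extChartAt I p).left_inv hx.2]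
  have hmeas : ∀ p, MeasurableSet (k p '' s p) := fun p =>
    measurable_image_of_fderivWithin (hsm p) (hkd p) (hkinj p)
  -- The partition sums to `1`, so at each point some member is nonzero, and it is supported in its
  -- chart domain. Thus finitely many chart images cover `κ '' U`, which also gives measurability.
  have hcover : κ '' U = ⋃ p ∈ T, k p '' s p := by
    ext z
    simp only [mem_iUnion, himage]
    constructor
    · rintro ⟨x, hx, rfl⟩
      have h1 : ∑ p ∈ T, ρ p x ≠ 0 := by rw [sum_partition_eq_one ρ x]; exact one_ne_zero
      obtain ⟨p, hp, hpx⟩ := Finset.exists_ne_zero_of_sum_ne_zero h1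
      refine ⟨p, hp, x, ⟨hx, ?_⟩, rfl⟩
      by_contra hxs
      exact hpx (hρ0 p x hxs)
    · rintro ⟨p, -, x, hx, rfl⟩
      exact ⟨x, hx.1, rfl⟩
  have hmeasU : MeasurableSet (κ '' U) := by
    rw [hcover]
    exact Finset.measurableSet_biUnion _ fun p _ => hmeas p
  -- `Function.invFunOn` below needs a point of `M`.
  by_cases hne : Nonempty M
  swap
  · have : IsEmpty M := not_nonempty_iff.1 hne
    have hU0 : κ '' U = ∅ := by rw [Set.eq_empty_of_isEmpty U, image_empty]
    rw [hU0, formIntegralWith_eq_sum, Finset.sum_eq_zero fun p _ => (this.false p).elim]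
    simp
  -- The inverse of `κ` turns the partition members into functions of the image variable. All chart
  -- integrals then live on the single set `κ '' U`, where the partition sums to `1`.
  set κi := Function.invFunOn κ U with hκi
  have hκil : ∀ x ∈ U, κi (κ x) = x := fun x hx => hinj.leftInvOn_invFunOn hx
  have hεε : ε * ε = 1 := by rcases hε with rfl | rfl <;> norm_num
  -- By the sign hypothesis, `ε` times the determinant is the absolute value that the
  -- measure-theoretic formula requires.
  have habs : ∀ p, ∀ y ∈ s p, ρ p ((extChartAt I p).symm y) * formCoeff I η p y =
      ε * (|(fderivWithin ℝ (k p) (range I) y).det| •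
        (fun z => ρ p (κi z) * h z) (k p y)) := by
    intro p y hy
    have h1 := hsign p y hy.1 hy.2
    rw [hcoeff p y hy.1 hy.2]
    have h2 : |(fderivWithin ℝ (k p) (range I) y).det| =
        ε * (fderivWithin ℝ (k p) (range I) y).det := by
      rw [← abs_of_pos h1, abs_mul]
      rcases hε with rfl | rfl <;> simp [hk]
    rw [h2]
    simp only [smul_eq_mul, hk, Function.comp_apply, hκil _ hy.2]
    linear_combination (-(ρ p ((extChartAt I p).symm y)) * h (κ ((extChartAt I p).symm y)) *
      (fderivWithin ℝ (κ ∘ (extChartAt I p).symm) (range I) y).det) * hεε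
  have hzero' : ∀ p, ∀ y ∈ (extChartAt I p).target \ s p,
      ρ p ((extChartAt I p).symm y) * formCoeff I η p y = 0 := by
    intro p y hy
    have : (extChartAt I p).symm y ∉ U := fun h' => hy.2 ⟨hy.1, h'⟩
    rw [formCoeff_of_eq_zero (hzero _ this), mul_zero]
  have hint : ∀ p, IntegrableOn (fun z => ρ p (κi z) * h z) (k p '' s p) := by
    intro p
    rw [integrableOn_image_iff_integrableOn_abs_det_fderiv_smul _ (hsm p) (hkd p) (hkinj p)]
    have h1 : IntegrableOn (fun y => ε * (ρ p ((extChartAt I p).symm y) * formCoeff I η p y))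
      (s p) := ((hη p).mono_set inter_subset_left).const_mul ε
    refine h1.congr_fun (fun y hy => ?_) (hsm p)
    simp only [habs p y hy]
    rw [← mul_assoc, hεε, one_mul]
  have hz2 : ∀ p, ∀ z ∈ κ '' U \ k p '' s p, ρ p (κi z) * h z = 0 := by
    rintro p z ⟨⟨x, hx, rfl⟩, hz⟩
    rw [himage] at hz
    have : x ∉ (extChartAt I p).source := fun h' => hz ⟨x, ⟨hx, h'⟩, rfl⟩
    rw [hκil x hx, hρ0 p x this, zero_mul]
  have hsub : ∀ p, k p '' s p ⊆ κ '' U := fun p => by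
    rw [himage]; exact image_mono inter_subset_left
  have hint' : ∀ p, IntegrableOn (fun z => ρ p (κi z) * h z) (κ '' U) := fun p =>
    (hint p).of_forall_sdiff_eq_zero hmeasU (hz2 p)
  have hterm : ∀ p, (∫ y in (extChartAt I p).target,
      ρ p ((extChartAt I p).symm y) * formCoeff I η p y) =
      ε * ∫ z in κ '' U, ρ p (κi z) * h z := by
    intro p
    have h1 : (∫ y in (extChartAt I p).target,
        ρ p ((extChartAt I p).symm y) * formCoeff I η p y) =
        ∫ y in s p, ρ p ((extChartAt I p).symm y) * formCoeff I η p y :=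
      setIntegral_eq_of_subset_of_forall_sdiff_eq_zero (measurableSet_extChartAt_target p)
        inter_subset_left (hzero' p)
    rw [h1, setIntegral_congr_fun (hsm p) (habs p), integral_const_mul,
      ← integral_image_eq_integral_abs_det_fderiv_smul volume (hsm p) (hkd p) (hkinj p)
        (fun z => ρ p (κi z) * h z),
      setIntegral_eq_of_subset_of_forall_sdiff_eq_zero hmeasU (hsub p) (hz2 p)]
  rw [formIntegralWith_eq_sum, ← hT, Finset.sum_congr rfl fun p _ => hterm p, ← Finset.mul_sum,
    ← integral_finsetSum _ fun p _ => hint' p]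
  congr 1
  refine setIntegral_congr_fun hmeasU ?_
  rintro z ⟨x, hx, rfl⟩
  simp only [← Finset.sum_mul, hκil x hx]
  rw [sum_partition_eq_one ρ x, one_mul]

end Integration

/-! ### Chart changes and orientation -/

section ChartChange

variable {E : Type*} [NormedAddCommGroup E] [NormedSpace ℝ E] {H : Type*} [TopologicalSpace H]
  {I : ModelWithCorners ℝ E H} {M : Type*} [TopologicalSpace M] [ChartedSpace H M]

theorem det_chartChange_pos [OrientedAtlas I M] {p q : M} {y : E}
    (hy : y ∈ (extChartAt I p).target)
    (hq : (extChartAt I p).symm y ∈ (extChartAt I q).source) :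
    0 < (fderivWithin ℝ (extChartAt I q ∘ (extChartAt I p).symm) (range I) y).det :=
  OrientedAtlas.det_pos _ (chart_mem_atlas H p) _ (chart_mem_atlas H q) y ⟨hy, hq⟩

variable [IsManifold I ∞ M] {E' : Type*} [NormedAddCommGroup E'] [NormedSpace ℝ E']

theorem mdifferentiableAt_extChartAt_of_mem {q x : M} (hx : x ∈ (extChartAt I q).source) :
    MDifferentiableAt I 𝓘(ℝ, E) (extChartAt I q) x :=
  mdifferentiableAt_extChartAt (by rwa [extChartAt_source] at hx)

theorem chartFrame_eq_comp {p q : M} {y : E} (hy : y ∈ (extChartAt I p).target)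
    (hq : (extChartAt I p).symm y ∈ (extChartAt I q).source) :
    chartFrame I p y = (chartFrame I q (extChartAt I q ((extChartAt I p).symm y))).comp
      (fderivWithin ℝ (extChartAt I q ∘ (extChartAt I p).symm) (range I) y) := by
  have hu := uniqueMDiffWithinAt_range_of_mem_target hy
  have hd := differentiableWithinAt_comp_extChartAt_symm hy (mdifferentiableAt_extChartAt_of_mem hq)
  have hsub : range I ⊆ (extChartAt I q ∘ (extChartAt I p).symm) ⁻¹' range I := by
    intro z _
    simp
  have h1 := mfderivWithin_comp (I := 𝓘(ℝ, E)) (I' := 𝓘(ℝ, E)) (I'' := I) y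
    (mdifferentiableWithinAt_extChartAt_symm_range ((extChartAt I q).map_source hq))
    hd.mdifferentiableWithinAt hsub hu
  rw [mfderivWithin_eq_fderivWithin] at h1
  rw [chartFrame, chartFrame]
  refine Eq.trans (Filter.EventuallyEq.mfderivWithin_eq ?_ ?_) h1
  · filter_upwards [extChartAt_eventually_symm_mem hy
      ((isOpen_extChartAt_source q).mem_nhds hq)] with z hz
    exact ((extChartAt I q).left_inv hz).symm
  · exact ((extChartAt I q).left_inv hq).symm

theorem fderivWithin_comp_symm_eq_comp {p q : M} {y : E} (hy : y ∈ (extChartAt I p).target)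
    (hq : (extChartAt I p).symm y ∈ (extChartAt I q).source) {κ : M → E'}
    (hκ : MDifferentiableAt I 𝓘(ℝ, E') κ ((extChartAt I p).symm y)) :
    fderivWithin ℝ (κ ∘ (extChartAt I p).symm) (range I) y =
      (fderivWithin ℝ (κ ∘ (extChartAt I q).symm) (range I)
        (extChartAt I q ((extChartAt I p).symm y))).comp
      (fderivWithin ℝ (extChartAt I q ∘ (extChartAt I p).symm) (range I) y) := by
  have hx := (extChartAt I q).left_inv hq
  rw [fderivWithin_comp_extChartAt_symm hy hκ, chartFrame_eq_comp hy hq,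
    fderivWithin_comp_extChartAt_symm ((extChartAt I q).map_source hq) (by rwa [hx])]
  rw [hx]
  rfl

/-- Passing from one chart to another contributes a positive determinant, so the sign of a Jacobian
may be checked in any one chart. -/
theorem det_comp_symm_pos_iff [OrientedAtlas I M] {p q : M} {y : E}
    (hy : y ∈ (extChartAt I p).target)
    (hq : (extChartAt I p).symm y ∈ (extChartAt I q).source) {κ : M → E}
    (hκ : MDifferentiableAt I 𝓘(ℝ, E) κ ((extChartAt I p).symm y)) {ε : ℝ} :
    0 < ε * (fderivWithin ℝ (κ ∘ (extChartAt I p).symm) (range I) y).det ↔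
      0 < ε * (fderivWithin ℝ (κ ∘ (extChartAt I q).symm) (range I)
        (extChartAt I q ((extChartAt I p).symm y))).det := by
  rw [fderivWithin_comp_symm_eq_comp hy hq hκ, ContinuousLinearMap.det,
    ContinuousLinearMap.toLinearMap_comp, LinearMap.det_comp, ← mul_assoc]
  exact mul_pos_iff_of_pos_right (det_chartChange_pos hy hq)

end ChartChange

/-! ### Transformation law and integrability of form coefficients -/

section ChartIndependence

variable {n : ℕ} {H : Type*} [TopologicalSpace H]
  {I : ModelWithCorners ℝ (EuclideanSpace ℝ (Fin n)) H}
  {M : Type*} [TopologicalSpace M] [ChartedSpace H M]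

/-- Alternating forms of top degree are multiples of the determinant. -/
theorem alternatingMap_map_single (α : EuclideanSpace ℝ (Fin n) [⋀^Fin n]→ₗ[ℝ] ℝ)
    (A : EuclideanSpace ℝ (Fin n) →L[ℝ] EuclideanSpace ℝ (Fin n)) :
    (α fun i => A (EuclideanSpace.single i 1)) =
      (α fun i => EuclideanSpace.single i 1) * A.det := by
  set b := (EuclideanSpace.basisFun (Fin n) ℝ).toBasis with hb
  have hbi : ∀ i, b i = EuclideanSpace.single i 1 := fun i => by simp [hb]
  have h := AlternatingMap.eq_smul_basis_det b α
  have h1 : (α fun i => A (EuclideanSpace.single i 1)) = α b * b.det (fun i => A (b i)) := by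
    conv_lhs => rw [h]
    simp [hbi]
  rw [h1]
  have h2 : b.det (fun i => A (b i)) = A.det := by
    have := b.det_comp A.toLinearMap b
    simpa [Function.comp_def, ContinuousLinearMap.det, b.det_self] using this
  rw [h2]
  congr 2
  ext1 i
  exact hbi i

theorem formCoeff_eq_mul_det [IsManifold I ∞ M] (η : ∀ x : M, TangentSpace I x [⋀^Fin n]→ₗ[ℝ] ℝ)
    {p q : M} {y : EuclideanSpace ℝ (Fin n)} (hy : y ∈ (extChartAt I p).target)
    (hq : (extChartAt I p).symm y ∈ (extChartAt I q).source) :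
    formCoeff I η p y = formCoeff I η q (extChartAt I q ((extChartAt I p).symm y)) *
      (fderivWithin ℝ (extChartAt I q ∘ (extChartAt I p).symm) (range I) y).det := by
  rw [formCoeff_eq, chartFrame_eq_comp hy hq, formCoeff_eq, (extChartAt I q).left_inv hq]
  exact alternatingMap_map_single
    ((show EuclideanSpace ℝ (Fin n) [⋀^Fin n]→ₗ[ℝ] ℝ from η ((extChartAt I p).symm y)).compLinearMap
      (chartFrame I q (extChartAt I q ((extChartAt I p).symm y))).toLinearMap) _

/-- The coefficients of `η` in all charts are continuous. -/
def FormContinuous (I : ModelWithCorners ℝ (EuclideanSpace ℝ (Fin n)) H)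
    (η : ∀ x : M, TangentSpace I x [⋀^Fin n]→ₗ[ℝ] ℝ) : Prop :=
  ∀ p : M, ContinuousOn (formCoeff I η p) (extChartAt I p).target

/-- A partition member has compact support inside its chart domain, so the integrand is continuous
on a compact part of the target and zero on the rest. -/
theorem FormContinuous.formIntegrable [CompactSpace M] [T2Space M]
    {η : ∀ x : M, TangentSpace I x [⋀^Fin n]→ₗ[ℝ] ℝ} (hη : FormContinuous I η)
    {ρ : SmoothPartitionOfUnity M I M univ}
    (hρ : ρ.IsSubordinate fun x => (chartAt H x).source) : FormIntegrable ρ η := by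
  intro p
  have hsub : tsupport (ρ p) ⊆ (extChartAt I p).source := by
    rw [extChartAt_source]; exact hρ p
  have hK : IsCompact (extChartAt I p '' tsupport (ρ p)) :=
    (isClosed_tsupport _).isCompact.image_of_continuousOn
      ((continuousOn_extChartAt p).mono hsub)
  have hKsub : extChartAt I p '' tsupport (ρ p) ⊆ (extChartAt I p).target := by
    rintro _ ⟨x, hx, rfl⟩
    exact (extChartAt I p).map_source (hsub hx)
  have hc : ContinuousOn (fun y => ρ p ((extChartAt I p).symm y) * formCoeff I η p y)
      (extChartAt I p).target :=
    ((ρ p).contMDiff.continuous.comp_continuousOn (continuousOn_extChartAt_symm p)).mul (hη p)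
  have h1 : IntegrableOn (fun y => ρ p ((extChartAt I p).symm y) * formCoeff I η p y)
      (extChartAt I p '' tsupport (ρ p)) := (hc.mono hKsub).integrableOn_compact hK
  refine h1.of_forall_sdiff_eq_zero (measurableSet_extChartAt_target p) ?_
  rintro y ⟨hy, hyK⟩
  have : ρ p ((extChartAt I p).symm y) = 0 := by
    by_contra h0
    exact hyK ⟨_, subset_closure h0, (extChartAt I p).right_inv hy⟩
  rw [this, zero_mul]

-- Cutting a form off by an indicator can destroy continuity but not integrability. The degree
-- computation splits a form in this way, which is why the change of variables assumes only
-- `FormIntegrable`.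
open Classical in
theorem FormIntegrable.indicator {ρ : SmoothPartitionOfUnity M I M univ}
    {η : ∀ x : M, TangentSpace I x [⋀^Fin n]→ₗ[ℝ] ℝ} (hη : FormIntegrable ρ η)
    {U : Set M} (hU : IsOpen U) :
    FormIntegrable ρ (fun x => (if x ∈ U then (1 : ℝ) else 0) • η x) := by
  intro p
  have h1 := ((hη p).mono_set (inter_subset_left (t := (extChartAt I p).symm ⁻¹' U)))
  refine IntegrableOn.of_forall_sdiff_eq_zero
    (s := (extChartAt I p).target ∩ (extChartAt I p).symm ⁻¹' U) ?_
    (measurableSet_extChartAt_target p) ?_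
  · refine h1.congr_fun (fun y hy => ?_) (measurableSet_target_inter_symm_preimage p hU)
    have : (extChartAt I p).symm y ∈ U := hy.2
    simp only [formCoeff_smul, if_pos this, one_mul]
  · rintro y ⟨hy, hy'⟩
    have : (extChartAt I p).symm y ∉ U := fun h => hy' ⟨hy, h⟩
    simp only [formCoeff_smul, if_neg this, zero_mul, mul_zero]

/-- A form that vanishes off the domain of a chart is integrated in that chart. -/
theorem formIntegralWith_eq_integral_target [IsManifold I ∞ M] [CompactSpace M]
    [OrientedAtlas I M] {ρ : SmoothPartitionOfUnity M I M univ}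
    (hρ : ρ.IsSubordinate fun x => (chartAt H x).source)
    {η : ∀ x : M, TangentSpace I x [⋀^Fin n]→ₗ[ℝ] ℝ} (hη : FormIntegrable ρ η) (q : M)
    (hzero : ∀ x ∉ (extChartAt I q).source, η x = 0) :
    formIntegralWith I ρ η = ∫ y in (extChartAt I q).target, formCoeff I η q y := by
  rw [formIntegralWith_eq_integral_image hρ hη (isOpen_extChartAt_source q)
    (extChartAt I q).injOn (fun x hx => mdifferentiableAt_extChartAt_of_mem hx) (Or.inl rfl)
    (h := formCoeff I η q) (fun p y hy hq => by
      rw [one_mul]; exact det_chartChange_pos hy hq)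
    (fun p y hy hq => formCoeff_eq_mul_det η hy hq) hzero, one_mul,
    (extChartAt I q).image_source_eq_target]

end ChartIndependence

end

/-! ### Regularity of derivatives in a fixed chart -/

section VectorValued

variable {E : Type*} [NormedAddCommGroup E] [NormedSpace ℝ E] {H : Type*} [TopologicalSpace H]
  {I : ModelWithCorners ℝ E H} {M : Type*} [TopologicalSpace M] [ChartedSpace H M]
  [IsManifold I ∞ M] {E' : Type*} [NormedAddCommGroup E'] [NormedSpace ℝ E']

theorem ContMDiffAt.contDiffWithinAt_comp_extChartAt_symm {p : M} {y : E}
    (hy : y ∈ (extChartAt I p).target) {k : ℕ∞} {G : M → E'}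
    (hG : ContMDiffAt I 𝓘(ℝ, E') k G ((extChartAt I p).symm y)) :
    ContDiffWithinAt ℝ k (G ∘ (extChartAt I p).symm) (range I) y := by
  rw [← contMDiffWithinAt_iff_contDiffWithinAt]
  exact hG.comp_contMDiffWithinAt y
    ((contMDiffWithinAt_extChartAt_symm_range (n := ∞) p hy).of_le (by exact_mod_cast le_top))

/-- Both factors refer to the preferred chart at the moving point, which may jump, so neither need
be continuous alone. Their composite is the derivative of `G` read in the single chart at `p`. -/
theorem ContMDiffAt.continuousWithinAt_mfderiv_comp_chartFrame {p : M} {y : E}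
    (hy : y ∈ (extChartAt I p).target) {k : ℕ∞} (hk : 1 ≤ k) {G : M → E'}
    (hG : ContMDiffAt I 𝓘(ℝ, E') k G ((extChartAt I p).symm y)) :
    ContinuousWithinAt (fun z => ContinuousLinearMap.comp
      (modelDeriv I 𝓘(ℝ, E') G ((extChartAt I p).symm z)) (chartFrame I p z))
      (extChartAt I p).target y := by
  have hG1 : ContMDiffAt I 𝓘(ℝ, E') 1 G ((extChartAt I p).symm y) :=
    hG.of_le (by exact_mod_cast hk)
  have h1 := (hG.contDiffWithinAt_comp_extChartAt_symm hy).fderivWithin_right (m := 0)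
    I.uniqueDiffOn (by simpa using hk) (extChartAt_target_subset_range p hy)
  have h2 := h1.continuousWithinAt.mono (extChartAt_target_subset_range (I := I) p)
  have h3 : ∀ᶠ z in 𝓝[(extChartAt I p).target] y,
      MDifferentiableAt I 𝓘(ℝ, E') G ((extChartAt I p).symm z) := by
    have h4 := ((contMDiffAt_iff_contMDiffAt_nhds (by simp)).1 hG1).mono fun x hx => hx.mdifferentiableAt one_ne_zero
    exact continuousOn_extChartAt_symm p y hy h4
  refine h2.congr_of_eventuallyEq ?_ ?_
  · filter_upwards [h3, self_mem_nhdsWithin] with z hz hz'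
    exact (fderivWithin_comp_extChartAt_symm hz' hz).symm
  · exact (fderivWithin_comp_extChartAt_symm hy (hG1.mdifferentiableAt one_ne_zero)).symm

end VectorValued

/-! ### Smooth maps to a quotient by a lattice and their local lifts -/

section QuotientMaps

theorem eventually_eq_of_mem_discrete {V : Type*} [NormedAddCommGroup V] (Γ : Submodule ℤ V)
    [DiscreteTopology Γ] {X : Type*} [TopologicalSpace X] {u : X → V} {x : X}
    (hu : ContinuousAt u x) (hmem : ∀ᶠ z in 𝓝 x, u z ∈ Γ) : ∀ᶠ z in 𝓝 x, u z = u x := by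
  obtain ⟨U, hU, hUx⟩ :=
    (discreteTopology_subtype_iff'.1 ‹DiscreteTopology Γ›) (u x) hmem.self_of_nhds
  have hxU : u x ∈ U := by
    have : u x ∈ U ∩ Γ := by rw [hUx]; rfl
    exact this.1
  filter_upwards [hu.preimage_mem_nhds (hU.mem_nhds hxU), hmem] with z hz hzΓ
  have : u z ∈ U ∩ (Γ : Set V) := ⟨hz, hzΓ⟩
  rwa [hUx] at this

variable {V : Type*} [NormedAddCommGroup V]
  (Γ : Submodule ℤ V) [DiscreteTopology Γ]

/-- Chart and projection are inverse modulo `Γ`, so `e ∘ mkQ - id` is continuous near `y` with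
values in a discrete group, hence locally constant. -/
theorem chart_mkQ_eventually {e : OpenPartialHomeomorph (V ⧸ Γ) V} (he : e ∈ atlas V (V ⧸ Γ))
    {y : V} (hy : Γ.mkQ y ∈ e.source) :
    ∀ᶠ z in 𝓝 y, e (Γ.mkQ z) = z + (e (Γ.mkQ y) - y) := by
  have hc : ContinuousAt (Γ.mkQ : V → V ⧸ Γ) y := (isLocalHomeomorph_mkQ Γ).continuous.continuousAt
  have hu : ContinuousAt (fun z => e (Γ.mkQ z) - z) y :=
    ((e.continuousAt hy).comp hc).sub continuousAt_id
  have hmem : ∀ᶠ z in 𝓝 y, e (Γ.mkQ z) - z ∈ Γ := by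
    filter_upwards [hc (e.open_source.mem_nhds hy)] with z hz
    rw [← Submodule.Quotient.eq]
    change Γ.mkQ _ = Γ.mkQ _
    rw [← mkQ_chart_symm Γ e he, e.left_inv hz]
  filter_upwards [eventually_eq_of_mem_discrete Γ hu hmem] with z hz
  rw [← hz]; abel

variable [NormedSpace ℝ V]

theorem hasMFDerivAt_mkQ (y : V) :
    HasMFDerivAt 𝓘(ℝ, V) 𝓘(ℝ, V) (Γ.mkQ : V → V ⧸ Γ) y (ContinuousLinearMap.id ℝ V) := by
  refine ⟨(isLocalHomeomorph_mkQ Γ).continuous.continuousAt, ?_⟩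
  have h := chart_mkQ_eventually Γ (chart_mem_atlas V (Γ.mkQ y)) (mem_chart_source V (Γ.mkQ y))
  have h2 : HasFDerivAt (fun z => z + (chartAt V (Γ.mkQ y) (Γ.mkQ y) - y))
    (ContinuousLinearMap.id ℝ V) y := (hasFDerivAt_id y).add_const _
  simp only [writtenInExtChartAt, extChartAt_self_eq, modelWithCornersSelf_coe, Set.range_id]
  exact (h2.congr_of_eventuallyEq h).hasFDerivWithinAt

theorem contMDiff_mkQ : ContMDiff 𝓘(ℝ, V) 𝓘(ℝ, V) ∞ (Γ.mkQ : V → V ⧸ Γ) := by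
  intro y
  rw [contMDiffAt_iff]
  refine ⟨(isLocalHomeomorph_mkQ Γ).continuous.continuousAt, ?_⟩
  have h := chart_mkQ_eventually Γ (chart_mem_atlas V (Γ.mkQ y)) (mem_chart_source V (Γ.mkQ y))
  have h2 : ContDiffAt ℝ ∞ (fun z => z + (chartAt V (Γ.mkQ y) (Γ.mkQ y) - y)) y :=
    contDiffAt_id.add contDiffAt_const
  simp only [extChartAt_self_eq, modelWithCornersSelf_coe, Set.range_id, contDiffWithinAt_univ]
  exact h2.congr_of_eventuallyEq h

variable {Γ} {E : Type*} [NormedAddCommGroup E] [NormedSpace ℝ E] {H : Type*} [TopologicalSpace H]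
  {I : ModelWithCorners ℝ E H} {M : Type*} [TopologicalSpace M] [ChartedSpace H M]

/-- The projection has derivative the identity, so passing to a local lift does not change
derivatives. -/
theorem mfderiv_eq_of_local_lift {g : M → V ⧸ Γ} {G : M → V} {x : M}
    (hG : MDifferentiableAt I 𝓘(ℝ, V) G x) (h : ∀ᶠ x' in 𝓝 x, Γ.mkQ (G x') = g x') :
    (modelDeriv I 𝓘(ℝ, V) g x) = modelDeriv I 𝓘(ℝ, V) G x := by
  have h1 := (hasMFDerivAt_mkQ Γ (G x)).comp x hG.hasMFDerivAt
  have h2 : HasMFDerivAt I 𝓘(ℝ, V) g x _ :=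
    h1.congr_of_eventuallyEq (h.mono fun _ hx' => hx'.symm)
  rw [modelDeriv, h2.mfderiv]
  rfl

theorem contMDiffAt_of_local_lift {g : M → V ⧸ Γ} {G : M → V} {x : M}
    (hG : ContMDiffAt I 𝓘(ℝ, V) ∞ G x) (h : ∀ᶠ x' in 𝓝 x, Γ.mkQ (G x') = g x') :
    ContMDiffAt I 𝓘(ℝ, V) ∞ g x :=
  ((contMDiff_mkQ Γ (G x)).comp x hG).congr_of_eventuallyEq (h.mono fun _ hx' => hx'.symm)

/-- A chart of the quotient is a local section of the projection. Composing with it gives a lift,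
and adding the lattice vector `v - e (g x)` corrects its value at `x`. -/
theorem exists_local_lift {g : M → V ⧸ Γ} (hg : ContMDiff I 𝓘(ℝ, V) ∞ g) {x : M} {v : V}
    (hv : Γ.mkQ v = g x) :
    ∃ U : Set M, IsOpen U ∧ x ∈ U ∧ ∃ G : M → V, G x = v ∧
      (∀ x' ∈ U, ContMDiffAt I 𝓘(ℝ, V) ∞ G x') ∧ ∀ x' ∈ U, Γ.mkQ (G x') = g x' := by
  set e := chartAt V (g x) with he
  have hes : g x ∈ e.source := mem_chart_source V (g x)
  have hsymm : ∀ q ∈ e.source, Γ.mkQ (e q) = q := fun q hq => by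
    rw [← mkQ_chart_symm Γ e (chart_mem_atlas V (g x)), e.left_inv hq]
  refine ⟨g ⁻¹' e.source, e.open_source.preimage hg.continuous, hes,
    fun x' => e (g x') + (v - e (g x)), by simp, fun x' hx' => ?_, fun x' hx' => ?_⟩
  · have h1 : ContMDiffAt 𝓘(ℝ, V) 𝓘(ℝ, V) ∞ (extChartAt 𝓘(ℝ, V) (g x)) (g x') :=
      contMDiffAt_extChartAt' hx'
    have h2 : ContMDiffAt I 𝓘(ℝ, V) ∞ (fun x' => e (g x')) x' := h1.comp x' (hg x')
    exact h2.add contMDiffAt_const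
  · have h3 : v - e (g x) ∈ Γ := by
      rw [← Submodule.Quotient.eq]
      change Γ.mkQ _ = Γ.mkQ _
      rw [hv, hsymm _ hes]
    have h4 : Γ.mkQ (v - e (g x)) = 0 := (Submodule.Quotient.mk_eq_zero Γ).2 h3
    rw [map_add, hsymm _ hx', h4, add_zero]

theorem exists_local_lift_at {g : M → V ⧸ Γ} (hg : ContMDiff I 𝓘(ℝ, V) ∞ g) (x : M) :
    ∃ G : M → V, ContMDiffAt I 𝓘(ℝ, V) ∞ G x ∧ ∀ᶠ x' in 𝓝 x, Γ.mkQ (G x') = g x' := by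
  obtain ⟨v, hv⟩ := Γ.mkQ_surjective (g x)
  obtain ⟨U, hU, hxU, G, -, hG, hGg⟩ := exists_local_lift hg hv
  exact ⟨G, hG x hxU, Filter.eventually_of_mem (hU.mem_nhds hxU) hGg⟩

theorem ContMDiff.add_const_quotient {g : M → V ⧸ Γ} (hg : ContMDiff I 𝓘(ℝ, V) ∞ g) (c : V ⧸ Γ) :
    ContMDiff I 𝓘(ℝ, V) ∞ (fun x => g x + c) := by
  intro x
  obtain ⟨c, rfl⟩ := Γ.mkQ_surjective c
  obtain ⟨G, hG, hGg⟩ := exists_local_lift_at hg x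
  exact contMDiffAt_of_local_lift (hG.add (contMDiffAt_const (c := c)))
    (hGg.mono fun x' hx' => by
      rw [← hx']; exact map_add Γ.mkQ (G x') c)

theorem mfderiv_add_const_quotient {g : M → V ⧸ Γ} (hg : ContMDiff I 𝓘(ℝ, V) ∞ g) (c : V ⧸ Γ)
    (x : M) : (modelDeriv I 𝓘(ℝ, V) (fun x => g x + c) x) =
      (modelDeriv I 𝓘(ℝ, V) g x) := by
  obtain ⟨c, rfl⟩ := Γ.mkQ_surjective c
  obtain ⟨G, hG, hGg⟩ := exists_local_lift_at hg x
  have hGd : MDifferentiableAt I 𝓘(ℝ, V) G x := hG.mdifferentiableAt (by simp)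
  have h1 := (hGd.hasMFDerivAt.add (hasMFDerivAt_const c x))
  rw [mfderiv_eq_of_local_lift hGd hGg, mfderiv_eq_of_local_lift (G := G + fun _ => c)
    h1.mdifferentiableAt (hGg.mono fun x' hx' => by
      rw [← hx']; exact map_add Γ.mkQ (G x') c), modelDeriv, h1.mfderiv]
  exact add_zero _

theorem ContMDiff.comp_quotient {g : M → V ⧸ Γ} (hg : ContMDiff I 𝓘(ℝ, V) ∞ g) {Φ : V ⧸ Γ → ℝ}
    (hΦ : ContDiff ℝ 1 (Φ ∘ Γ.mkQ)) : ContMDiff I 𝓘(ℝ, ℝ) 1 (Φ ∘ g) := by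
  intro x
  obtain ⟨G, hG, hGg⟩ := exists_local_lift_at hg x
  refine ((hΦ.contMDiff (G x)).comp x (hG.of_le (by exact_mod_cast le_top))).congr_of_eventuallyEq
    (hGg.mono fun x' hx' => ?_)
  simp [← hx']

theorem mfderiv_comp_quotient {g : M → V ⧸ Γ} (hg : ContMDiff I 𝓘(ℝ, V) ∞ g) {Φ : V ⧸ Γ → ℝ}
    (hΦ : ContDiff ℝ 1 (Φ ∘ Γ.mkQ)) {x : M} {v : V} (hv : Γ.mkQ v = g x) :
    (modelDeriv I 𝓘(ℝ, ℝ) (Φ ∘ g) x) =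
      (fderiv ℝ (Φ ∘ Γ.mkQ) v).comp (modelDeriv I 𝓘(ℝ, V) g x) := by
  obtain ⟨U, hU, hxU, G, hGx, hG, hGg⟩ := exists_local_lift hg hv
  have hGg' : ∀ᶠ x' in 𝓝 x, Γ.mkQ (G x') = g x' := Filter.eventually_of_mem (hU.mem_nhds hxU) hGg
  have hGd : MDifferentiableAt I 𝓘(ℝ, V) G x := (hG x hxU).mdifferentiableAt (by simp)
  rw [mfderiv_eq_of_local_lift hGd hGg']
  have hd : HasFDerivAt (Φ ∘ Γ.mkQ) (fderiv ℝ (Φ ∘ Γ.mkQ) (G x)) (G x) :=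
    (hΦ.differentiable one_ne_zero (G x)).hasFDerivAt
  have h1 := hd.hasMFDerivAt.comp x hGd.hasMFDerivAt
  have h2 : HasMFDerivAt I 𝓘(ℝ, ℝ) (Φ ∘ g) x _ := h1.congr_of_eventuallyEq
    (hGg'.mono fun x' hx' => by simp [← hx'])
  rw [modelDeriv, h2.mfderiv, hGx]
  rfl

theorem continuousOn_mfderiv_comp_chartFrame [IsManifold I ∞ M] {g : M → V ⧸ Γ}
    (hg : ContMDiff I 𝓘(ℝ, V) ∞ g) (p : M) :
    ContinuousOn (fun z => ContinuousLinearMap.comp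
      (modelDeriv I 𝓘(ℝ, V) g ((extChartAt I p).symm z)) (chartFrame I p z))
      (extChartAt I p).target := by
  intro y hy
  obtain ⟨v, hv⟩ := Γ.mkQ_surjective (g ((extChartAt I p).symm y))
  obtain ⟨U, hU, hxU, G, hGx, hG, hGg⟩ := exists_local_lift hg hv
  have h3 : ∀ x ∈ U, (modelDeriv I 𝓘(ℝ, V) g x) = modelDeriv I 𝓘(ℝ, V) G x :=
    fun x hx => mfderiv_eq_of_local_lift ((hG x hx).mdifferentiableAt (by simp))
      (Filter.eventually_of_mem (hU.mem_nhds hx) hGg)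
  refine ((hG _ hxU).continuousWithinAt_mfderiv_comp_chartFrame (k := ⊤) hy
    le_top).congr_of_eventuallyEq ?_ ?_
  · filter_upwards [continuousOn_extChartAt_symm p y hy (hU.mem_nhds hxU)] with z hz
    rw [h3 _ hz]
  · rw [h3 _ hxU]

end QuotientMaps

section

open MeasureTheory

/-! ### The divergence theorem on a half-space -/

section HalfSpace

/-- The divergence theorem for a compactly supported vector field on a half-space. -/
theorem integral_divergence_halfSpace {X : Fin 3 → (Fin 3 → ℝ) → ℝ} {D : (Fin 3 → ℝ) → ℝ}
    {K : Set (Fin 3 → ℝ)} (hK : IsCompact K) (hX : ∀ i, ∀ y ∉ K, X i y = 0)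
    (hD : ∀ y ∉ K, D y = 0) (hXc : ∀ i, ContinuousOn (X i) {y | 0 ≤ y 0})
    (hDc : ContinuousOn D {y | 0 ≤ y 0})
    (hXd : ∀ i y, 0 < y 0 → DifferentiableAt ℝ (X i) y)
    (hdiv : ∀ y, 0 < y 0 → ∑ i, fderiv ℝ (X i) y (Pi.single i 1) = D y) :
    ∫ y in {y : Fin 3 → ℝ | 0 ≤ y 0}, D y = -∫ z : Fin 2 → ℝ, X 0 (Fin.cons 0 z) := by
  obtain ⟨R, hR⟩ := hK.isBounded.subset_closedBall 0
  -- Every point of `K` has all coordinates below `r` in absolute value, so of the six faces of the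
  -- box `[0, r] × [-r, r]²` only the one in `y 0 = 0` can carry flux.
  set r : ℝ := max R 0 + 1 with hr
  have hr0 : 0 < r := by positivity
  have hKr : ∀ y ∈ K, ∀ i, |y i| < r := by
    intro y hy i
    have h1 := hR hy
    rw [mem_closedBall_zero_iff] at h1
    have h2 := norm_le_pi_norm y i
    rw [Real.norm_eq_abs] at h2
    have h3 := le_max_left R 0
    linarith
  set lo : Fin 3 → ℝ := Fin.cons 0 fun _ => -r with hlo
  set hi : Fin 3 → ℝ := fun _ => r with hhi
  have hle : lo ≤ hi := by
    intro i
    refine Fin.cases ?_ (fun j => ?_) i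
    · simp [hlo, hhi, hr0.le]
    · simp [hlo, hhi]; linarith
  have hsub : Icc lo hi ⊆ {y : Fin 3 → ℝ | 0 ≤ y 0} := fun y hy => by
    have := hy.1 0
    simpa [hlo] using this
  have hoff : ∀ y ∈ {y : Fin 3 → ℝ | 0 ≤ y 0} \ Icc lo hi, y ∉ K := by
    rintro y ⟨hy, hy'⟩ hyK
    apply hy'
    refine ⟨fun i => ?_, fun i => (abs_lt.1 (hKr y hyK i)).2.le⟩
    refine Fin.cases ?_ (fun j => ?_) i
    · simpa [hlo] using hy
    · simpa [hlo] using (abs_lt.1 (hKr y hyK j.succ)).1.le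
  have hmeas : MeasurableSet {y : Fin 3 → ℝ | 0 ≤ y 0} :=
    (isClosed_le continuous_const (continuous_apply 0)).measurableSet
  have h1 : ∫ y in {y : Fin 3 → ℝ | 0 ≤ y 0}, D y = ∫ y in Icc lo hi, D y :=
    setIntegral_eq_of_subset_of_forall_sdiff_eq_zero hmeas hsub fun y hy => hD y (hoff y hy)
  have hae : (Set.univ.pi fun i => Ioo (lo i) (hi i)) =ᵐ[volume] Icc lo hi :=
    Measure.univ_pi_Ioo_ae_eq_Icc
  have hIoo : ∀ y ∈ (Set.univ.pi fun i => Ioo (lo i) (hi i)), 0 < y 0 := fun y hy => by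
    simpa [hlo] using (hy 0 (mem_univ _)).1
  have hmeasI : MeasurableSet (Set.univ.pi fun i => Ioo (lo i) (hi i)) :=
    MeasurableSet.univ_pi fun i => measurableSet_Ioo
  have hDint : IntegrableOn D (Icc lo hi) := (hDc.mono hsub).integrableOn_compact isCompact_Icc
  -- The divergence is controlled only where `y 0 > 0`. It agrees there with `D`, which is
  -- continuous up to the wall, and the faces of the box are null sets.
  have hint : IntegrableOn (fun y => ∑ i, fderiv ℝ (X i) y (Pi.single i 1)) (Icc lo hi) := by
    rw [← integrableOn_congr_set_ae hae]
    exact ((integrableOn_congr_set_ae hae).2 hDint).congr_fun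
      (fun y hy => (hdiv y (hIoo y hy)).symm) hmeasI
  have key := integral_divergence_of_hasFDerivAt_off_countable' lo hi hle X
    (fun i y => fderiv ℝ (X i) y) ∅ countable_empty (fun i => (hXc i).mono hsub)
    (fun y hy i => (hXd i y (hIoo y hy.1)).hasFDerivAt) hint
  have h2 : ∫ y in Icc lo hi, D y = ∫ y in Icc lo hi, ∑ i, fderiv ℝ (X i) y (Pi.single i 1) := by
    rw [← setIntegral_congr_set hae, ← setIntegral_congr_set hae]
    exact setIntegral_congr_fun hmeasI fun y hy => (hdiv y (hIoo y hy)).symm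
  have hfront : ∀ i (z : Fin 2 → ℝ), X i (i.insertNth (hi i) z) = 0 := by
    intro i z
    refine hX i _ fun hk => ?_
    have := hKr _ hk i
    rw [Fin.insertNth_apply_same] at this
    exact absurd this (by simp [hhi, abs_of_pos hr0])
  have hback : ∀ (j : Fin 2) (z : Fin 2 → ℝ),
      X j.succ (j.succ.insertNth (lo j.succ) z) = 0 := by
    intro i z
    refine hX _ _ fun hk => ?_
    have := hKr _ hk i.succ
    rw [Fin.insertNth_apply_same] at this
    exact absurd this (by simp [hlo, abs_of_pos hr0])
  rw [h1, h2, key, Fin.sum_univ_succ]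
  simp only [hfront, hback, integral_zero, sub_zero, Finset.sum_const_zero, add_zero, zero_sub]
  congr 1
  have hfun : ∀ z : Fin 2 → ℝ, X 0 (Fin.insertNth 0 (lo 0) z) = X 0 (Fin.cons 0 z) := by
    intro z
    rw [Fin.insertNth_zero']
    simp [hlo]
  simp only [hfun]
  refine setIntegral_eq_integral_of_forall_compl_eq_zero fun z hz => hX 0 _ fun hk => hz ?_
  refine ⟨fun i => ?_, fun i => ?_⟩
  · simpa [hlo] using (abs_lt.1 (hKr _ hk i.succ)).1.le
  · simpa [hhi] using (abs_lt.1 (hKr _ hk i.succ)).2.le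

variable {E : Type*} [NormedAddCommGroup E] [NormedSpace ℝ E]

theorem hasFDerivAt_fderiv_apply {A : E → ℝ} {y : E} (hA : ContDiffAt ℝ 2 A y) (v : E) :
    HasFDerivAt (fun z => fderiv ℝ A z v)
      ((ContinuousLinearMap.apply ℝ ℝ v).comp (fderiv ℝ (fderiv ℝ A) y)) y := by
  have h1 : DifferentiableAt ℝ (fderiv ℝ A) y :=
    (hA.fderiv_right (m := 1) (by norm_num)).differentiableAt one_ne_zero
  exact (ContinuousLinearMap.apply ℝ ℝ v).hasFDerivAt.comp y h1.hasFDerivAt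

theorem hasFDerivAt_mul_minor {F A B : E → ℝ} {y : E} (hF : DifferentiableAt ℝ F y)
    (hA : ContDiffAt ℝ 2 A y) (hB : ContDiffAt ℝ 2 B y) (v w : E) :
    DifferentiableAt ℝ (fun z => F z * (fderiv ℝ A z v * fderiv ℝ B z w -
      fderiv ℝ A z w * fderiv ℝ B z v)) y ∧ ∀ u, fderiv ℝ (fun z => F z * (fderiv ℝ A z v *
      fderiv ℝ B z w - fderiv ℝ A z w * fderiv ℝ B z v)) y u =
      fderiv ℝ F y u * (fderiv ℝ A y v * fderiv ℝ B y w - fderiv ℝ A y w * fderiv ℝ B y v) +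
      F y * (fderiv ℝ (fderiv ℝ A) y u v * fderiv ℝ B y w
        + fderiv ℝ A y v * fderiv ℝ (fderiv ℝ B) y u w
        - fderiv ℝ (fderiv ℝ A) y u w * fderiv ℝ B y v
        - fderiv ℝ A y w * fderiv ℝ (fderiv ℝ B) y u v) := by
  have h := hF.hasFDerivAt.mul (((hasFDerivAt_fderiv_apply hA v).mul
    (hasFDerivAt_fderiv_apply hB w)).sub ((hasFDerivAt_fderiv_apply hA w).mul
    (hasFDerivAt_fderiv_apply hB v)))
  refine ⟨h.differentiableAt, fun u => ?_⟩
  have h' := congrArg (fun L : E →L[ℝ] ℝ => L u) h.fderiv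
  refine h'.trans ?_
  simp
  ring

/-- The divergence of the vector field `F • (∇A × ∇B)` is `det (∇F, ∇A, ∇B)`. -/
theorem sum_fderiv_mul_minor {F A B : E → ℝ} {y : E} (hF : DifferentiableAt ℝ F y)
    (hA : ContDiffAt ℝ 2 A y) (hB : ContDiffAt ℝ 2 B y) (e : Fin 3 → E) :
    ∑ k : Fin 3, fderiv ℝ (fun z => F z * (fderiv ℝ A z (e (k + 1)) * fderiv ℝ B z (e (k + 2)) -
      fderiv ℝ A z (e (k + 2)) * fderiv ℝ B z (e (k + 1)))) y (e k) =
      (Matrix.of fun i j => ![fderiv ℝ F y, fderiv ℝ A y, fderiv ℝ B y] j (e i)).det := by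
  -- The field `∇A × ∇B` is divergence free: its second-derivative terms cancel by symmetry.
  have hsA : IsSymmSndFDerivAt ℝ A y := hA.isSymmSndFDerivAt (by simp)
  have hsB : IsSymmSndFDerivAt ℝ B y := hB.isSymmSndFDerivAt (by simp)
  simp only [(hasFDerivAt_mul_minor hF hA hB _ _).2, Fin.sum_univ_three, Matrix.det_fin_three]
  have e1 : (0 : Fin 3) + 1 = 1 := rfl
  have e2 : (0 : Fin 3) + 2 = 2 := rfl
  have e3 : (1 : Fin 3) + 1 = 2 := rfl
  have e4 : (1 : Fin 3) + 2 = 0 := rfl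
  have e5 : (2 : Fin 3) + 1 = 0 := rfl
  have e6 : (2 : Fin 3) + 2 = 1 := rfl
  rw [e1, e2, e3, e4, e5, e6]
  rw [hsA (e 1) (e 0), hsA (e 2) (e 0), hsA (e 2) (e 1), hsB (e 1) (e 0), hsB (e 2) (e 0),
    hsB (e 2) (e 1)]
  simp
  ring

end HalfSpace

/-! ### Wedge products of covectors -/

section RowForm

variable {E : Type*} [NormedAddCommGroup E] [NormedSpace ℝ E] {n : ℕ}

/-- The `n`-form `L₁ ∧ ⋯ ∧ Lₙ`. -/
noncomputable def rowForm (L : Fin n → E →L[ℝ] ℝ) : E [⋀^Fin n]→ₗ[ℝ] ℝ :=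
  Matrix.detRowAlternating.compLinearMap (LinearMap.pi fun j => (L j).toLinearMap)

theorem rowForm_apply (L : Fin n → E →L[ℝ] ℝ) (v : Fin n → E) :
    rowForm L v = (Matrix.of fun i j => L j (v i)).det := rfl

theorem rowForm_eq_zero_of_eq_zero (L : Fin n → E →L[ℝ] ℝ) {j : Fin n} (hj : L j = 0) :
    rowForm L = 0 := by
  ext v
  rw [rowForm_apply]
  exact Matrix.det_eq_zero_of_column_eq_zero j fun i => by simp [hj]

theorem rowForm_cons_sum {ι : Type*} (s : Finset ι) (l : ι → E →L[ℝ] ℝ) (a b : E →L[ℝ] ℝ) :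
    rowForm ![∑ k ∈ s, l k, a, b] = ∑ k ∈ s, rowForm ![l k, a, b] := by
  ext v
  rw [alternatingMap_sum_apply]
  simp [rowForm_apply, Matrix.det_fin_three, Finset.sum_sub_distrib, Finset.sum_add_distrib,
    ← Finset.sum_mul, ← Finset.mul_sum]

variable {H : Type*} [TopologicalSpace H]
  {I : ModelWithCorners ℝ (EuclideanSpace ℝ (Fin n)) H}
  {M : Type*} [TopologicalSpace M] [ChartedSpace H M]

theorem formCoeff_smul_rowForm (c : M → ℝ) (L : M → Fin n → EuclideanSpace ℝ (Fin n) →L[ℝ] ℝ)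
    (p : M) (y : EuclideanSpace ℝ (Fin n)) :
    formCoeff I (fun x => c x • rowForm (L x)) p y = c ((extChartAt I p).symm y) *
      (Matrix.of fun i j => (L ((extChartAt I p).symm y) j)
        (chartFrame I p y (EuclideanSpace.single i 1))).det := rfl

theorem formCoeff_rowForm (L : M → Fin n → EuclideanSpace ℝ (Fin n) →L[ℝ] ℝ)
    (p : M) (y : EuclideanSpace ℝ (Fin n)) :
    formCoeff I (fun x => rowForm (L x)) p y =
      (Matrix.of fun i j => (L ((extChartAt I p).symm y) j)
        (chartFrame I p y (EuclideanSpace.single i 1))).det := rfl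

theorem formContinuous_rowForm {L : M → Fin n → EuclideanSpace ℝ (Fin n) →L[ℝ] ℝ}
    (hL : ∀ p j, ContinuousOn (fun y => (L ((extChartAt I p).symm y) j).comp (chartFrame I p y))
      (extChartAt I p).target) :
    FormContinuous I (fun x => rowForm (L x)) := by
  intro p
  simp only [funext (formCoeff_rowForm (I := I) L p)]
  exact (Continuous.matrix_det continuous_id).comp_continuousOn (continuousOn_pi.2 fun i =>
    continuousOn_pi.2 fun j => (hL p j).clm_apply continuousOn_const)

theorem FormContinuous.smul {η : ∀ x : M, TangentSpace I x [⋀^Fin n]→ₗ[ℝ] ℝ}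
    (hη : FormContinuous I η) {c : M → ℝ} (hc : Continuous c) :
    FormContinuous I (fun x => c x • η x) := fun p =>
  (hc.comp_continuousOn (continuousOn_extChartAt_symm p)).mul (hη p)

end RowForm

/-! ### Interior points of a chart -/

section InteriorLift

variable {E : Type*} [NormedAddCommGroup E] [NormedSpace ℝ E] {H : Type*} [TopologicalSpace H]
  {I : ModelWithCorners ℝ E H} {M : Type*} [TopologicalSpace M] [ChartedSpace H M]

theorem eventually_mem_target_of_range_mem_nhds {q : M} {y : E}
    (hy : y ∈ (extChartAt I q).target) (hr : range I ∈ 𝓝 y) :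
    ∀ᶠ z in 𝓝 y, z ∈ (extChartAt I q).target := by
  have h := extChartAt_target_mem_nhdsWithin_of_mem hy
  rwa [nhdsWithin_eq_nhds.2 hr] at h

/-- A point of the range outside the target lies off the closed set `K`, and the function vanishes
in a neighbourhood of it. This justifies extending chart expressions by zero to the whole
half-space. -/
theorem continuousOn_range_of_eq_zero_off_compact {F : E → ℝ} {q : M} {K : Set E}
    (hF : ContinuousOn F (extChartAt I q).target) (hK : IsCompact K)
    (hKt : K ⊆ (extChartAt I q).target) (hz : ∀ y ∉ K, F y = 0) : ContinuousOn F (range I) := by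
  intro y hy
  by_cases hyt : y ∈ (extChartAt I q).target
  · exact (hF y hyt).mono_of_mem_nhdsWithin (extChartAt_target_mem_nhdsWithin_of_mem hyt)
  · have h1 : ∀ᶠ z in 𝓝 y, F z = 0 := by
      filter_upwards [hK.isClosed.isOpen_compl.mem_nhds fun h => hyt (hKt h)] with z hz'
      exact hz z hz'
    exact (continuousAt_const.congr (h1.mono fun z hz => hz.symm)).continuousWithinAt

variable [IsManifold I ∞ M] {V : Type*} [NormedAddCommGroup V] [NormedSpace ℝ V]
  {Γ : Submodule ℤ V} [DiscreteTopology Γ]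

/-- At an interior point, a smooth map to `V ⧸ Γ` has a smooth local lift in a chart. -/
theorem exists_chart_lift {g : M → V ⧸ Γ} (hg : ContMDiff I 𝓘(ℝ, V) ∞ g) {q : M} {y : E}
    (hy : y ∈ (extChartAt I q).target) (hr : range I ∈ 𝓝 y) {v : V}
    (hv : Γ.mkQ v = g ((extChartAt I q).symm y)) :
    ∃ G : E → V, G y = v ∧ ContDiffAt ℝ ∞ G y ∧ ∀ᶠ z in 𝓝 y,
      Γ.mkQ (G z) = g ((extChartAt I q).symm z) ∧
      (modelDeriv I 𝓘(ℝ, V) g ((extChartAt I q).symm z)).comp (chartFrame I q z) =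
        fderiv ℝ G z := by
  obtain ⟨U, hU, hxU, G, hGx, hG, hGg⟩ := exists_local_lift hg hv
  have hsm : ∀ᶠ z in 𝓝 y, (extChartAt I q).symm z ∈ U := by
    have h := extChartAt_eventually_symm_mem hy (hU.mem_nhds hxU)
    rwa [nhdsWithin_eq_nhds.2 hr] at h
  refine ⟨G ∘ (extChartAt I q).symm, hGx, ?_, ?_⟩
  · exact (ContMDiffAt.contDiffWithinAt_comp_extChartAt_symm (k := ⊤) hy (hG _ hxU)).contDiffAt hr
  · filter_upwards [hsm, eventually_mem_target_of_range_mem_nhds hy hr,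
      eventually_eventually_nhds.2 hr] with z hz hzt hzr
    have hd : MDifferentiableAt I 𝓘(ℝ, V) G ((extChartAt I q).symm z) :=
      (hG _ hz).mdifferentiableAt (by simp)
    refine ⟨hGg _ hz, ?_⟩
    rw [mfderiv_eq_of_local_lift hd (Filter.eventually_of_mem (hU.mem_nhds hz) hGg),
      ← fderivWithin_comp_extChartAt_symm hzt hd, fderivWithin_of_mem_nhds (s := range I) hzr]

theorem differentiableAt_comp_symm_of_range_mem_nhds {E' : Type*} [NormedAddCommGroup E']
    [NormedSpace ℝ E'] {f : M → E'} {q : M} {y : E}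
    (hy : y ∈ (extChartAt I q).target) (hr : range I ∈ 𝓝 y)
    (hf : MDifferentiableAt I 𝓘(ℝ, E') f ((extChartAt I q).symm y)) :
    DifferentiableAt ℝ (f ∘ (extChartAt I q).symm) y ∧
      (modelDeriv I 𝓘(ℝ, E') f ((extChartAt I q).symm y)).comp (chartFrame I q y) =
        fderiv ℝ (f ∘ (extChartAt I q).symm) y := by
  refine ⟨(differentiableWithinAt_comp_extChartAt_symm hy hf).differentiableAt hr, ?_⟩
  rw [← fderivWithin_comp_extChartAt_symm hy hf, fderivWithin_of_mem_nhds hr]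

end InteriorLift

/-! ### Stokes' theorem in one chart -/

section ChartStokes

variable {M : Type*} [TopologicalSpace M] [ChartedSpace (EuclideanHalfSpace 3) M]
  {V : Type*} [NormedAddCommGroup V] [NormedSpace ℝ V]
  {Γ : Submodule ℤ V} [DiscreteTopology Γ]

/-- The 3-form `df ∧ g*(a ∧ b)`, where `a` and `b` are linear functionals of `V`. -/
noncomputable def wedgeForm (f : M → ℝ) (g : M → V ⧸ Γ) (a b : V →L[ℝ] ℝ) (x : M) :
    TangentSpace (𝓡∂ 3) x [⋀^Fin 3]→ₗ[ℝ] ℝ :=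
  rowForm ![modelDeriv (𝓡∂ 3) 𝓘(ℝ, ℝ) f x, a.comp (modelDeriv (𝓡∂ 3) 𝓘(ℝ, V) g x),
    b.comp (modelDeriv (𝓡∂ 3) 𝓘(ℝ, V) g x)]

/-- The partial derivatives of `a ∘ g` in the chart at `q`. -/
noncomputable def partialDeriv (g : M → V ⧸ Γ) (a : V →L[ℝ] ℝ) (q : M) (k : Fin 3)
    (y : EuclideanSpace ℝ (Fin 3)) : ℝ :=
  a (modelDeriv (𝓡∂ 3) 𝓘(ℝ, V) g ((extChartAt (𝓡∂ 3) q).symm y)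
    (chartFrame (𝓡∂ 3) q y (EuclideanSpace.single k 1)))

open Classical in
/-- The vector field `f • (∇a × ∇b)` in the chart at `q`, extended by zero. -/
noncomputable def wedgeField (f : M → ℝ) (g : M → V ⧸ Γ) (a b : V →L[ℝ] ℝ) (q : M) (k : Fin 3)
    (y : EuclideanSpace ℝ (Fin 3)) : ℝ :=
  (if y ∈ (extChartAt (𝓡∂ 3) q).target then f ((extChartAt (𝓡∂ 3) q).symm y) else 0) *
    (partialDeriv g a q (k + 1) y * partialDeriv g b q (k + 2) y -
      partialDeriv g a q (k + 2) y * partialDeriv g b q (k + 1) y)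

/-- The embedding of the plane as the boundary of the half-space. -/
noncomputable def planeIncl (z : EuclideanSpace ℝ (Fin 2)) : EuclideanSpace ℝ (Fin 3) :=
  WithLp.toLp 2 (Fin.cons 0 z.ofLp)

theorem continuousOn_partialDeriv [IsManifold (𝓡∂ 3) ∞ M] {g : M → V ⧸ Γ}
    (hg : ContMDiff (𝓡∂ 3) 𝓘(ℝ, V) ∞ g) (a : V →L[ℝ] ℝ) (q : M) (k : Fin 3) :
    ContinuousOn (partialDeriv g a q k) (extChartAt (𝓡∂ 3) q).target :=
  a.continuous.comp_continuousOn
    ((continuousOn_mfderiv_comp_chartFrame hg q).clm_apply continuousOn_const)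

theorem formContinuous_wedgeForm [IsManifold (𝓡∂ 3) ∞ M] {f : M → ℝ}
    (hf : ContMDiff (𝓡∂ 3) 𝓘(ℝ, ℝ) 1 f) {g : M → V ⧸ Γ}
    (hg : ContMDiff (𝓡∂ 3) 𝓘(ℝ, V) ∞ g) (a b : V →L[ℝ] ℝ) :
    FormContinuous (𝓡∂ 3) (wedgeForm f g a b) := by
  refine formContinuous_rowForm fun p j => ?_
  have h : ∀ c : V →L[ℝ] ℝ, ContinuousOn (fun y =>
      (c.comp (modelDeriv (𝓡∂ 3) 𝓘(ℝ, V) g ((extChartAt (𝓡∂ 3) p).symm y))).comp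
        (chartFrame (𝓡∂ 3) p y)) (extChartAt (𝓡∂ 3) p).target := fun c =>
    continuousOn_const.clm_comp (continuousOn_mfderiv_comp_chartFrame hg p)
  fin_cases j
  · intro y hy
    exact ContMDiffAt.continuousWithinAt_mfderiv_comp_chartFrame (k := 1) hy le_rfl (hf _)
  · exact h a
  · exact h b

theorem wedgeForm_eq_zero {f : M → ℝ} {x : M} (hx : x ∉ tsupport f) (g : M → V ⧸ Γ)
    (a b : V →L[ℝ] ℝ) : wedgeForm f g a b x = 0 := by
  refine rowForm_eq_zero_of_eq_zero _ (j := 0) ?_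
  have h : f =ᶠ[𝓝 x] fun _ => 0 := notMem_tsupport_iff_eventuallyEq.1 hx
  have h2 : HasMFDerivAt (𝓡∂ 3) 𝓘(ℝ, ℝ) f x _ :=
    (hasMFDerivAt_const (0 : ℝ) x).congr_of_eventuallyEq h
  exact h2.mfderiv

/-- **Stokes' theorem** in a chart of a manifold with boundary. -/
theorem integral_formCoeff_wedgeForm [IsManifold (𝓡∂ 3) ∞ M] [T2Space M] [CompactSpace M]
    {f : M → ℝ} (hf : ContMDiff (𝓡∂ 3) 𝓘(ℝ, ℝ) 1 f) {g : M → V ⧸ Γ}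
    (hg : ContMDiff (𝓡∂ 3) 𝓘(ℝ, V) ∞ g) (a b : V →L[ℝ] ℝ) {q : M}
    (hq : tsupport f ⊆ (extChartAt (𝓡∂ 3) q).source) :
    ∫ y in (extChartAt (𝓡∂ 3) q).target, formCoeff (𝓡∂ 3) (wedgeForm f g a b) q y =
      -∫ z, wedgeField f g a b q 0 (planeIncl z) := by
  classical
  set T := (extChartAt (𝓡∂ 3) q).target with hT
  set ψ := (extChartAt (𝓡∂ 3) q).symm with hψ
  have hTr : T ⊆ range (𝓡∂ 3) := extChartAt_target_subset_range q
  set K := extChartAt (𝓡∂ 3) q '' tsupport f with hK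
  have hKc : IsCompact K := (isClosed_tsupport f).isCompact.image_of_continuousOn
    ((continuousOn_extChartAt q).mono hq)
  have hKT : K ⊆ T := by
    rintro _ ⟨x, hx, rfl⟩
    exact (extChartAt (𝓡∂ 3) q).map_source (hq hx)
  have hψK : ∀ y ∈ T, y ∉ K → ψ y ∉ tsupport f := fun y hy hyK h =>
    hyK ⟨ψ y, h, (extChartAt (𝓡∂ 3) q).right_inv hy⟩
  have hX0 : ∀ i, ∀ y ∉ K, wedgeField f g a b q i y = 0 := by
    intro i y hy
    rw [wedgeField]
    split_ifs with h
    · rw [image_eq_zero_of_notMem_tsupport (hψK y h hy), zero_mul]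
    · rw [zero_mul]
  set D : EuclideanSpace ℝ (Fin 3) → ℝ := fun y =>
    if y ∈ T then formCoeff (𝓡∂ 3) (wedgeForm f g a b) q y else 0 with hD
  have hD0 : ∀ y ∉ K, D y = 0 := by
    intro y hy
    simp only [hD]
    split_ifs with h
    · exact formCoeff_of_eq_zero (wedgeForm_eq_zero (hψK y h hy) g a b)
    · rfl
  have hXc : ∀ i, ContinuousOn (wedgeField f g a b q i) (range (𝓡∂ 3)) := by
    intro i
    refine continuousOn_range_of_eq_zero_off_compact ?_ hKc hKT (hX0 i)
    have h1 : ContinuousOn (fun y => f (ψ y) *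
        (partialDeriv g a q (i + 1) y * partialDeriv g b q (i + 2) y -
          partialDeriv g a q (i + 2) y * partialDeriv g b q (i + 1) y)) T :=
      (hf.continuous.comp_continuousOn (continuousOn_extChartAt_symm q)).mul
        (((continuousOn_partialDeriv hg a q _).mul (continuousOn_partialDeriv hg b q _)).sub
        ((continuousOn_partialDeriv hg a q _).mul (continuousOn_partialDeriv hg b q _)))
    refine h1.congr fun y hy => ?_
    rw [wedgeField, if_pos hy]
  have hDc : ContinuousOn D (range (𝓡∂ 3)) := by
    refine continuousOn_range_of_eq_zero_off_compact ?_ hKc hKT hD0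
    exact (formContinuous_wedgeForm hf hg a b q).congr fun y hy => if_pos hy
  have hpos : ∀ y : EuclideanSpace ℝ (Fin 3), 0 < y 0 → range (𝓡∂ 3) ∈ 𝓝 y := by
    intro y hy
    rw [← mem_interior_iff_mem_nhds, interior_range_modelWithCornersEuclideanHalfSpace]
    exact hy
  have hdiv : ∀ y : EuclideanSpace ℝ (Fin 3), 0 < y 0 →
      (∀ i, DifferentiableAt ℝ (wedgeField f g a b q i) y) ∧
      ∑ i, fderiv ℝ (wedgeField f g a b q i) y (EuclideanSpace.single i 1) = D y := by
    intro y hy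
    have hr := hpos y hy
    by_cases hyT : y ∈ T
    -- A global lift of `g` to `V` need not exist, but the identity is local: near `y` the field is
    -- `f • (∇(a ∘ G) × ∇(b ∘ G))` for a smooth lift `G` in the chart.
    · obtain ⟨v, hv⟩ := Γ.mkQ_surjective (g (ψ y))
      obtain ⟨G, -, hG, hGe⟩ := exists_chart_lift hg hyT hr hv
      have hfm : MDifferentiableAt (𝓡∂ 3) 𝓘(ℝ, ℝ) f (ψ y) :=
        (hf _).mdifferentiableAt one_ne_zero
      obtain ⟨hfd, hfe⟩ := differentiableAt_comp_symm_of_range_mem_nhds hyT hr hfm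
      have hlin : ∀ c : V →L[ℝ] ℝ, ContDiffAt ℝ 2 (c ∘ G) y := fun c =>
        c.contDiff.contDiffAt.comp y (hG.of_le (WithTop.coe_le_coe.2 (le_top : (2 : ℕ∞) ≤ ⊤)))
      have hGd : ∀ᶠ z in 𝓝 y, DifferentiableAt ℝ G z :=
        ((hG.of_le (m := 1) (by exact_mod_cast le_top)).eventually (by simp)).mono
          fun z hz => hz.differentiableAt one_ne_zero
      have hpart : ∀ (c : V →L[ℝ] ℝ), ∀ᶠ z in 𝓝 y, ∀ k,
          partialDeriv g c q k z = fderiv ℝ (c ∘ G) z (EuclideanSpace.single k 1) := by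
        intro c
        filter_upwards [hGe, hGd] with z hz hzd k
        rw [fderiv_comp z c.differentiableAt hzd, c.fderiv, ← hz.2]
        rfl
      have hXe : ∀ i, wedgeField f g a b q i =ᶠ[𝓝 y] fun z => (f ∘ ψ) z *
          (fderiv ℝ (a ∘ G) z (EuclideanSpace.single (i + 1) 1) *
            fderiv ℝ (b ∘ G) z (EuclideanSpace.single (i + 2) 1) -
          fderiv ℝ (a ∘ G) z (EuclideanSpace.single (i + 2) 1) *
            fderiv ℝ (b ∘ G) z (EuclideanSpace.single (i + 1) 1)) := by
        intro i
        filter_upwards [hpart a, hpart b, eventually_mem_target_of_range_mem_nhds hyT hr]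
          with z hza hzb hzT
        simp only [wedgeField, if_pos hzT, hza, hzb, Function.comp, hψ]
      refine ⟨fun i => ((hasFDerivAt_mul_minor hfd (hlin a) (hlin b) _ _).1).congr_of_eventuallyEq
        (hXe i), ?_⟩
      simp only [(hXe _).fderiv_eq]
      rw [sum_fderiv_mul_minor hfd (hlin a) (hlin b) (fun i => EuclideanSpace.single i 1)]
      simp only [hD, if_pos hyT]
      refine Eq.trans ?_ (formCoeff_rowForm _ q y).symm
      congr 1
      ext i j
      fin_cases j
      · simpa using (congrArg (fun L => L (EuclideanSpace.single i 1)) hfe).symm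
      · exact ((hpart a).self_of_nhds i).symm
      · exact ((hpart b).self_of_nhds i).symm
    · have hyK : y ∉ K := fun h => hyT (hKT h)
      have h0 : ∀ i, wedgeField f g a b q i =ᶠ[𝓝 y] fun _ => 0 := by
        intro i
        filter_upwards [hKc.isClosed.isOpen_compl.mem_nhds hyK] with z hz
        exact hX0 i z hz
      refine ⟨fun i => (differentiableAt_const 0).congr_of_eventuallyEq (h0 i), ?_⟩
      simp only [(h0 _).fderiv_eq]
      simp [hD0 y hyK]
  -- transport to `Fin 3 → ℝ`
  set e : (Fin 3 → ℝ) ≃L[ℝ] EuclideanSpace ℝ (Fin 3) := (EuclideanSpace.equiv (Fin 3) ℝ).symm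
    with he
  have heval : ∀ w, (e w).ofLp = w := fun w => rfl
  have hes : ∀ i, e (Pi.single i 1) = EuclideanSpace.single i 1 := fun i => rfl
  have hmaps : MapsTo e {w : Fin 3 → ℝ | 0 ≤ w 0} (range (𝓡∂ 3)) := by
    intro w hw
    rw [range_modelWithCornersEuclideanHalfSpace]
    exact hw
  have key := integral_divergence_halfSpace (X := fun i => wedgeField f g a b q i ∘ e)
    (D := D ∘ e) (K := e ⁻¹' K) (e.toHomeomorph.isCompact_preimage.2 hKc)
    (fun i w hw => hX0 i _ hw) (fun w hw => hD0 _ hw)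
    (fun i => (hXc i).comp e.continuous.continuousOn hmaps)
    (hDc.comp e.continuous.continuousOn hmaps)
    (fun i w hw => ((hdiv (e w) hw).1 i).comp w e.differentiableAt)
    (fun w hw => by
      refine Eq.trans ?_ (hdiv (e w) hw).2
      refine Finset.sum_congr rfl fun i _ => ?_
      rw [e.comp_right_fderiv, ContinuousLinearMap.comp_apply]
      simp [hes])
  have hvol3 : MeasurePreserving (WithLp.toLp 2 : (Fin 3 → ℝ) → EuclideanSpace ℝ (Fin 3)) :=
    PiLp.volume_preserving_toLp (Fin 3)
  have hvol2 : MeasurePreserving (WithLp.toLp 2 : (Fin 2 → ℝ) → EuclideanSpace ℝ (Fin 2)) :=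
    PiLp.volume_preserving_toLp (Fin 2)
  have hemb3 : MeasurableEmbedding (WithLp.toLp 2 : (Fin 3 → ℝ) → EuclideanSpace ℝ (Fin 3)) :=
    (MeasurableEquiv.toLp 2 (Fin 3 → ℝ)).measurableEmbedding
  have hemb2 : MeasurableEmbedding (WithLp.toLp 2 : (Fin 2 → ℝ) → EuclideanSpace ℝ (Fin 2)) :=
    (MeasurableEquiv.toLp 2 (Fin 2 → ℝ)).measurableEmbedding
  rw [← hvol2.integral_comp hemb2]
  refine Eq.trans ?_ key
  have h1 : ∫ y in T, formCoeff (𝓡∂ 3) (wedgeForm f g a b) q y = ∫ y in T, D y :=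
    setIntegral_congr_fun (measurableSet_extChartAt_target q) fun y hy => (if_pos hy).symm
  have h2 : ∫ y in T, D y = ∫ y in range (𝓡∂ 3), D y :=
    (setIntegral_eq_of_subset_of_forall_sdiff_eq_zero
      (𝓡∂ 3).isClosed_range.measurableSet hTr fun y hy => if_neg hy.2).symm
  rw [h1, h2, ← hvol3.setIntegral_preimage_emb hemb3]
  congr 2
  rw [range_modelWithCornersEuclideanHalfSpace]
  rfl

end ChartStokes

/-! ### Frames at the centre of a chart and derivatives of maps into a manifold -/

section Frames

variable {E : Type*} [NormedAddCommGroup E] [NormedSpace ℝ E] {H : Type*} [TopologicalSpace H]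
  {I : ModelWithCorners ℝ E H} {M : Type*} [TopologicalSpace M] [ChartedSpace H M]
  [IsManifold I ∞ M]

/-- The tangent space at `p` is identified with the model through this very chart, in which the
inverse chart reads as the identity. -/
theorem chartFrame_self (p : M) : chartFrame I p (extChartAt I p p) = ContinuousLinearMap.id ℝ E := by
  have hy := mem_extChartAt_target (I := I) p
  have hd := mdifferentiableWithinAt_extChartAt_symm_range hy
  have h : HasFDerivWithinAt (extChartAt I p ∘ (extChartAt I p).symm) (ContinuousLinearMap.id ℝ E)
      (range I) (extChartAt I p p) := by
    refine (hasFDerivWithinAt_id _ _).congr_of_eventuallyEq ?_ ((extChartAt I p).right_inv hy)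
    filter_upwards [extChartAt_target_mem_nhdsWithin (I := I) p] with z hz
    exact (extChartAt I p).right_inv hz
  have h1 : HasMFDerivWithinAt 𝓘(ℝ, E) I (extChartAt I p).symm (range I) (extChartAt I p p)
      (ContinuousLinearMap.id ℝ E) := by
    refine ⟨hd.continuousWithinAt, ?_⟩
    simp only [writtenInExtChartAt, extChartAt_to_inv]
    simp only [extChartAt_self_eq, modelWithCornersSelf_coe, range_id, inter_univ]
    exact h
  exact h1.mfderivWithin (uniqueMDiffWithinAt_range_of_mem_target hy)

theorem hasMFDerivAt_comp_of_hasMFDerivWithinAt {E₁ E₂ E₃ H₁ H₂ H₃ M₁ M₂ M₃ : Type*}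
    [NormedAddCommGroup E₁] [NormedSpace ℝ E₁] [TopologicalSpace H₁]
    {I₁ : ModelWithCorners ℝ E₁ H₁} [TopologicalSpace M₁] [ChartedSpace H₁ M₁]
    [NormedAddCommGroup E₂] [NormedSpace ℝ E₂] [TopologicalSpace H₂]
    {I₂ : ModelWithCorners ℝ E₂ H₂} [TopologicalSpace M₂] [ChartedSpace H₂ M₂]
    [NormedAddCommGroup E₃] [NormedSpace ℝ E₃] [TopologicalSpace H₃]
    {I₃ : ModelWithCorners ℝ E₃ H₃} [TopologicalSpace M₃] [ChartedSpace H₃ M₃]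
    {g : M₂ → M₃} {f : M₁ → M₂} {x : M₁} {u : Set M₂} {g' : E₂ →L[ℝ] E₃} {f' : E₁ →L[ℝ] E₂}
    (hg : HasMFDerivWithinAt I₂ I₃ g u (f x) g') (hf : HasMFDerivAt I₁ I₂ f x f')
    (hu : ∀ z, f z ∈ u) : HasMFDerivAt I₁ I₃ (g ∘ f) x (g'.comp f') := by
  exact hasMFDerivWithinAt_univ.1
    (HasMFDerivWithinAt.comp x hg (hasMFDerivWithinAt_univ.2 hf) fun z _ => hu z)

/-- The derivative of a map into `M`, computed from its expression in the chart at `q`. -/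
theorem modelDeriv_eq_chartFrame_comp {E' : Type*} [NormedAddCommGroup E'] [NormedSpace ℝ E']
    {H' : Type*} [TopologicalSpace H'] {I' : ModelWithCorners ℝ E' H'} {N : Type*}
    [TopologicalSpace N] [ChartedSpace H' N] {φ : N → M} {s : N} (hφ : MDifferentiableAt I' I φ s)
    {q : M} (hq : φ s ∈ (extChartAt I q).source) :
    modelDeriv I' I φ s = (chartFrame I q (extChartAt I q (φ s))).comp
      (modelDeriv I' 𝓘(ℝ, E) (extChartAt I q ∘ φ) s) := by
  have hd : MDifferentiableAt I' 𝓘(ℝ, E) (extChartAt I q ∘ φ) s :=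
    (mdifferentiableAt_extChartAt_of_mem hq).comp s hφ
  have h1 := (mdifferentiableWithinAt_extChartAt_symm_range
    ((extChartAt I q).map_source hq)).hasMFDerivWithinAt
  have h2 := hasMFDerivAt_comp_of_hasMFDerivWithinAt (x := s) (f := extChartAt I q ∘ φ) h1
    hd.hasMFDerivAt (fun z => by simp)
  have h3 : HasMFDerivAt I' I φ s _ := h2.congr_of_eventuallyEq (by
    filter_upwards [hφ.continuousAt ((isOpen_extChartAt_source q).mem_nhds hq)] with z hz
    exact ((extChartAt I q).left_inv hz).symm)
  exact h3.mfderiv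

end Frames

/-! ### Orientation of the boundary -/

section BoundaryForm

theorem det_eq_of_fin_two (A : EuclideanSpace ℝ (Fin 2) →L[ℝ] EuclideanSpace ℝ (Fin 2)) :
    A.det = A (EuclideanSpace.single 0 1) 0 * A (EuclideanSpace.single 1 1) 1 -
      A (EuclideanSpace.single 0 1) 1 * A (EuclideanSpace.single 1 1) 0 := by
  have h := alternatingMap_map_single
    (rowForm ![EuclideanSpace.proj (0 : Fin 2), EuclideanSpace.proj (1 : Fin 2)]) A
  simp [rowForm_apply, Matrix.det_fin_two] at h
  linarith

theorem basisFun_det_fin_three (u v w : EuclideanSpace ℝ (Fin 3)) :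
    (EuclideanSpace.basisFun (Fin 3) ℝ).toBasis.det ![u, v, w] =
      u 0 * (v 1 * w 2 - v 2 * w 1) - v 0 * (u 1 * w 2 - u 2 * w 1) +
        w 0 * (u 1 * v 2 - u 2 * v 1) := by
  rw [Basis.det_apply, Matrix.det_fin_three]
  simp [Basis.toMatrix_apply]
  ring

theorem basisFun_det_map (A : EuclideanSpace ℝ (Fin 3) →L[ℝ] EuclideanSpace ℝ (Fin 3))
    (u v w : EuclideanSpace ℝ (Fin 3)) :
    (EuclideanSpace.basisFun (Fin 3) ℝ).toBasis.det ![A u, A v, A w] =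
      A.det * (EuclideanSpace.basisFun (Fin 3) ℝ).toBasis.det ![u, v, w] := by
  rw [ContinuousLinearMap.det, ← Basis.det_comp]
  congr 1
  ext i
  fin_cases i <;> rfl

theorem planeIncl_eq (z : EuclideanSpace ℝ (Fin 2)) : planeIncl z =
    z 0 • EuclideanSpace.single 1 1 + z 1 • EuclideanSpace.single 2 1 := by
  ext i
  fin_cases i
  · simp [planeIncl]
  · simp [planeIncl]
  · simp only [planeIncl, PiLp.add_apply, PiLp.smul_apply, PiLp.single_apply]
    simp
    rfl

/-- The projection of the half-space to its boundary plane. -/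
noncomputable def planeProj : EuclideanSpace ℝ (Fin 3) →L[ℝ] EuclideanSpace ℝ (Fin 2) :=
  (EuclideanSpace.equiv (Fin 2) ℝ).symm.toContinuousLinearMap.comp
    (ContinuousLinearMap.pi fun i => EuclideanSpace.proj i.succ)

theorem planeProj_apply (y : EuclideanSpace ℝ (Fin 3)) (i : Fin 2) :
    planeProj y i = y i.succ := rfl

theorem planeIncl_planeProj {y : EuclideanSpace ℝ (Fin 3)} (hy : y 0 = 0) :
    planeIncl (planeProj y) = y := by
  ext i
  refine Fin.cases ?_ (fun j => ?_) i
  · simp [planeIncl, hy]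
  · simp [planeIncl, planeProj_apply]

variable {B : Type*} [TopologicalSpace B] [ChartedSpace (EuclideanHalfSpace 3) B]
  [IsManifold (𝓡∂ 3) ∞ B]

/-- Being an interior point can be tested in any chart. A positive zeroth coordinate gives a full
neighbourhood inside the target, and a zero one rules it out. -/
theorem mem_boundary_iff_extChartAt {q x : B} (hx : x ∈ (extChartAt (𝓡∂ 3) q).source) :
    x ∈ (𝓡∂ 3).boundary B ↔ extChartAt (𝓡∂ 3) q x 0 = 0 := by
  have hx' : x ∈ (chartAt (EuclideanHalfSpace 3) q).source := by rwa [extChartAt_source] at hx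
  have h1 := (𝓡∂ 3).isInteriorPoint_iff_of_mem_atlas (n := ∞) (by simp)
    (chart_mem_atlas (EuclideanHalfSpace 3) q) hx'
  have ht : extChartAt (𝓡∂ 3) q x ∈ (extChartAt (𝓡∂ 3) q).target := (extChartAt _ q).map_source hx
  have hr : 0 ≤ extChartAt (𝓡∂ 3) q x 0 := by
    have := extChartAt_target_subset_range q ht
    rwa [range_modelWithCornersEuclideanHalfSpace] at this
  change (𝓡∂ 3).IsBoundaryPoint x ↔ _
  rw [(𝓡∂ 3).isBoundaryPoint_iff_not_isInteriorPoint, h1]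
  change extChartAt (𝓡∂ 3) q x ∉ interior (extChartAt (𝓡∂ 3) q).target ↔ _
  constructor
  · intro h
    by_contra h0
    have hpos : extChartAt (𝓡∂ 3) q x ∈ interior (range (𝓡∂ 3)) := by
      rw [interior_range_modelWithCornersEuclideanHalfSpace]
      exact lt_of_le_of_ne hr (Ne.symm h0)
    exact h (mem_interior_iff_mem_nhds.2 (eventually_mem_target_of_range_mem_nhds ht
      (mem_interior_iff_mem_nhds.1 hpos)))
  · intro h0 h
    have := interior_mono (extChartAt_target_subset_range (I := 𝓡∂ 3) q) h
    rw [interior_range_modelWithCornersEuclideanHalfSpace] at this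
    exact absurd h0 (ne_of_gt this)

/-- A change of charts of a manifold with boundary maps the inward normal vector at a boundary
point to a vector that does not point outward. -/
theorem chartChange_single_zero_nonneg {p q : B} {y : EuclideanSpace ℝ (Fin 3)}
    (hy : y ∈ (extChartAt (𝓡∂ 3) p).target)
    (hq : (extChartAt (𝓡∂ 3) p).symm y ∈ (extChartAt (𝓡∂ 3) q).source)
    (h0 : extChartAt (𝓡∂ 3) q ((extChartAt (𝓡∂ 3) p).symm y) 0 = 0) :
    0 ≤ fderivWithin ℝ (extChartAt (𝓡∂ 3) q ∘ (extChartAt (𝓡∂ 3) p).symm) (range (𝓡∂ 3)) y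
      (EuclideanSpace.single 0 1) 0 := by
  have hd := (differentiableWithinAt_comp_extChartAt_symm hy
    (mdifferentiableAt_extChartAt_of_mem hq)).hasFDerivWithinAt
  have hd0 := (EuclideanSpace.proj (0 : Fin 3) : EuclideanSpace ℝ (Fin 3) →L[ℝ] ℝ).hasFDerivAt
    |>.comp_hasFDerivWithinAt y hd
  -- The zeroth coordinate is nonnegative throughout the half-space and vanishes at the image of
  -- `y`, so it has a minimum there and its derivative in an inward direction is nonnegative.
  have hmin : IsLocalMinOn ((EuclideanSpace.proj (0 : Fin 3) : EuclideanSpace ℝ (Fin 3) →L[ℝ] ℝ) ∘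
      (extChartAt (𝓡∂ 3) q ∘ (extChartAt (𝓡∂ 3) p).symm)) (range (𝓡∂ 3)) y := by
    refine Filter.Eventually.of_forall fun z => ?_
    have hz : extChartAt (𝓡∂ 3) q ((extChartAt (𝓡∂ 3) p).symm z) ∈ range (𝓡∂ 3) := by simp
    rw [range_modelWithCornersEuclideanHalfSpace] at hz
    change extChartAt (𝓡∂ 3) q ((extChartAt (𝓡∂ 3) p).symm y) 0 ≤
      extChartAt (𝓡∂ 3) q ((extChartAt (𝓡∂ 3) p).symm z) 0
    rw [h0]
    exact hz
  refine hmin.hasFDerivWithinAt_nonneg hd0 (mem_posTangentConeAt_of_segment_subset ?_)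
  have hyr := extChartAt_target_subset_range p hy
  rw [range_modelWithCornersEuclideanHalfSpace] at hyr ⊢
  rw [segment_subset_iff]
  intro s t hs ht hst
  simp only [mem_ofPred_eq, PiLp.add_apply, PiLp.smul_apply, smul_eq_mul,
    PiLp.single_apply, if_true]
  have : 0 ≤ y 0 := hyr
  nlinarith

variable {V : Type*} [NormedAddCommGroup V] [NormedSpace ℝ V]
  {Γ : Submodule ℤ V} [DiscreteTopology Γ] {S : Type*} [TopologicalSpace S]
  [ChartedSpace (EuclideanSpace ℝ (Fin 2)) S]

/-- The 2-form `u • h*(a ∧ b)` on a surface. -/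
noncomputable def surfaceForm (u : S → ℝ) (h : S → V ⧸ Γ) (a b : V →L[ℝ] ℝ) (s : S) :
    TangentSpace (𝓡 2) s [⋀^Fin 2]→ₗ[ℝ] ℝ :=
  u s • rowForm ![a.comp (modelDeriv (𝓡 2) 𝓘(ℝ, V) h s), b.comp (modelDeriv (𝓡 2) 𝓘(ℝ, V) h s)]

theorem formContinuous_surfaceForm [IsManifold (𝓡 2) ∞ S] {u : S → ℝ} (hu : Continuous u)
    {h : S → V ⧸ Γ} (hh : ContMDiff (𝓡 2) 𝓘(ℝ, V) ∞ h) (a b : V →L[ℝ] ℝ) :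
    FormContinuous (𝓡 2) (surfaceForm u h a b) := by
  refine FormContinuous.smul (formContinuous_rowForm fun p j => ?_) hu
  have hc : ∀ c : V →L[ℝ] ℝ, ContinuousOn (fun y =>
      (c.comp (modelDeriv (𝓡 2) 𝓘(ℝ, V) h ((extChartAt (𝓡 2) p).symm y))).comp
        (chartFrame (𝓡 2) p y)) (extChartAt (𝓡 2) p).target := fun c =>
    continuousOn_const.clm_comp (continuousOn_mfderiv_comp_chartFrame hh p)
  fin_cases j
  · exact hc a
  · exact hc b

variable {ι : S → B}

/-- The derivative of the inclusion of the boundary in a chart of the surface and a chart of the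
manifold has negative determinant. -/
theorem IsOrientedBoundary.det_neg [IsManifold (𝓡 2) ∞ S] [OrientedAtlas (𝓡∂ 3) B]
    (hι : IsOrientedBoundary ι) {s : S} {q : B}
    (hq : ι s ∈ (extChartAt (𝓡∂ 3) q).source) :
    (modelDeriv (𝓡 2) 𝓘(ℝ, EuclideanSpace ℝ (Fin 2))
      (fun s => planeProj (extChartAt (𝓡∂ 3) q (ι s))) s).det < 0 ∧
    ∀ v, modelDeriv (𝓡 2) 𝓘(ℝ, EuclideanSpace ℝ (Fin 3)) (extChartAt (𝓡∂ 3) q ∘ ι) s v =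
      planeIncl (modelDeriv (𝓡 2) 𝓘(ℝ, EuclideanSpace ℝ (Fin 2))
      (fun s => planeProj (extChartAt (𝓡∂ 3) q (ι s))) s v) := by
  have hιd : MDifferentiableAt (𝓡 2) (𝓡∂ 3) ι s := (hι.contMDiff s).mdifferentiableAt (by simp)
  set k := extChartAt (𝓡∂ 3) q ∘ ι with hk
  have hkd : MDifferentiableAt (𝓡 2) 𝓘(ℝ, EuclideanSpace ℝ (Fin 3)) k s :=
    (mdifferentiableAt_extChartAt_of_mem hq).comp s hιd
  set W := modelDeriv (𝓡 2) 𝓘(ℝ, EuclideanSpace ℝ (Fin 3)) k s with hW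
  have hbd : ∀ s', ι s' ∈ (extChartAt (𝓡∂ 3) q).source → k s' 0 = 0 := fun s' hs' =>
    (mem_boundary_iff_extChartAt hs').1 (hι.range_eq ▸ mem_range_self s')
  have hW0 : ∀ v, W v 0 = 0 := by
    intro v
    have h1 := (EuclideanSpace.proj (0 : Fin 3) : EuclideanSpace ℝ (Fin 3) →L[ℝ] ℝ).hasFDerivAt
      (x := k s) |>.hasMFDerivAt.comp s hkd.hasMFDerivAt
    have h2 := (hasMFDerivAt_const (I := 𝓡 2) (I' := 𝓘(ℝ, ℝ)) (0 : ℝ) s).congr_of_eventuallyEq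
      (f₁ := (EuclideanSpace.proj (0 : Fin 3) : EuclideanSpace ℝ (Fin 3) →L[ℝ] ℝ) ∘ k) (by
        filter_upwards [hιd.continuousAt ((isOpen_extChartAt_source q).mem_nhds hq)] with s' hs'
        exact hbd s' hs')
    have h3 := hasMFDerivAt_unique h1 h2
    exact congrArg (fun L : EuclideanSpace ℝ (Fin 2) →L[ℝ] ℝ => L v) h3
  have hN : modelDeriv (𝓡 2) 𝓘(ℝ, EuclideanSpace ℝ (Fin 2)) (fun s => planeProj (k s)) s =
      planeProj.comp W := by
    have h1 := planeProj.hasFDerivAt (x := k s) |>.hasMFDerivAt.comp s hkd.hasMFDerivAt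
    exact h1.mfderiv
  have hWv : ∀ v, W v = planeIncl (planeProj.comp W v) := fun v =>
    (planeIncl_planeProj (hW0 v)).symm
  refine ⟨?_, fun v => by
    have := hWv v
    rw [← hN] at this
    exact this⟩
  set y := extChartAt (𝓡∂ 3) (ι s) (ι s) with hy
  have hyt : y ∈ (extChartAt (𝓡∂ 3) (ι s)).target := mem_extChartAt_target (ι s)
  have hys : (extChartAt (𝓡∂ 3) (ι s)).symm y = ι s := extChartAt_to_inv (ι s)
  set A := fderivWithin ℝ (extChartAt (𝓡∂ 3) q ∘ (extChartAt (𝓡∂ 3) (ι s)).symm)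
    (range (𝓡∂ 3)) y with hA
  have hAdet : 0 < A.det := det_chartChange_pos hyt (by rwa [hys])
  have hAe : 0 ≤ A (EuclideanSpace.single 0 1) 0 :=
    chartChange_single_zero_nonneg hyt (by rwa [hys]) (by rw [hys]; exact hbd s hq)
  -- The orientation condition refers to the preferred chart at `ι s`; the chart change `A` carries
  -- it to the chart at `q`.
  have hWA : ∀ v, W v = A (modelDeriv (𝓡 2) (𝓡∂ 3) ι s v) := by
    intro v
    have h1 := modelDeriv_eq_chartFrame_comp hιd (mem_extChartAt_source (I := 𝓡∂ 3) (ι s))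
    have h2 : k =ᶠ[𝓝 s] (extChartAt (𝓡∂ 3) q ∘ (extChartAt (𝓡∂ 3) (ι s)).symm) ∘
        (extChartAt (𝓡∂ 3) (ι s) ∘ ι) := by
      filter_upwards [hιd.continuousAt ((isOpen_extChartAt_source (I := 𝓡∂ 3) (ι s)).mem_nhds
        (mem_extChartAt_source (ι s)))] with s' hs'
      have hs'' : ι s' ∈ (extChartAt (𝓡∂ 3) (ι s)).source := hs'
      simp only [hk, Function.comp_apply, (extChartAt (𝓡∂ 3) (ι s)).left_inv hs'']
    have h3 : MDifferentiableAt (𝓡 2) 𝓘(ℝ, EuclideanSpace ℝ (Fin 3))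
        (extChartAt (𝓡∂ 3) (ι s) ∘ ι) s :=
      (mdifferentiableAt_extChartAt_of_mem (mem_extChartAt_source (ι s))).comp s hιd
    have h4 : HasFDerivWithinAt (extChartAt (𝓡∂ 3) q ∘ (extChartAt (𝓡∂ 3) (ι s)).symm) A
        (range (𝓡∂ 3)) y := (differentiableWithinAt_comp_extChartAt_symm hyt
          (mdifferentiableAt_extChartAt_of_mem (by rwa [hys]))).hasFDerivWithinAt
    have h5 := (hasMFDerivAt_comp_of_hasMFDerivWithinAt (x := s)
      (f := extChartAt (𝓡∂ 3) (ι s) ∘ ι) h4.hasMFDerivWithinAt h3.hasMFDerivAt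
      (fun z => by simp)).congr_of_eventuallyEq h2
    have h6 : W = A.comp (modelDeriv (𝓡 2) 𝓘(ℝ, EuclideanSpace ℝ (Fin 3))
      (extChartAt (𝓡∂ 3) (ι s) ∘ ι) s) := h5.mfderiv
    rw [h1, h6, chartFrame_self]
    rfl
  have hor := hι.oriented s
  have hdet := mul_pos hAdet hor
  have hmap := basisFun_det_map A (-EuclideanSpace.single 0 1)
    (modelDeriv (𝓡 2) (𝓡∂ 3) ι s (EuclideanSpace.single 0 1))
    (modelDeriv (𝓡 2) (𝓡∂ 3) ι s (EuclideanSpace.single 1 1))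
  rw [← hWA, ← hWA, basisFun_det_fin_three, hW0, hW0, map_neg] at hmap
  have hdet' := hdet.trans_eq hmap.symm
  have hN' : modelDeriv (𝓡 2) 𝓘(ℝ, EuclideanSpace ℝ (Fin 2))
      (fun s => planeProj (extChartAt (𝓡∂ 3) q (ι s))) s = planeProj.comp W := hN
  rw [hN', det_eq_of_fin_two]
  simp only [ContinuousLinearMap.comp_apply, planeProj_apply]
  simp only [PiLp.neg_apply] at hdet'
  change W (EuclideanSpace.single 0 1) 1 * W (EuclideanSpace.single 1 1) 2 -
    W (EuclideanSpace.single 0 1) 2 * W (EuclideanSpace.single 1 1) 1 < 0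
  -- Since `W v 0 = 0`, the positive `3 × 3` determinant equals `-(A e₀) 0` times the planar one. As
  -- `(A e₀) 0 ≥ 0`, the planar determinant must be negative.
  by_contra hcon
  push Not at hcon
  nlinarith [mul_nonneg hAe hcon]

end BoundaryForm

/-! ### Stokes' theorem on a compact manifold with boundary -/

section Stokes

theorem modelDeriv_finset_sum {E : Type*} [NormedAddCommGroup E] [NormedSpace ℝ E] {H : Type*}
    [TopologicalSpace H] {I : ModelWithCorners ℝ E H} {M : Type*} [TopologicalSpace M]
    [ChartedSpace H M] {σ : Type*} (s : Finset σ) {f : σ → M → ℝ} {x : M}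
    (hf : ∀ j ∈ s, MDifferentiableAt I 𝓘(ℝ, ℝ) (f j) x) :
    MDifferentiableAt I 𝓘(ℝ, ℝ) (fun x => ∑ j ∈ s, f j x) x ∧
    modelDeriv I 𝓘(ℝ, ℝ) (fun x => ∑ j ∈ s, f j x) x =
      ∑ j ∈ s, modelDeriv I 𝓘(ℝ, ℝ) (f j) x := by
  classical
  induction s using Finset.induction_on with
  | empty =>
    have h := hasMFDerivAt_const (I := I) (I' := 𝓘(ℝ, ℝ)) (0 : ℝ) x
    simp only [Finset.sum_empty]
    exact ⟨h.mdifferentiableAt, h.mfderiv⟩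
  | insert j s hj ih =>
    obtain ⟨h1, h2⟩ := ih fun k hk => hf k (Finset.mem_insert_of_mem hk)
    have h3 := (hf j (Finset.mem_insert_self j s)).hasMFDerivAt.add h1.hasMFDerivAt
    simp only [Finset.sum_insert hj]
    exact ⟨h3.mdifferentiableAt, by rw [← h2]; exact h3.mfderiv⟩

variable {B : Type*} [TopologicalSpace B] [ChartedSpace (EuclideanHalfSpace 3) B]
  [IsManifold (𝓡∂ 3) ∞ B] [OrientedAtlas (𝓡∂ 3) B]
  {V : Type*} [NormedAddCommGroup V] [NormedSpace ℝ V]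
  {Γ : Submodule ℤ V} [DiscreteTopology Γ] {S : Type*} [TopologicalSpace S]
  [ChartedSpace (EuclideanSpace ℝ (Fin 2)) S] [IsManifold (𝓡 2) ∞ S] [T2Space S] [CompactSpace S]
  [OrientedAtlas (𝓡 2) S] {ι : S → B}

/-- The plane coordinates of the chart at `q` reverse the orientation of the surface
(`IsOrientedBoundary.det_neg`), so the change of variables runs with `ε = -1`. This produces the
same sign as the inward wall in `integral_formCoeff_wedgeForm`. -/
theorem formIntegralWith_surfaceForm_eq (hι : IsOrientedBoundary ι)
    {ρ : SmoothPartitionOfUnity S (𝓡 2) S univ}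
    (hρ : ρ.IsSubordinate fun s => (chartAt (EuclideanSpace ℝ (Fin 2)) s).source) {f : B → ℝ}
    (hf : Continuous f) {g : B → V ⧸ Γ} (hg : ContMDiff (𝓡∂ 3) 𝓘(ℝ, V) ∞ g) (a b : V →L[ℝ] ℝ)
    {q : B} (hq : tsupport f ⊆ (extChartAt (𝓡∂ 3) q).source) :
    formIntegralWith (𝓡 2) ρ (surfaceForm (f ∘ ι) (g ∘ ι) a b) =
      -∫ z, wedgeField f g a b q 0 (planeIncl z) := by
  classical
  set U : Set S := ι ⁻¹' (extChartAt (𝓡∂ 3) q).source with hU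
  have hUo : IsOpen U := (isOpen_extChartAt_source q).preimage hι.contMDiff.continuous
  set k : S → EuclideanSpace ℝ (Fin 3) := extChartAt (𝓡∂ 3) q ∘ ι with hk
  set κ : S → EuclideanSpace ℝ (Fin 2) := fun s => planeProj (extChartAt (𝓡∂ 3) q (ι s)) with hκ
  have hιd : ∀ s, MDifferentiableAt (𝓡 2) (𝓡∂ 3) ι s := fun s =>
    (hι.contMDiff s).mdifferentiableAt (by simp)
  have hinc : ∀ s ∈ U, planeIncl (κ s) = k s := fun s hs =>
    planeIncl_planeProj ((mem_boundary_iff_extChartAt hs).1 (hι.range_eq ▸ mem_range_self s))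
  have hinj : InjOn κ U := by
    intro s hs t ht hst
    have h1 : k s = k t := by rw [← hinc s hs, ← hinc t ht, hst]
    exact hι.injective ((extChartAt (𝓡∂ 3) q).injOn hs ht h1)
  have hκd : ∀ s ∈ U, MDifferentiableAt (𝓡 2) 𝓘(ℝ, EuclideanSpace ℝ (Fin 2)) κ s := by
    intro s hs
    have h1 : MDifferentiableAt (𝓡 2) 𝓘(ℝ, EuclideanSpace ℝ (Fin 3)) k s :=
      (mdifferentiableAt_extChartAt_of_mem hs).comp s (hιd s)
    exact (planeProj.differentiableAt (x := k s)).mdifferentiableAt.comp s h1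
  have hcont : FormContinuous (𝓡 2) (surfaceForm (f ∘ ι) (g ∘ ι) a b) :=
    formContinuous_surfaceForm (hf.comp hι.contMDiff.continuous) (hg.comp hι.contMDiff) a b
  have hsign : ∀ p, ∀ y ∈ (extChartAt (𝓡 2) p).target, (extChartAt (𝓡 2) p).symm y ∈ U →
      0 < -1 * (fderivWithin ℝ (κ ∘ (extChartAt (𝓡 2) p).symm) (range (𝓡 2)) y).det := by
    intro p y hy hs
    set s := (extChartAt (𝓡 2) p).symm y with hs'
    rw [det_comp_symm_pos_iff hy (mem_extChartAt_source (I := 𝓡 2) s) (hκd s hs),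
      fderivWithin_comp_extChartAt_symm (mem_extChartAt_target (I := 𝓡 2) s)
      (by rw [extChartAt_to_inv]; exact hκd s hs), chartFrame_self, extChartAt_to_inv]
    have := (hι.det_neg hs).1
    change 0 < -1 * (modelDeriv (𝓡 2) 𝓘(ℝ, EuclideanSpace ℝ (Fin 2)) κ s).det
    linarith
  have hcoeff : ∀ p, ∀ y ∈ (extChartAt (𝓡 2) p).target, (extChartAt (𝓡 2) p).symm y ∈ U →
      formCoeff (𝓡 2) (surfaceForm (f ∘ ι) (g ∘ ι) a b) p y =
        (fun z => wedgeField f g a b q 0 (planeIncl z)) (κ ((extChartAt (𝓡 2) p).symm y)) *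
        (fderivWithin ℝ (κ ∘ (extChartAt (𝓡 2) p).symm) (range (𝓡 2)) y).det := by
    intro p y hy hs
    have hfd := fderivWithin_comp_extChartAt_symm hy (hκd _ hs)
    rw [hfd]
    refine (formCoeff_smul_rowForm _ _ p y).trans ?_
    set s := (extChartAt (𝓡 2) p).symm y with hs'
    have hks : (extChartAt (𝓡∂ 3) q).symm (k s) = ι s := (extChartAt (𝓡∂ 3) q).left_inv hs
    have hkt : k s ∈ (extChartAt (𝓡∂ 3) q).target := (extChartAt (𝓡∂ 3) q).map_source hs
    set N := modelDeriv (𝓡 2) 𝓘(ℝ, EuclideanSpace ℝ (Fin 2)) κ s with hN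
    have hgι : modelDeriv (𝓡 2) 𝓘(ℝ, V) (g ∘ ι) s =
        (modelDeriv (𝓡∂ 3) 𝓘(ℝ, V) g (ι s)).comp (modelDeriv (𝓡 2) (𝓡∂ 3) ι s) :=
      mfderiv_comp s ((hg _).mdifferentiableAt (by simp)) (hιd s)
    have hval : ∀ (c : V →L[ℝ] ℝ) v, c (modelDeriv (𝓡 2) 𝓘(ℝ, V) (g ∘ ι) s v) =
        N v 0 * partialDeriv g c q 1 (k s) + N v 1 * partialDeriv g c q 2 (k s) := by
      intro c v
      rw [hgι, modelDeriv_eq_chartFrame_comp (hιd s) hs]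
      simp only [ContinuousLinearMap.comp_apply]
      rw [(hι.det_neg hs).2 v, planeIncl_eq]
      simp only [map_add, map_smul, smul_eq_mul, partialDeriv, hks]
      rfl
    rw [det_eq_of_fin_two, Matrix.det_fin_two]
    simp only [hinc s hs, wedgeField, if_pos hkt, hks, Matrix.of_apply, Matrix.cons_val_zero,
      Matrix.cons_val_one, ContinuousLinearMap.comp_apply, hval, Function.comp_apply,
      zero_add]
    ring
  have hzero : ∀ s ∉ U, surfaceForm (f ∘ ι) (g ∘ ι) a b s = 0 := by
    intro s hs
    have : f (ι s) = 0 := image_eq_zero_of_notMem_tsupport fun h => hs (hq h)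
    rw [surfaceForm, Function.comp_apply, this]
    exact zero_smul ℝ _
  rw [formIntegralWith_eq_integral_image hρ (hcont.formIntegrable hρ) hUo hinj hκd (Or.inr rfl)
    (h := fun z => wedgeField f g a b q 0 (planeIncl z)) hsign hcoeff hzero, neg_one_mul]
  congr 1
  -- Points of the plane in the target come from the surface, because `ι` is onto the boundary; at
  -- all other points the field is zero by definition.
  refine setIntegral_eq_integral_of_forall_compl_eq_zero fun z hz => ?_
  rw [wedgeField]
  split_ifs with h
  · exfalso
    have hx := (extChartAt (𝓡∂ 3) q).map_target h
    have hr := (extChartAt (𝓡∂ 3) q).right_inv h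
    have hb : (extChartAt (𝓡∂ 3) q).symm (planeIncl z) ∈ range ι := by
      rw [hι.range_eq, mem_boundary_iff_extChartAt hx, hr]
      rfl
    obtain ⟨s, hs⟩ := hb
    refine hz ⟨s, by rw [← hs] at hx; exact hx, ?_⟩
    simp only [hκ]
    rw [hs, hr]
    ext i
    rfl
  · rw [zero_mul]

variable [T2Space B] [CompactSpace B]

/-- **Stokes' theorem** for `d (f g*(a ∧ b))` on a compact oriented 3-manifold with boundary. -/
theorem formIntegral_wedgeForm (hι : IsOrientedBoundary ι) {f : B → ℝ}
    (hf : ContMDiff (𝓡∂ 3) 𝓘(ℝ, ℝ) 1 f) {g : B → V ⧸ Γ} (hg : ContMDiff (𝓡∂ 3) 𝓘(ℝ, V) ∞ g)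
    (a b : V →L[ℝ] ℝ) :
    formIntegral (𝓡∂ 3) (wedgeForm f g a b) =
      formIntegral (𝓡 2) (surfaceForm (f ∘ ι) (g ∘ ι) a b) := by
  rw [formIntegral, formIntegral]
  set ρ := (SmoothPartitionOfUnity.exists_isSubordinate_chartAt_source (𝓡∂ 3) B).choose
  have hρ := (SmoothPartitionOfUnity.exists_isSubordinate_chartAt_source (𝓡∂ 3) B).choose_spec
  set ρS := (SmoothPartitionOfUnity.exists_isSubordinate_chartAt_source (𝓡 2) S).choose
  have hρS := (SmoothPartitionOfUnity.exists_isSubordinate_chartAt_source (𝓡 2) S).choose_spec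
  set T := (finite_nonzero_partition ρ).toFinset
  -- Both sides are linear in `f`, so the partition of unity reduces the claim to functions
  -- supported in one chart.
  set F : B → B → ℝ := fun q x => ρ q x * f x with hF
  have hFs : ∀ q, ContMDiff (𝓡∂ 3) 𝓘(ℝ, ℝ) 1 (F q) := fun q =>
    ((ρ q).contMDiff.of_le (by exact_mod_cast le_top)).mul hf
  have hFsum : ∀ x, ∑ q ∈ T, F q x = f x := fun x => by
    simp only [hF, ← Finset.sum_mul]
    rw [sum_partition_eq_one ρ x, one_mul]
  have hFsupp : ∀ q, tsupport (F q) ⊆ (extChartAt (𝓡∂ 3) q).source := by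
    intro q
    rw [extChartAt_source]
    exact (tsupport_mul_subset_left).trans (hρ q)
  have h1 : wedgeForm f g a b = fun x => ∑ q ∈ T, wedgeForm (F q) g a b x := by
    funext x
    have h2 := (modelDeriv_finset_sum (I := 𝓡∂ 3) T (f := F) (x := x)
      fun q _ => (hFs q x).mdifferentiableAt one_ne_zero).2
    simp only [hFsum] at h2
    unfold wedgeForm
    rw [show modelDeriv (𝓡∂ 3) 𝓘(ℝ, ℝ) f x = _ from h2]
    exact rowForm_cons_sum T _ _ _
  have h3 : surfaceForm (f ∘ ι) (g ∘ ι) a b =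
      fun s => ∑ q ∈ T, surfaceForm (F q ∘ ι) (g ∘ ι) a b s := by
    funext s
    unfold surfaceForm
    rw [Function.comp_apply, ← hFsum]
    exact Finset.sum_smul
  rw [h1, h3, formIntegralWith_finset_sum ρ T _
      fun q _ => (formContinuous_wedgeForm (hFs q) hg a b).formIntegrable hρ,
    formIntegralWith_finset_sum ρS T _ fun q _ => (formContinuous_surfaceForm
      ((hFs q).continuous.comp hι.contMDiff.continuous) (hg.comp hι.contMDiff) a b).formIntegrable
      hρS]
  refine Finset.sum_congr rfl fun q _ => ?_
  rw [formIntegralWith_surfaceForm_eq hι hρS (hFs q).continuous hg a b (hFsupp q),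
    formIntegralWith_eq_integral_target hρ
      ((formContinuous_wedgeForm (hFs q) hg a b).formIntegrable hρ) q
      (fun x hx => wedgeForm_eq_zero (fun h => hx (hFsupp q h)) g a b),
    integral_formCoeff_wedgeForm (hFs q) hg a b (hFsupp q)]

end Stokes

end

/-! ### Weighted volume forms and exactness -/

section WeightedVolume

variable {V : Type*} [NormedAddCommGroup V] [NormedSpace ℝ V] [FiniteDimensional ℝ V]
  {Γ : Submodule ℤ V} [DiscreteTopology Γ]
  {B : Type*} [TopologicalSpace B] [ChartedSpace (EuclideanHalfSpace 3) B]

/-- The coordinates of a basis, as continuous linear functionals. -/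
noncomputable def Module.Basis.coordL (b : Basis (Fin 3) ℝ V) (i : Fin 3) : V →L[ℝ] ℝ :=
  LinearMap.toContinuousLinearMap (b.coord i)

theorem Module.Basis.coordL_apply (b : Basis (Fin 3) ℝ V) (i : Fin 3) (v : V) :
    b.coordL i v = b.repr v i := rfl

/-- The pullback of the 3-form `Φ dx₀ ∧ dx₁ ∧ dx₂` on `V ⧸ Γ`, where `x` are the coordinates with
respect to the basis `b` of `V`. -/
noncomputable def weightedForm (b : Basis (Fin 3) ℝ V) (g : B → V ⧸ Γ) (Φ : V ⧸ Γ → ℝ) (x : B) :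
    TangentSpace (𝓡∂ 3) x [⋀^Fin 3]→ₗ[ℝ] ℝ :=
  Φ (g x) • rowForm fun j => (b.coordL j).comp (modelDeriv (𝓡∂ 3) 𝓘(ℝ, V) g x)

theorem formContinuous_weightedForm [IsManifold (𝓡∂ 3) ∞ B] (b : Basis (Fin 3) ℝ V)
    {g : B → V ⧸ Γ} (hg : ContMDiff (𝓡∂ 3) 𝓘(ℝ, V) ∞ g) {Φ : V ⧸ Γ → ℝ} (hΦ : Continuous Φ) :
    FormContinuous (𝓡∂ 3) (weightedForm b g Φ) := by
  refine FormContinuous.smul (formContinuous_rowForm fun p j => ?_) (hΦ.comp hg.continuous)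
  have h : ContinuousOn (fun y => (b.coordL j).comp
      ((modelDeriv (𝓡∂ 3) 𝓘(ℝ, V) g ((extChartAt (𝓡∂ 3) p).symm y)).comp
        (chartFrame (𝓡∂ 3) p y))) (extChartAt (𝓡∂ 3) p).target :=
    continuousOn_const.clm_comp (continuousOn_mfderiv_comp_chartFrame hg p)
  exact h

/-- In `dΦ = ∑ₖ ∂ₖΦ dxₖ` only the term `k = i` survives the wedge product with `dxᵢ₊₁ ∧ dxᵢ₊₂`.
Indices are modulo `3`, and a cyclic permutation is even, so no sign appears. -/
theorem wedgeForm_eq_weightedForm (b : Basis (Fin 3) ℝ V) {g : B → V ⧸ Γ}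
    (hg : ContMDiff (𝓡∂ 3) 𝓘(ℝ, V) ∞ g) {Φ Ψ : V ⧸ Γ → ℝ} (hΦ : ContDiff ℝ 1 (Φ ∘ Γ.mkQ))
    (i : Fin 3) (hΨ : ∀ v, Ψ (Γ.mkQ v) = fderiv ℝ (Φ ∘ Γ.mkQ) v (b i)) :
    wedgeForm (Φ ∘ g) g (b.coordL (i + 1)) (b.coordL (i + 2)) = weightedForm b g Ψ := by
  funext x
  obtain ⟨v, hv⟩ := Γ.mkQ_surjective (g x)
  set L := modelDeriv (𝓡∂ 3) 𝓘(ℝ, V) g x with hL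
  have hd : ∀ w, modelDeriv (𝓡∂ 3) 𝓘(ℝ, ℝ) (Φ ∘ g) x w =
      ∑ k, b.repr (L w) k * fderiv ℝ (Φ ∘ Γ.mkQ) v (b k) := by
    intro w
    rw [mfderiv_comp_quotient hg hΦ hv, ContinuousLinearMap.comp_apply]
    conv_lhs => rw [← b.sum_repr (modelDeriv (𝓡∂ 3) 𝓘(ℝ, V) g x w)]
    simp only [map_sum, map_smul, smul_eq_mul, hL]
  have key : ∀ w : Fin 3 → EuclideanSpace ℝ (Fin 3),
      rowForm ![modelDeriv (𝓡∂ 3) 𝓘(ℝ, ℝ) (Φ ∘ g) x, (b.coordL (i + 1)).comp L,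
        (b.coordL (i + 2)).comp L] w =
      Ψ (g x) * rowForm (fun j => (b.coordL j).comp L) w := by
    intro w
    rw [← hv, hΨ]
    simp only [rowForm_apply, Matrix.det_fin_three, Matrix.of_apply, Matrix.cons_val_zero,
      Matrix.cons_val_one, Matrix.cons_val, hd, ContinuousLinearMap.comp_apply,
      Basis.coordL_apply, Fin.sum_univ_three]
    fin_cases i
    · simp only [Fin.zero_eta, zero_add]
      ring
    · simp only [Fin.mk_one, show (1 : Fin 3) + 1 = 2 from rfl, show (1 : Fin 3) + 2 = 0 from rfl]
      ring
    · simp only [Fin.reduceFinMk, show (2 : Fin 3) + 1 = 0 from rfl,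
        show (2 : Fin 3) + 2 = 1 from rfl]
      ring
  exact AlternatingMap.ext key

variable [IsManifold (𝓡∂ 3) ∞ B] [T2Space B] [CompactSpace B] [OrientedAtlas (𝓡∂ 3) B]
  {S : Type*} [TopologicalSpace S] [ChartedSpace (EuclideanSpace ℝ (Fin 2)) S]
  [IsManifold (𝓡 2) ∞ S] [T2Space S] [CompactSpace S] [OrientedAtlas (𝓡 2) S] {ι : S → B}

/-- The integral of the pullback of the exact form `(∂ᵢ Φ) dx₀ ∧ dx₁ ∧ dx₂` depends only on the
values at the boundary. -/
theorem formIntegral_weightedForm_fderiv (hι : IsOrientedBoundary ι) (b : Basis (Fin 3) ℝ V)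
    {g : B → V ⧸ Γ} (hg : ContMDiff (𝓡∂ 3) 𝓘(ℝ, V) ∞ g) {Φ Ψ : V ⧸ Γ → ℝ}
    (hΦ : ContDiff ℝ 1 (Φ ∘ Γ.mkQ)) (i : Fin 3)
    (hΨ : ∀ v, Ψ (Γ.mkQ v) = fderiv ℝ (Φ ∘ Γ.mkQ) v (b i)) :
    formIntegral (𝓡∂ 3) (weightedForm b g Ψ) =
      formIntegral (𝓡 2) (surfaceForm (Φ ∘ g ∘ ι) (g ∘ ι) (b.coordL (i + 1)) (b.coordL (i + 2))) := by
  rw [← wedgeForm_eq_weightedForm b hg hΦ i hΨ]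
  exact formIntegral_wedgeForm hι (hg.comp_quotient hΦ) hg _ _

theorem formIntegral_weightedForm_const (b : Basis (Fin 3) ℝ V) (g : B → V ⧸ Γ) (c : ℝ) :
    formIntegral (𝓡∂ 3) (weightedForm b g fun _ => c) =
      c * formIntegral (𝓡∂ 3) (weightedForm b g fun _ => 1) := by
  rw [formIntegral, formIntegral, ← formIntegralWith_smul]
  congr 1
  funext x
  have key : ∀ w : Fin 3 → EuclideanSpace ℝ (Fin 3),
      c * rowForm (fun j => (b.coordL j).comp (modelDeriv (𝓡∂ 3) 𝓘(ℝ, V) g x)) w =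
      c * (1 * rowForm (fun j => (b.coordL j).comp (modelDeriv (𝓡∂ 3) 𝓘(ℝ, V) g x)) w) :=
    fun w => by rw [one_mul]
  exact AlternatingMap.ext key

end WeightedVolume

/-! ### The enclosed volume as a weighted integral -/

section Volume

variable {S : Type*} [TopologicalSpace S] [ChartedSpace (EuclideanSpace ℝ (Fin 2)) S]
  (F : Filling S) (Γ : Submodule ℤ su2) [DiscreteTopology Γ]

theorem Filling.volume_eq (b : Basis (Fin 3) ℝ su2) (g : F.B → su2 ⧸ Γ) :
    F.volume Γ g = su2.stdBasis.det b * formIntegral (𝓡∂ 3) (weightedForm b g fun _ => 1) := by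
  rw [Filling.volume, formIntegral, formIntegral, ← formIntegralWith_smul]
  congr 1
  funext x
  have h := AlternatingMap.eq_smul_basis_det b su2.det
  have key : ∀ w : Fin 3 → EuclideanSpace ℝ (Fin 3),
      su2.det.compLinearMap (modelDeriv (𝓡∂ 3) 𝓘(ℝ, su2) g x).toLinearMap w =
      su2.stdBasis.det b * ((1 : ℝ) *
        rowForm (fun j => (b.coordL j).comp (modelDeriv (𝓡∂ 3) 𝓘(ℝ, su2) g x)) w) := by
    intro w
    rw [h, rowForm_apply, one_mul, AlternatingMap.compLinearMap_apply, AlternatingMap.smul_apply,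
      smul_eq_mul, Basis.det_apply, ← Matrix.det_transpose]
    rfl
  exact AlternatingMap.ext key

theorem Filling.volume_add_const (c : su2 ⧸ Γ) {g : F.B → su2 ⧸ Γ}
    (hg : ContMDiff (𝓡∂ 3) 𝓘(ℝ, su2) ∞ g) : F.volume Γ (fun x => g x + c) = F.volume Γ g := by
  rw [Filling.volume, Filling.volume]
  congr 1
  funext x
  have h := mfderiv_add_const_quotient hg c x
  change su2.det.compLinearMap (modelDeriv (𝓡∂ 3) 𝓘(ℝ, su2) (fun x => g x + c) x).toLinearMap =
    su2.det.compLinearMap (modelDeriv (𝓡∂ 3) 𝓘(ℝ, su2) g x).toLinearMap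
  rw [h]

end Volume

/-! ### Sublattices of rank two -/

section RankTwo

variable {V : Type*} [NormedAddCommGroup V]

/-- The values of `d` lie in `Γ ⧸ Γ'`. In a chart they become elements of the discrete group `Γ`, so
`d` is locally constant, and `S` is connected. -/
theorem sub_eq_const_of_factor_eq {Γ Γ' : Submodule ℤ V} [DiscreteTopology Γ]
    [DiscreteTopology Γ'] (hΓ : Γ' ≤ Γ) {S : Type*} [TopologicalSpace S] [ConnectedSpace S]
    {d : S → V ⧸ Γ'} (hd : Continuous d) (h : ∀ s, Submodule.factor hΓ (d s) = 0) :
    ∃ c, ∀ s, d s = c := by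
  have hloc : IsLocallyConstant d := by
    rw [IsLocallyConstant.iff_eventually_eq]
    intro s
    set e := chartAt V (d s)
    have hes : d s ∈ e.source := mem_chart_source V (d s)
    have hsrc : ∀ᶠ t in 𝓝 s, d t ∈ e.source :=
      hd.continuousAt (e.open_source.mem_nhds hes)
    have hmem : ∀ᶠ t in 𝓝 s, e (d t) ∈ Γ := by
      filter_upwards [hsrc] with t ht
      have h1 : Γ'.mkQ (e (d t)) = d t := by
        rw [← mkQ_chart_symm Γ' e (chart_mem_atlas V (d s)), e.left_inv ht]
      have h2 := h t
      rw [← h1] at h2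
      exact (Submodule.Quotient.mk_eq_zero Γ).1 h2
    have hc : ContinuousAt (fun t => e (d t)) s := (e.continuousAt hes).comp hd.continuousAt
    filter_upwards [eventually_eq_of_mem_discrete Γ hc hmem, hsrc] with t ht hts
    exact e.injOn hts hes ht
  obtain ⟨s₀⟩ := (inferInstance : Nonempty S)
  exact ⟨d s₀, fun s => hloc.apply_eq_of_preconnectedSpace s s₀⟩

/-- If the real span were all of `V`, then `Γ'` would be a full lattice, of rank `3`. -/
theorem exists_functional_of_finrank_eq_two [NormedSpace ℝ V] [FiniteDimensional ℝ V]
    (hV : Module.finrank ℝ V = 3)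
    {Γ' : Submodule ℤ V} [DiscreteTopology Γ'] (h : Module.finrank ℤ Γ' = 2) :
    ∃ l : V →ₗ[ℝ] ℝ, l ≠ 0 ∧ ∀ v ∈ Γ', l v = 0 := by
  have hlt : Submodule.span ℝ (Γ' : Set V) < ⊤ := by
    rw [lt_top_iff_ne_top]
    intro htop
    have : IsZLattice ℝ Γ' := ⟨htop⟩
    have := ZLattice.rank ℝ Γ'
    omega
  obtain ⟨l, hl, hker⟩ := Submodule.exists_le_ker_of_lt_top _ hlt
  exact ⟨l, hl, fun v hv => hker (Submodule.subset_span hv)⟩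

/-- The volume of a filling in the quotient by a lattice of rank `2` is determined by the
boundary values. -/
theorem Filling.volume_eq_of_finrank_eq_two {S : Type*} [TopologicalSpace S]
    [ChartedSpace (EuclideanSpace ℝ (Fin 2)) S] [IsManifold (𝓡 2) ∞ S] [T2Space S] [CompactSpace S]
    [OrientedAtlas (𝓡 2) S] {Γ' : Submodule ℤ su2} [DiscreteTopology Γ']
    (hrank : Module.finrank ℤ Γ' = 2) (F₁ : Filling S) (F₂ : Filling S) {g₁ : F₁.B → su2 ⧸ Γ'}
    {g₂ : F₂.B → su2 ⧸ Γ'} (hg₁ : ContMDiff (𝓡∂ 3) 𝓘(ℝ, su2) ∞ g₁)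
    (hg₂ : ContMDiff (𝓡∂ 3) 𝓘(ℝ, su2) ∞ g₂) (h : ∀ s, g₁ (F₁.incl s) = g₂ (F₂.incl s)) :
    F₁.volume Γ' g₁ = F₂.volume Γ' g₂ := by
  have hV : Module.finrank ℝ su2 = 3 := by
    rw [Module.finrank_eq_card_basis su2.stdBasis, Fintype.card_fin]
  obtain ⟨l, hl, hlΓ⟩ := exists_functional_of_finrank_eq_two hV hrank
  obtain ⟨i, hi⟩ : ∃ i, l (su2.stdBasis i) ≠ 0 := by
    by_contra! hcon
    exact hl (su2.stdBasis.ext fun i => by simp [hcon i])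
  set L : su2 →L[ℝ] ℝ := LinearMap.toContinuousLinearMap l
  -- The functional descends to the quotient, where `d(l dxᵢ₊₁ ∧ dxᵢ₊₂) = l(bᵢ) dx₀ ∧ dx₁ ∧ dx₂`
  -- with `l(bᵢ) ≠ 0`. Hence the volume form is exact.
  set Φ : su2 ⧸ Γ' → ℝ :=
    fun x => Γ'.liftQ l.toAddMonoidHom.toIntLinearMap (fun v hv => hlΓ v hv) x
  have hΦ : Φ ∘ Γ'.mkQ = L := rfl
  have hΦd : ContDiff ℝ 1 (Φ ∘ Γ'.mkQ) := by rw [hΦ]; exact L.contDiff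
  have hΨ : ∀ v, (fun _ : su2 ⧸ Γ' => l (su2.stdBasis i)) (Γ'.mkQ v) =
      fderiv ℝ (Φ ∘ Γ'.mkQ) v (su2.stdBasis i) := by
    intro v
    rw [hΦ, L.fderiv]
    rfl
  have h1 := formIntegral_weightedForm_fderiv F₁.isOrientedBoundary su2.stdBasis hg₁ hΦd
    (Ψ := fun _ => l (su2.stdBasis i)) i hΨ
  have h2 := formIntegral_weightedForm_fderiv F₂.isOrientedBoundary su2.stdBasis hg₂ hΦd
    (Ψ := fun _ => l (su2.stdBasis i)) i hΨ
  have h3 : g₁ ∘ F₁.incl = g₂ ∘ F₂.incl := funext h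
  rw [h3, ← h2, formIntegral_weightedForm_const (c := l (su2.stdBasis i)) (g := g₁),
    formIntegral_weightedForm_const (c := l (su2.stdBasis i)) (g := g₂)] at h1
  rw [F₁.volume_eq Γ' su2.stdBasis, F₂.volume_eq Γ' su2.stdBasis]
  congr 1
  exact mul_left_cancel₀ hi h1

end RankTwo

section FormIntegral

variable {n : ℕ} {H : Type*} [TopologicalSpace H]
  {I : ModelWithCorners ℝ (EuclideanSpace ℝ (Fin n)) H}
  {M : Type*} [TopologicalSpace M] [ChartedSpace H M] [IsManifold I ∞ M] [T2Space M]
  [CompactSpace M] [OrientedAtlas I M]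

theorem formIntegral_add {η θ : ∀ x : M, TangentSpace I x [⋀^Fin n]→ₗ[ℝ] ℝ}
    (hη : FormContinuous I η) (hθ : FormContinuous I θ) :
    formIntegral I (fun x => η x + θ x) = formIntegral I η + formIntegral I θ := by
  have hρ := (SmoothPartitionOfUnity.exists_isSubordinate_chartAt_source I M).choose_spec
  have h := formIntegralWith_finset_sum
    (SmoothPartitionOfUnity.exists_isSubordinate_chartAt_source I M).choose Finset.univ ![η, θ]
    (by
      intro j _
      fin_cases j
      · exact hη.formIntegrable hρ
      · exact hθ.formIntegrable hρ)
  simp only [Fin.sum_univ_two] at h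
  exact h

theorem formIntegral_smul (c : ℝ) (η : ∀ x : M, TangentSpace I x [⋀^Fin n]→ₗ[ℝ] ℝ) :
    formIntegral I (fun x => c • η x) = c * formIntegral I η :=
  formIntegralWith_smul _ c η

end FormIntegral

/-! ### Products of periodic functions on the quotient -/

section Periodic

open MeasureTheory

theorem Function.Periodic.apply_eq_of_sub_eq_int {h : ℝ → ℝ} (hh : Function.Periodic h 1)
    {s t : ℝ} {m : ℤ} (hst : s - t = m) : h s = h t := by
  have := hh.int_mul m t
  rw [mul_one, ← hst] at this
  rw [← this]
  congr 1
  ring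

/-- Once its mean is subtracted, `h` integrates to zero over each period. -/
theorem periodic_integral_sub_mean {h : ℝ → ℝ} (hh : Function.Periodic h 1) (hc : Continuous h) :
    Function.Periodic (fun s => ∫ t in (0 : ℝ)..s, (h t - ∫ r in (0 : ℝ)..1, h r)) 1 := by
  intro s
  set c := ∫ r in (0 : ℝ)..1, h r with hc'
  have hi : ∀ a b : ℝ, IntervalIntegrable (fun t => h t - c) volume a b := fun a b =>
    (hc.sub continuous_const).intervalIntegrable a b
  have h1 : (∫ t in s..(s + 1), (h t - c)) = 0 := by
    rw [intervalIntegral.integral_sub (hc.intervalIntegrable _ _) (by simp),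
      hh.intervalIntegral_add_eq s 0]
    simp [hc']
  change ∫ t in (0 : ℝ)..(s + 1), (h t - c) = ∫ t in (0 : ℝ)..s, (h t - c)
  rw [← intervalIntegral.integral_add_adjacent_intervals (hi 0 s) (hi s (s + 1)), h1, add_zero]

variable {V : Type*} [NormedAddCommGroup V] [NormedSpace ℝ V] [FiniteDimensional ℝ V]
  {Γ : Submodule ℤ V}

variable (Γ) in
/-- `∏ᵢ hᵢ (xᵢ)` as a function on `V ⧸ Γ`, where `x` are the coordinates with respect to the
basis `b`; it is meaningful if the `hᵢ` are periodic with period `1` and the elements of `Γ` have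
integral coordinates. -/
noncomputable def prodFun (b : Basis (Fin 3) ℝ V) (h : Fin 3 → ℝ → ℝ) (x : V ⧸ Γ) : ℝ :=
  ∏ i, h i (b.coordL i (Quotient.out x))

/-- Two representatives differ by a vector with integral coordinates, which periodicity ignores; the
choice made by `Quotient.out` is therefore immaterial. -/
theorem prodFun_mkQ {b : Basis (Fin 3) ℝ V} (hb : ∀ v ∈ Γ, ∀ i, ∃ m : ℤ, b.coordL i v = m)
    {h : Fin 3 → ℝ → ℝ} (hh : ∀ i, Function.Periodic (h i) 1) (v : V) :
    prodFun Γ b h (Γ.mkQ v) = ∏ i, h i (b.coordL i v) := by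
  refine Finset.prod_congr rfl fun i _ => ?_
  have h1 : Γ.mkQ (Quotient.out (Γ.mkQ v)) = Γ.mkQ v := Quotient.out_eq (Γ.mkQ v)
  obtain ⟨m, hm⟩ := hb _ ((Submodule.Quotient.eq Γ).1 h1) i
  rw [map_sub] at hm
  exact (hh i).apply_eq_of_sub_eq_int hm

theorem contDiff_prodFun_comp_mkQ {b : Basis (Fin 3) ℝ V}
    (hb : ∀ v ∈ Γ, ∀ i, ∃ m : ℤ, b.coordL i v = m) {h : Fin 3 → ℝ → ℝ}
    (hh : ∀ i, Function.Periodic (h i) 1) (hd : ∀ i, ContDiff ℝ 1 (h i)) :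
    ContDiff ℝ 1 (prodFun Γ b h ∘ Γ.mkQ) := by
  have h1 : prodFun Γ b h ∘ Γ.mkQ = fun v => ∏ i, h i (b.coordL i v) :=
    funext (prodFun_mkQ hb hh)
  rw [h1]
  exact contDiff_prod fun i _ => (hd i).comp (b.coordL i).contDiff

theorem continuous_prodFun {b : Basis (Fin 3) ℝ V}
    (hb : ∀ v ∈ Γ, ∀ i, ∃ m : ℤ, b.coordL i v = m) {h : Fin 3 → ℝ → ℝ}
    (hh : ∀ i, Function.Periodic (h i) 1) (hd : ∀ i, Continuous (h i)) :
    Continuous (prodFun Γ b h) := by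
  have h1 : prodFun Γ b h ∘ Γ.mkQ = fun v => ∏ i, h i (b.coordL i v) :=
    funext (prodFun_mkQ hb hh)
  have h2 : Continuous (prodFun Γ b h ∘ Γ.mkQ) := by
    rw [h1]
    exact continuous_finsetProd _ fun i _ => (hd i).comp (b.coordL i).continuous
  exact continuous_coinduced_dom.2 h2

theorem fderiv_prodFun_comp_mkQ {b : Basis (Fin 3) ℝ V}
    (hb : ∀ v ∈ Γ, ∀ i, ∃ m : ℤ, b.coordL i v = m) {h : Fin 3 → ℝ → ℝ}
    (hh : ∀ i, Function.Periodic (h i) 1) (hd : ∀ i, Differentiable ℝ (h i)) (v : V) (i : Fin 3) :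
    fderiv ℝ (prodFun Γ b h ∘ Γ.mkQ) v (b i) =
      (∏ j ∈ Finset.univ.erase i, h j (b.coordL j v)) * deriv (h i) (b.coordL i v) := by
  have h1 : prodFun Γ b h ∘ Γ.mkQ = fun v => ∏ i, h i (b.coordL i v) :=
    funext (prodFun_mkQ hb hh)
  have h2 := HasFDerivAt.finsetProd (u := Finset.univ) fun j _ =>
    ((hd j (b.coordL j v)).hasDerivAt.comp_hasFDerivAt v (b.coordL j).hasFDerivAt)
  simp only [Function.comp_apply] at h2
  rw [h1, h2.fderiv, _root_.sum_apply, Finset.sum_eq_single i]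
  · simp [Basis.coordL_apply]
  · intro j _ hj
    simp [Basis.coordL_apply, hj.symm]
  · simp

theorem prodFun_update_sub (b : Basis (Fin 3) ℝ V) (h : Fin 3 → ℝ → ℝ) (i : Fin 3) (c : ℝ)
    (x : V ⧸ Γ) : prodFun Γ b (Function.update h i fun s => h i s - c) x =
      prodFun Γ b h x + (-c) * prodFun Γ b (Function.update h i fun _ => 1) x := by
  have key : ∀ k : ℝ → ℝ, prodFun Γ b (Function.update h i k) x =
      k (b.coordL i (Quotient.out x)) *
        ∏ j ∈ Finset.univ.erase i, h j (b.coordL j (Quotient.out x)) := by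
    intro k
    rw [prodFun, ← Finset.mul_prod_erase _ _ (Finset.mem_univ i), Function.update_self]
    congr 1
    refine Finset.prod_congr rfl fun j hj => ?_
    rw [Function.update_of_ne (Finset.ne_of_mem_erase hj)]
  have h1 := key (h i)
  rw [Function.update_eq_self] at h1
  rw [key, key, h1]
  ring

end Periodic

/-! ### Replacing periodic factors by their means -/

section Averaging

variable {V : Type*} [NormedAddCommGroup V] [NormedSpace ℝ V] [FiniteDimensional ℝ V]
  {Γ : Submodule ℤ V} [DiscreteTopology Γ]
  {S : Type*} [TopologicalSpace S] [ChartedSpace (EuclideanSpace ℝ (Fin 2)) S]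
  [IsManifold (𝓡 2) ∞ S] [T2Space S] [CompactSpace S] [OrientedAtlas (𝓡 2) S]
  {B₁ : Type*} [TopologicalSpace B₁] [ChartedSpace (EuclideanHalfSpace 3) B₁]
  [IsManifold (𝓡∂ 3) ∞ B₁] [T2Space B₁] [CompactSpace B₁] [OrientedAtlas (𝓡∂ 3) B₁] {ι₁ : S → B₁}
  {B₂ : Type*} [TopologicalSpace B₂] [ChartedSpace (EuclideanHalfSpace 3) B₂]
  [IsManifold (𝓡∂ 3) ∞ B₂] [T2Space B₂] [CompactSpace B₂] [OrientedAtlas (𝓡∂ 3) B₂] {ι₂ : S → B₂}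

theorem formIntegral_weightedForm_update_sub {b : Basis (Fin 3) ℝ V}
    (hb : ∀ v ∈ Γ, ∀ i, ∃ m : ℤ, b.coordL i v = m) {h : Fin 3 → ℝ → ℝ}
    (hh : ∀ i, Function.Periodic (h i) 1) (hd : ∀ i, Continuous (h i)) {g : B₁ → V ⧸ Γ}
    (hg : ContMDiff (𝓡∂ 3) 𝓘(ℝ, V) ∞ g) (i : Fin 3) (c : ℝ) :
    formIntegral (𝓡∂ 3) (weightedForm b g
        (prodFun Γ b (Function.update h i fun s => h i s - c))) =
      formIntegral (𝓡∂ 3) (weightedForm b g (prodFun Γ b h)) - c *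
        formIntegral (𝓡∂ 3) (weightedForm b g (prodFun Γ b (Function.update h i fun _ => 1))) := by
  have hc₁ := continuous_prodFun hb hh hd
  have hc₂ : Continuous fun x => (-c) * prodFun Γ b (Function.update h i fun _ => 1) x := by
    refine continuous_const.mul (continuous_prodFun hb (fun j => ?_) fun j => ?_)
    · rcases eq_or_ne j i with rfl | hj
      · rw [Function.update_self]; exact fun _ => rfl
      · rw [Function.update_of_ne hj]; exact hh j
    · rcases eq_or_ne j i with rfl | hj
      · rw [Function.update_self]; exact continuous_const
      · rw [Function.update_of_ne hj]; exact hd j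
  have h1 := formIntegral_add (formContinuous_weightedForm b hg hc₁)
    (formContinuous_weightedForm b hg hc₂)
  have h2 : (fun x => weightedForm b g (prodFun Γ b h) x + weightedForm b g
      (fun x => (-c) * prodFun Γ b (Function.update h i fun _ => 1) x) x) =
      weightedForm b g (prodFun Γ b (Function.update h i fun s => h i s - c)) := by
    funext x
    have key : ∀ w : Fin 3 → EuclideanSpace ℝ (Fin 3),
        prodFun Γ b h (g x) *
          rowForm (fun j => (b.coordL j).comp (modelDeriv (𝓡∂ 3) 𝓘(ℝ, V) g x)) w +
        ((-c) * prodFun Γ b (Function.update h i fun _ => 1) (g x)) *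
          rowForm (fun j => (b.coordL j).comp (modelDeriv (𝓡∂ 3) 𝓘(ℝ, V) g x)) w =
        prodFun Γ b (Function.update h i fun s => h i s - c) (g x) *
          rowForm (fun j => (b.coordL j).comp (modelDeriv (𝓡∂ 3) 𝓘(ℝ, V) g x)) w := by
      intro w
      rw [prodFun_update_sub]
      ring
    exact AlternatingMap.ext key
  have h3 : (fun x => (-c) • weightedForm b g (prodFun Γ b (Function.update h i fun _ => 1)) x) =
      weightedForm b g (fun x => (-c) * prodFun Γ b (Function.update h i fun _ => 1) x) := by
    funext x
    have key : ∀ w : Fin 3 → EuclideanSpace ℝ (Fin 3),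
        (-c) * (prodFun Γ b (Function.update h i fun _ => 1) (g x) *
          rowForm (fun j => (b.coordL j).comp (modelDeriv (𝓡∂ 3) 𝓘(ℝ, V) g x)) w) =
        ((-c) * prodFun Γ b (Function.update h i fun _ => 1) (g x)) *
          rowForm (fun j => (b.coordL j).comp (modelDeriv (𝓡∂ 3) 𝓘(ℝ, V) g x)) w := by
      intro w
      ring
    exact AlternatingMap.ext key
  rw [h2, ← h3, formIntegral_smul] at h1
  rw [h1]
  ring

/-- A product function one of whose factors has mean zero integrates to a quantity that is
determined by the boundary values. -/
theorem formIntegral_weightedForm_sub_mean_eq (hι₁ : IsOrientedBoundary ι₁)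
    (hι₂ : IsOrientedBoundary ι₂) {b : Basis (Fin 3) ℝ V}
    (hb : ∀ v ∈ Γ, ∀ i, ∃ m : ℤ, b.coordL i v = m) {h : Fin 3 → ℝ → ℝ}
    (hh : ∀ i, Function.Periodic (h i) 1) (hd : ∀ i, ContDiff ℝ 1 (h i)) {g₁ : B₁ → V ⧸ Γ}
    (hg₁ : ContMDiff (𝓡∂ 3) 𝓘(ℝ, V) ∞ g₁) {g₂ : B₂ → V ⧸ Γ}
    (hg₂ : ContMDiff (𝓡∂ 3) 𝓘(ℝ, V) ∞ g₂) (hgg : g₁ ∘ ι₁ = g₂ ∘ ι₂) (i : Fin 3) :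
    formIntegral (𝓡∂ 3) (weightedForm b g₁
        (prodFun Γ b (Function.update h i fun s => h i s - ∫ r in (0 : ℝ)..1, h i r))) =
      formIntegral (𝓡∂ 3) (weightedForm b g₂
        (prodFun Γ b (Function.update h i fun s => h i s - ∫ r in (0 : ℝ)..1, h i r))) := by
  set c := ∫ r in (0 : ℝ)..1, h i r with hc
  -- With the factor `h i` replaced by this periodic primitive, the product is a function on the
  -- quotient whose `i`-th partial derivative is the given weight.
  set ψ : ℝ → ℝ := fun s => ∫ t in (0 : ℝ)..s, (h i t - c) with hψ
  have hcont : Continuous fun t => h i t - c := (hd i).continuous.sub continuous_const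
  have hψd : ∀ s, HasDerivAt ψ (h i s - c) s := fun s =>
    intervalIntegral.integral_hasDerivAt_right (hcont.intervalIntegrable _ _)
      (hcont.stronglyMeasurableAtFilter _ _) hcont.continuousAt
  have hψp : Function.Periodic ψ 1 := periodic_integral_sub_mean (hh i) (hd i).continuous
  have hψc : ContDiff ℝ 1 ψ := by
    rw [contDiff_one_iff_deriv]
    refine ⟨fun s => (hψd s).differentiableAt, ?_⟩
    rw [show deriv ψ = fun s => h i s - c from funext fun s => (hψd s).deriv]
    exact hcont
  set k := Function.update h i ψ with hk
  have hkp : ∀ j, Function.Periodic (k j) 1 := by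
    intro j
    rcases eq_or_ne j i with rfl | hj
    · rw [hk, Function.update_self]; exact hψp
    · rw [hk, Function.update_of_ne hj]; exact hh j
  have hkd : ∀ j, ContDiff ℝ 1 (k j) := by
    intro j
    rcases eq_or_ne j i with rfl | hj
    · rw [hk, Function.update_self]; exact hψc
    · rw [hk, Function.update_of_ne hj]; exact hd j
  have hup : ∀ j, Function.Periodic (Function.update h i (fun s => h i s - c) j) 1 := by
    intro j
    rcases eq_or_ne j i with rfl | hj
    · rw [Function.update_self]; exact fun s => by simp only [hh j s]
    · rw [Function.update_of_ne hj]; exact hh j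
  have hΨ : ∀ v, prodFun Γ b (Function.update h i fun s => h i s - c) (Γ.mkQ v) =
      fderiv ℝ (prodFun Γ b k ∘ Γ.mkQ) v (b i) := by
    intro v
    rw [fderiv_prodFun_comp_mkQ hb hkp (fun j => (hkd j).differentiable one_ne_zero),
      prodFun_mkQ hb hup, ← Finset.prod_erase_mul _ _ (Finset.mem_univ i)]
    congr 1
    · refine Finset.prod_congr rfl fun j hj => ?_
      rw [hk, Function.update_of_ne (Finset.ne_of_mem_erase hj),
        Function.update_of_ne (Finset.ne_of_mem_erase hj)]
    · rw [hk, Function.update_self, Function.update_self, (hψd _).deriv]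
  have hkc := contDiff_prodFun_comp_mkQ hb hkp hkd
  rw [formIntegral_weightedForm_fderiv hι₁ b hg₁ hkc i hΨ,
    formIntegral_weightedForm_fderiv hι₂ b hg₂ hkc i hΨ, hgg]

/-- Subtracting its mean from one factor leaves a weight whose integrals over the two fillings
agree. In the difference that factor may thus be replaced by the constant `1` at the cost of its
mean; three such steps leave the weight `1`. -/
theorem formIntegral_weightedForm_sub_eq_mul (hι₁ : IsOrientedBoundary ι₁)
    (hι₂ : IsOrientedBoundary ι₂) {b : Basis (Fin 3) ℝ V}
    (hb : ∀ v ∈ Γ, ∀ i, ∃ m : ℤ, b.coordL i v = m) {h : Fin 3 → ℝ → ℝ}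
    (hh : ∀ i, Function.Periodic (h i) 1) (hd : ∀ i, ContDiff ℝ 1 (h i)) {g₁ : B₁ → V ⧸ Γ}
    (hg₁ : ContMDiff (𝓡∂ 3) 𝓘(ℝ, V) ∞ g₁) {g₂ : B₂ → V ⧸ Γ}
    (hg₂ : ContMDiff (𝓡∂ 3) 𝓘(ℝ, V) ∞ g₂) (hgg : g₁ ∘ ι₁ = g₂ ∘ ι₂) :
    formIntegral (𝓡∂ 3) (weightedForm b g₁ (prodFun Γ b h)) -
        formIntegral (𝓡∂ 3) (weightedForm b g₂ (prodFun Γ b h)) =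
      (∏ i, ∫ r in (0 : ℝ)..1, h i r) *
        (formIntegral (𝓡∂ 3) (weightedForm b g₁ fun _ => 1) -
          formIntegral (𝓡∂ 3) (weightedForm b g₂ fun _ => 1)) := by
  have step : ∀ k : Fin 3 → ℝ → ℝ, (∀ i, Function.Periodic (k i) 1) →
      (∀ i, ContDiff ℝ 1 (k i)) → ∀ i,
      formIntegral (𝓡∂ 3) (weightedForm b g₁ (prodFun Γ b k)) -
        formIntegral (𝓡∂ 3) (weightedForm b g₂ (prodFun Γ b k)) = (∫ r in (0 : ℝ)..1, k i r) *
      (formIntegral (𝓡∂ 3) (weightedForm b g₁ (prodFun Γ b (Function.update k i fun _ => 1))) -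
        formIntegral (𝓡∂ 3)
          (weightedForm b g₂ (prodFun Γ b (Function.update k i fun _ => 1)))) := by
    intro k hk hkd i
    have h1 := formIntegral_weightedForm_sub_mean_eq hι₁ hι₂ hb hk hkd hg₁ hg₂ hgg i
    rw [formIntegral_weightedForm_update_sub hb hk (fun j => (hkd j).continuous) hg₁,
      formIntegral_weightedForm_update_sub hb hk (fun j => (hkd j).continuous) hg₂] at h1
    linear_combination h1
  have hper : ∀ k : Fin 3 → ℝ → ℝ, (∀ i, Function.Periodic (k i) 1) → ∀ i j,
      Function.Periodic (Function.update k i (fun _ => 1) j) 1 := by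
    intro k hk i j
    rcases eq_or_ne j i with rfl | hj
    · rw [Function.update_self]; exact fun _ => rfl
    · rw [Function.update_of_ne hj]; exact hk j
  have hdif : ∀ k : Fin 3 → ℝ → ℝ, (∀ i, ContDiff ℝ 1 (k i)) → ∀ i j,
      ContDiff ℝ 1 (Function.update k i (fun _ => 1) j) := by
    intro k hk i j
    rcases eq_or_ne j i with rfl | hj
    · rw [Function.update_self]; exact contDiff_const
    · rw [Function.update_of_ne hj]; exact hk j
  set k₀ := Function.update h 0 fun _ => 1 with hk₀
  set k₁ := Function.update k₀ 1 fun _ => 1 with hk₁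
  have h3 : prodFun Γ b (Function.update k₁ 2 fun _ => 1) = fun _ => 1 := by
    funext x
    rw [prodFun, Fin.prod_univ_three]
    simp [hk₁, hk₀]
  rw [step h hh hd 0, step k₀ (hper h hh 0) (hdif h hd 0) 1,
    step k₁ (hper k₀ (hper h hh 0) 1) (hdif k₀ (hdif h hd 0) 1) 2, h3, Fin.prod_univ_three]
  simp only [hk₁, hk₀, Function.update_apply]
  simp
  ring

end Averaging

/-! ### Regular values and Sard's theorem -/

section RegularValue

open MeasureTheory

variable {V : Type*} [NormedAddCommGroup V] [NormedSpace ℝ V]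
  {Γ : Submodule ℤ V} [DiscreteTopology Γ]
  {B : Type*} [TopologicalSpace B] [ChartedSpace (EuclideanHalfSpace 3) B]

/-- The coordinates of a basis, as an equivalence with the Euclidean space. -/
noncomputable def Module.Basis.coordEquiv (b : Basis (Fin 3) ℝ V) :
    V ≃L[ℝ] EuclideanSpace ℝ (Fin 3) :=
  b.equivFunL.trans (EuclideanSpace.equiv (Fin 3) ℝ).symm

theorem Module.Basis.coordEquiv_apply [FiniteDimensional ℝ V] (b : Basis (Fin 3) ℝ V) (v : V) (i : Fin 3) :
    b.coordEquiv v i = b.coordL i v := rfl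

/-- The derivative of `g` in the chart at `q` and in the coordinates of the basis `b`. -/
noncomputable def coordDeriv (b : Basis (Fin 3) ℝ V) (g : B → V ⧸ Γ) (q : B)
    (y : EuclideanSpace ℝ (Fin 3)) : EuclideanSpace ℝ (Fin 3) →L[ℝ] EuclideanSpace ℝ (Fin 3) :=
  (b.coordEquiv : V →L[ℝ] EuclideanSpace ℝ (Fin 3)).comp
    ((modelDeriv (𝓡∂ 3) 𝓘(ℝ, V) g ((extChartAt (𝓡∂ 3) q).symm y)).comp (chartFrame (𝓡∂ 3) q y))

/-- An interior point at which the derivative of `g` is invertible. -/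
def IsRegularPoint (b : Basis (Fin 3) ℝ V) (g : B → V ⧸ Γ) (x : B) : Prop :=
  ∃ q : B, ∃ y ∈ (extChartAt (𝓡∂ 3) q).target, (extChartAt (𝓡∂ 3) q).symm y = x ∧
    range (𝓡∂ 3) ∈ 𝓝 y ∧ (coordDeriv b g q y).det ≠ 0

theorem range_halfSpace_mem_nhds {y : EuclideanSpace ℝ (Fin 3)} (hy : y ∈ range (𝓡∂ 3))
    (h0 : y 0 ≠ 0) : range (𝓡∂ 3) ∈ 𝓝 y := by
  rw [← mem_interior_iff_mem_nhds, interior_range_modelWithCornersEuclideanHalfSpace]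
  rw [range_modelWithCornersEuclideanHalfSpace] at hy
  exact lt_of_le_of_ne hy h0.symm

theorem volume_zeroth_coord_eq_zero :
    volume {y : EuclideanSpace ℝ (Fin 3) | y 0 = 0} = 0 := by
  refine Measure.addHaar_submodule volume
    (LinearMap.ker (EuclideanSpace.proj (𝕜 := ℝ) (0 : Fin 3)).toLinearMap) fun h => ?_
  have h1 : EuclideanSpace.single (0 : Fin 3) (1 : ℝ) ∈
      LinearMap.ker (EuclideanSpace.proj (𝕜 := ℝ) (0 : Fin 3)).toLinearMap := h ▸ Submodule.mem_top
  simp at h1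

/-- The derivative in coordinates is the derivative of a local lift. -/
theorem coordDeriv_eq_fderivWithin [IsManifold (𝓡∂ 3) ∞ B] (b : Basis (Fin 3) ℝ V)
    {g : B → V ⧸ Γ} {G : B → V} {q : B} {y : EuclideanSpace ℝ (Fin 3)}
    (hy : y ∈ (extChartAt (𝓡∂ 3) q).target)
    (hG : MDifferentiableAt (𝓡∂ 3) 𝓘(ℝ, V) G ((extChartAt (𝓡∂ 3) q).symm y))
    (h : ∀ᶠ x in 𝓝 ((extChartAt (𝓡∂ 3) q).symm y), Γ.mkQ (G x) = g x) :
    fderivWithin ℝ ((fun x => b.coordEquiv (G x)) ∘ (extChartAt (𝓡∂ 3) q).symm) (range (𝓡∂ 3)) y =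
      coordDeriv b g q y := by
  have h1 := (differentiableWithinAt_comp_extChartAt_symm hy hG).hasFDerivWithinAt
  have h2 := (b.coordEquiv.hasFDerivAt
    (x := (G ∘ (extChartAt (𝓡∂ 3) q).symm) y)).comp_hasFDerivWithinAt y h1
  rw [fderivWithin_comp_extChartAt_symm hy hG, ← mfderiv_eq_of_local_lift hG h] at h2
  exact h2.fderivWithin
    ((𝓡∂ 3).uniqueDiffOn y (extChartAt_target_subset_range q hy))

variable [FiniteDimensional ℝ V]

theorem countable_of_discreteTopology (Γ : Submodule ℤ V) [DiscreteTopology Γ] : Countable Γ := by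
  have : ProperSpace V := FiniteDimensional.proper ℝ V
  exact TopologicalSpace.separableSpace_iff_countable.1 inferInstance

/-- **Sard's theorem** for maps to `V ⧸ Γ`: almost all points of `V` represent regular values. -/
theorem volume_irregular_values [IsManifold (𝓡∂ 3) ∞ B] [CompactSpace B]
    (b : Basis (Fin 3) ℝ V) {g : B → V ⧸ Γ} (hg : ContMDiff (𝓡∂ 3) 𝓘(ℝ, V) ∞ g) :
    volume (b.coordEquiv '' {v | ∃ x, g x = Γ.mkQ v ∧ ¬ IsRegularPoint b g x}) = 0 := by
  set N : Set B → Set (EuclideanSpace ℝ (Fin 3)) := fun s =>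
    b.coordEquiv '' {v | ∃ x ∈ s, g x = Γ.mkQ v ∧ ¬ IsRegularPoint b g x} with hN
  suffices volume (N univ) = 0 by simpa [hN] using this
  refine isCompact_univ.induction_on (p := fun s => volume (N s) = 0) ?_ ?_ ?_ ?_
  · simp [hN]
  · intro s t hst ht
    refine measure_mono_null (image_mono ?_) ht
    rintro v ⟨x, hx, h⟩
    exact ⟨x, hst hx, h⟩
  · intro s t hs ht
    refine measure_mono_null ?_ (measure_union_null hs ht)
    rintro _ ⟨v, ⟨x, hx | hx, h⟩, rfl⟩
    · exact Or.inl ⟨v, ⟨x, hx, h⟩, rfl⟩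
    · exact Or.inr ⟨v, ⟨x, hx, h⟩, rfl⟩
  intro q _
  obtain ⟨v₀, hv₀⟩ := Γ.mkQ_surjective (g q)
  obtain ⟨U, hU, hqU, G, -, hG, hGg⟩ := exists_local_lift hg hv₀
  refine ⟨U ∩ (extChartAt (𝓡∂ 3) q).source, ?_, ?_⟩
  · exact mem_nhdsWithin_of_mem_nhds (Filter.inter_mem (hU.mem_nhds hqU)
      (extChartAt_source_mem_nhds q))
  -- The points of `V` over `g x` are the translates of `G x` by lattice vectors; one map per
  -- vector, countably many in all.
  set k : Γ → EuclideanSpace ℝ (Fin 3) → EuclideanSpace ℝ (Fin 3) := fun γ y =>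
    ((fun x => b.coordEquiv (G x)) ∘ (extChartAt (𝓡∂ 3) q).symm) y + b.coordEquiv (γ : V) with hk
  set s := {y | y ∈ (extChartAt (𝓡∂ 3) q).target ∧ (extChartAt (𝓡∂ 3) q).symm y ∈ U ∧
    ¬ IsRegularPoint b g ((extChartAt (𝓡∂ 3) q).symm y)} with hs
  have hkd : ∀ γ, ∀ y ∈ s, HasFDerivWithinAt (k γ) (coordDeriv b g q y) (range (𝓡∂ 3)) y := by
    intro γ y hy
    have hd : MDifferentiableAt (𝓡∂ 3) 𝓘(ℝ, V) G ((extChartAt (𝓡∂ 3) q).symm y) :=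
      (hG _ hy.2.1).mdifferentiableAt (by simp)
    rw [← coordDeriv_eq_fderivWithin b hy.1 hd
      (Filter.eventually_of_mem (hU.mem_nhds hy.2.1) hGg)]
    refine DifferentiableWithinAt.hasFDerivWithinAt ?_ |>.add_const _
    exact b.coordEquiv.differentiableAt.comp_differentiableWithinAt y
      (differentiableWithinAt_comp_extChartAt_symm hy.1 hd)
  have hsr : s ⊆ range (𝓡∂ 3) := fun y hy => extChartAt_target_subset_range q hy.1
  have hsub : N (U ∩ (extChartAt (𝓡∂ 3) q).source) ⊆
      ⋃ γ, (k γ '' (s ∩ {y | y 0 = 0}) ∪ k γ '' (s \ {y | y 0 = 0})) := by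
    rintro _ ⟨v, ⟨x, ⟨hxU, hxs⟩, hgx, hx⟩, rfl⟩
    have h1 : v - G x ∈ Γ := by
      rw [← Submodule.Quotient.eq]
      exact hgx.symm.trans (hGg x hxU).symm
    have h2 : (extChartAt (𝓡∂ 3) q).symm (extChartAt (𝓡∂ 3) q x) = x :=
      (extChartAt (𝓡∂ 3) q).left_inv hxs
    have h3 : extChartAt (𝓡∂ 3) q x ∈ s := by
      refine ⟨(extChartAt (𝓡∂ 3) q).map_source hxs, ?_, ?_⟩ <;> rwa [h2]
    refine mem_iUnion.2 ⟨⟨v - G x, h1⟩, ?_⟩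
    rw [← image_union, inter_union_sdiff]
    refine ⟨_, h3, ?_⟩
    simp only [hk, Function.comp_apply, h2, map_sub]
    abel
  have : Countable Γ := countable_of_discreteTopology Γ
  refine measure_mono_null hsub (measure_iUnion_null fun γ => measure_union_null ?_ ?_)
  -- Boundary points are never regular, but they form a null set in the chart and a differentiable
  -- map keeps it null. At the other points of `s` the determinant vanishes.
  · refine addHaar_image_eq_zero_of_differentiableOn_of_addHaar_eq_zero volume
      (fun y hy => ((hkd γ y hy.1).differentiableWithinAt.mono
        (inter_subset_left.trans hsr)))
      (measure_mono_null inter_subset_right volume_zeroth_coord_eq_zero)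
  · refine addHaar_image_eq_zero_of_det_fderivWithin_eq_zero volume
      (f' := coordDeriv b g q) (fun y hy => (hkd γ y hy.1).mono (sdiff_subset.trans hsr))
      fun y hy => ?_
    by_contra hne
    exact hy.1.2.2 ⟨q, y, hy.1.1, rfl, range_halfSpace_mem_nhds (hsr hy.1) hy.2, hne⟩

end RegularValue

/-! ### Local lifts at regular points -/

section LocalDegree

open MeasureTheory

variable {V : Type*} [NormedAddCommGroup V] [NormedSpace ℝ V]
  {Γ : Submodule ℤ V} [DiscreteTopology Γ]
  {B : Type*} [TopologicalSpace B] [ChartedSpace (EuclideanHalfSpace 3) B]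

/-- On the open set `U`, the map `κ` is an injective lift of `g` in the coordinates of the basis `b`,
with Jacobian determinant of sign `ε`. -/
structure IsSignedLift (b : Basis (Fin 3) ℝ V) (g : B → V ⧸ Γ) (U : Set B)
    (κ : B → EuclideanSpace ℝ (Fin 3)) (ε : ℝ) : Prop where
  isOpen : IsOpen U
  injOn : InjOn κ U
  mkQ_eq : ∀ x ∈ U, Γ.mkQ (b.coordEquiv.symm (κ x)) = g x
  mdifferentiableAt : ∀ x ∈ U, MDifferentiableAt (𝓡∂ 3) 𝓘(ℝ, EuclideanSpace ℝ (Fin 3)) κ x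
  fderivWithin_eq : ∀ p, ∀ y ∈ (extChartAt (𝓡∂ 3) p).target, (extChartAt (𝓡∂ 3) p).symm y ∈ U →
    fderivWithin ℝ (κ ∘ (extChartAt (𝓡∂ 3) p).symm) (range (𝓡∂ 3)) y = coordDeriv b g p y
  sign_pos : ∀ p, ∀ y ∈ (extChartAt (𝓡∂ 3) p).target, (extChartAt (𝓡∂ 3) p).symm y ∈ U →
    0 < ε * (fderivWithin ℝ (κ ∘ (extChartAt (𝓡∂ 3) p).symm) (range (𝓡∂ 3)) y).det

theorem IsSignedLift.mono {b : Basis (Fin 3) ℝ V} {g : B → V ⧸ Γ} {U W : Set B}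
    {κ : B → EuclideanSpace ℝ (Fin 3)} {ε : ℝ} (h : IsSignedLift b g U κ ε) (hW : IsOpen W)
    (hWU : W ⊆ U) : IsSignedLift b g W κ ε where
  isOpen := hW
  injOn := h.injOn.mono hWU
  mkQ_eq x hx := h.mkQ_eq x (hWU hx)
  mdifferentiableAt x hx := h.mdifferentiableAt x (hWU hx)
  fderivWithin_eq p y hy hx := h.fderivWithin_eq p y hy (hWU hx)
  sign_pos p y hy hx := h.sign_pos p y hy (hWU hx)

/-- The **inverse function theorem** at a regular point. -/
theorem exists_isSignedLift [IsManifold (𝓡∂ 3) ∞ B] [OrientedAtlas (𝓡∂ 3) B]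
    {b : Basis (Fin 3) ℝ V} {g : B → V ⧸ Γ} (hg : ContMDiff (𝓡∂ 3) 𝓘(ℝ, V) ∞ g) {x : B}
    (hx : IsRegularPoint b g x) {v : V} (hv : Γ.mkQ v = g x) :
    ∃ U κ ε, IsSignedLift b g U κ ε ∧ (ε = 1 ∨ ε = -1) ∧ x ∈ U ∧ κ x = b.coordEquiv v ∧
      ContinuousOn κ U ∧
      ∀ W ∈ 𝓝 x, κ '' W ∈ 𝓝 (b.coordEquiv v) := by
  obtain ⟨q, y, hy, rfl, hr, hdet⟩ := hx
  obtain ⟨U, hU, hxU, G, hGx, hG, hGg⟩ := exists_local_lift hg hv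
  set κ : B → EuclideanSpace ℝ (Fin 3) := fun x => b.coordEquiv (G x) with hκ
  set k := κ ∘ (extChartAt (𝓡∂ 3) q).symm with hk
  have hGd : ∀ x ∈ U, MDifferentiableAt (𝓡∂ 3) 𝓘(ℝ, V) G x := fun x hx =>
    (hG x hx).mdifferentiableAt (by simp)
  have hκd : ∀ x ∈ U, MDifferentiableAt (𝓡∂ 3) 𝓘(ℝ, EuclideanSpace ℝ (Fin 3)) κ x := fun x hx =>
    b.coordEquiv.differentiableAt.mdifferentiableAt.comp x (hGd x hx)
  have hfd : ∀ p, ∀ y ∈ (extChartAt (𝓡∂ 3) p).target, (extChartAt (𝓡∂ 3) p).symm y ∈ U →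
      fderivWithin ℝ (κ ∘ (extChartAt (𝓡∂ 3) p).symm) (range (𝓡∂ 3)) y = coordDeriv b g p y :=
    fun p y hy hx => coordDeriv_eq_fderivWithin b hy (hGd _ hx)
      (Filter.eventually_of_mem (hU.mem_nhds hx) hGg)
  have hkc : ContDiffAt ℝ ∞ k y :=
    b.coordEquiv.contDiff.contDiffAt.comp y
      ((ContMDiffAt.contDiffWithinAt_comp_extChartAt_symm (k := ⊤) hy (hG _ hxU)).contDiffAt hr)
  have hky : fderiv ℝ k y = coordDeriv b g q y := by
    rw [← hfd q y hy hxU, fderivWithin_of_mem_nhds hr]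
  have hdet' : (fderiv ℝ k y).det ≠ 0 := hky ▸ hdet
  set L := (fderiv ℝ k y).toContinuousLinearEquivOfDetNeZero hdet' with hL
  have hstrict : HasStrictFDerivAt k (L : EuclideanSpace ℝ (Fin 3) →L[ℝ] _) y := by
    rw [hL, ContinuousLinearMap.coe_toContinuousLinearEquivOfDetNeZero]
    exact hkc.hasStrictFDerivAt (by simp)
  have hkyv : k y = b.coordEquiv v := by simp only [hk, hκ, Function.comp_apply, hGx]
  obtain ⟨ε, hε, hεpos⟩ : ∃ ε : ℝ, (ε = 1 ∨ ε = -1) ∧ 0 < ε * (fderiv ℝ k y).det := by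
    rcases lt_or_gt_of_ne hdet' with h | h
    · exact ⟨-1, Or.inr rfl, by linarith⟩
    · exact ⟨1, Or.inl rfl, by linarith⟩
  have hsm : ∀ᶠ z in 𝓝 y, (extChartAt (𝓡∂ 3) q).symm z ∈ U := by
    have h := extChartAt_eventually_symm_mem hy (hU.mem_nhds hxU)
    rwa [nhdsWithin_eq_nhds.2 hr] at h
  have hcont : ContinuousAt (fun z => ε * (fderiv ℝ k z).det) y :=
    continuousAt_const.mul (ContinuousLinearMap.continuous_det.continuousAt.comp
      (hkc.fderiv_right (m := 0) (by simp)).continuousAt)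
  have hev : ∀ᶠ z in 𝓝 y, z ∈ (extChartAt (𝓡∂ 3) q).target ∧ (extChartAt (𝓡∂ 3) q).symm z ∈ U ∧
      range (𝓡∂ 3) ∈ 𝓝 z ∧ 0 < ε * (fderiv ℝ k z).det ∧
      z ∈ (hstrict.toOpenPartialHomeomorph k).source := by
    filter_upwards [eventually_mem_target_of_range_mem_nhds hy hr, hsm,
      eventually_eventually_nhds.2 hr, hcont.eventually (lt_mem_nhds hεpos),
      (hstrict.toOpenPartialHomeomorph k).open_source.mem_nhds
        hstrict.mem_toOpenPartialHomeomorph_source] with z h1 h2 h3 h4 h5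
    exact ⟨h1, h2, h3, h4, h5⟩
  obtain ⟨T, hT, hTo, hyT⟩ := eventually_nhds_iff.1 hev
  set W := (extChartAt (𝓡∂ 3) q).source ∩ extChartAt (𝓡∂ 3) q ⁻¹' T with hW
  have hWU : W ⊆ U := by
    rintro x ⟨hxs, hxT⟩
    have := (hT _ hxT).2.1
    rwa [(extChartAt (𝓡∂ 3) q).left_inv hxs] at this
  have hWo : IsOpen W :=
    (continuousOn_extChartAt q).isOpen_inter_preimage (isOpen_extChartAt_source q) hTo
  have hkκ : ∀ x ∈ W, k (extChartAt (𝓡∂ 3) q x) = κ x := by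
    intro x hx
    simp only [hk, Function.comp_apply, (extChartAt (𝓡∂ 3) q).left_inv hx.1]
  refine ⟨W, κ, ε, ⟨hWo, ?_, ?_, fun x hx => hκd x (hWU hx), fun p z hz hx => hfd p z hz (hWU hx),
    ?_⟩, hε, ⟨(extChartAt (𝓡∂ 3) q).map_target hy, ?_⟩, hkyv,
    fun x hx => (hκd x (hWU hx)).continuousAt.continuousWithinAt, ?_⟩
  · intro x hx x' hx' hxx'
    rw [← hkκ x hx, ← hkκ x' hx'] at hxx'
    exact (extChartAt (𝓡∂ 3) q).injOn hx.1 hx'.1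
      ((hstrict.toOpenPartialHomeomorph k).injOn (hT _ hx.2).2.2.2.2 (hT _ hx'.2).2.2.2.2 hxx')
  · intro x hx
    simp only [hκ, ContinuousLinearEquiv.symm_apply_apply]
    exact hGg x (hWU hx)
  · intro p z hz hx
    rw [det_comp_symm_pos_iff hz hx.1 (hκd _ (hWU hx))]
    obtain ⟨-, -, h3, h4, -⟩ := hT _ hx.2
    rwa [fderivWithin_of_mem_nhds h3]
  · simpa only [mem_preimage, (extChartAt (𝓡∂ 3) q).right_inv hy] using hyT
  · intro N hN
    have h1 : ∀ᶠ z in 𝓝 y, (extChartAt (𝓡∂ 3) q).symm z ∈ N := by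
      have h := extChartAt_eventually_symm_mem hy hN
      rwa [nhdsWithin_eq_nhds.2 hr] at h
    have h2 := Filter.image_mem_map (m := k) h1
    rw [hstrict.map_nhds_eq_of_equiv, hkyv] at h2
    refine Filter.mem_of_superset h2 ?_
    rintro _ ⟨z, hz, rfl⟩
    exact ⟨_, hz, rfl⟩

end LocalDegree

/-! ### Integrals of concentrated products over cubes -/

section Cube

open MeasureTheory

/-- The open cube with centre `a` and side length `2 r`. -/
def openCube (a : EuclideanSpace ℝ (Fin 3)) (r : ℝ) : Set (EuclideanSpace ℝ (Fin 3)) :=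
  {c | ∀ i, |c i - a i| < r}

theorem isOpen_openCube (a : EuclideanSpace ℝ (Fin 3)) (r : ℝ) : IsOpen (openCube a r) := by
  simp only [openCube, ofPred_forall]
  exact isOpen_iInter_of_finite fun i => isOpen_lt (by fun_prop) continuous_const

theorem openCube_mem_nhds (a : EuclideanSpace ℝ (Fin 3)) {r : ℝ} (hr : 0 < r) :
    openCube a r ∈ 𝓝 a :=
  (isOpen_openCube a r).mem_nhds fun i => by simpa using hr

theorem exists_openCube_subset {a : EuclideanSpace ℝ (Fin 3)}
    {N : Set (EuclideanSpace ℝ (Fin 3))} (hN : N ∈ 𝓝 a) : ∃ r > 0, openCube a r ⊆ N := by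
  have h1 : (EuclideanSpace.equiv (Fin 3) ℝ).symm ⁻¹' N ∈ 𝓝 (EuclideanSpace.equiv (Fin 3) ℝ a) :=
    (EuclideanSpace.equiv (Fin 3) ℝ).symm.continuous.continuousAt.preimage_mem_nhds (by simpa using hN)
  obtain ⟨r, hr, h2⟩ := Metric.mem_nhds_iff.1 h1
  refine ⟨r, hr, fun c hc => ?_⟩
  have h3 : EuclideanSpace.equiv (Fin 3) ℝ c ∈ Metric.ball (EuclideanSpace.equiv (Fin 3) ℝ a) r := by
    rw [Metric.mem_ball, dist_pi_lt_iff hr]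
    exact fun i => hc i
  simpa using h2 h3

theorem openCube_subset (a : EuclideanSpace ℝ (Fin 3)) {r r' : ℝ} (h : r ≤ r') :
    openCube a r ⊆ openCube a r' := fun _ hc i => (hc i).trans_le h

/-- The integral of a product of periodic functions concentrated near the coordinates of `a`. -/
theorem setIntegral_prod_eq_prod_integral {a : EuclideanSpace ℝ (Fin 3)} {δ : ℝ} (hδ : δ ≤ 1 / 2)
    {s : Set (EuclideanSpace ℝ (Fin 3))} (hs : s ⊆ openCube a (1 / 2)) (hs' : openCube a δ ⊆ s)
    {h : Fin 3 → ℝ → ℝ} (hp : ∀ i, Function.Periodic (h i) 1)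
    (hsupp : ∀ i t, h i t ≠ 0 → ∃ m : ℤ, |t - a i - m| < δ) :
    ∫ z in s, ∏ i, h i (z i) = ∏ i, ∫ r in (0 : ℝ)..1, h i r := by
  rw [← setIntegral_eq_of_subset_of_forall_sdiff_eq_zero (isOpen_openCube a (1 / 2)).measurableSet hs,
    ← integral_indicator (isOpen_openCube a (1 / 2)).measurableSet]
  · set k : Fin 3 → ℝ → ℝ := fun i => (Ioo (a i - 1 / 2) (a i + 1 / 2)).indicator (h i) with hk
    have h1 : (openCube a (1 / 2)).indicator (fun z => ∏ i, h i (z i)) =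
        fun z => (fun w : Fin 3 → ℝ => ∏ i, k i (w i))
          ((MeasurableEquiv.toLp 2 (Fin 3 → ℝ)).symm z) := by
      funext z
      by_cases hz : z ∈ openCube a (1 / 2)
      · rw [indicator_of_mem hz]
        refine Finset.prod_congr rfl fun i _ => ?_
        rw [hk]
        have := abs_lt.1 (hz i)
        exact (indicator_of_mem (show z i ∈ Ioo (a i - 1 / 2) (a i + 1 / 2) from
          ⟨by linarith, by linarith⟩) (h i)).symm
      · rw [indicator_of_notMem hz]
        obtain ⟨i, hi⟩ : ∃ i, ¬ |z i - a i| < 1 / 2 := not_forall.1 hz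
        refine (Finset.prod_eq_zero (Finset.mem_univ i) ?_).symm
        rw [hk]
        refine indicator_of_notMem (fun hmem => hi ?_) (h i)
        have h2 : z i ∈ Ioo (a i - 1 / 2) (a i + 1 / 2) := hmem
        rw [abs_lt]
        exact ⟨by linarith [h2.1], by linarith [h2.2]⟩
    rw [h1, (EuclideanSpace.volume_preserving_symm_measurableEquiv_toLp (Fin 3)).integral_comp',
      integral_fintype_prod_volume_eq_prod]
    refine Finset.prod_congr rfl fun i _ => ?_
    rw [hk, integral_indicator measurableSet_Ioo, ← integral_Ioc_eq_integral_Ioo,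
      ← intervalIntegral.integral_of_le (by linarith)]
    -- The interval of length `1` about `a i` is a full period.
    have h2 := (hp i).intervalIntegral_add_eq (a i - 1 / 2) 0
    rw [zero_add] at h2
    rw [← h2]
    congr 1
    ring
  · rintro z ⟨hz, hzs⟩
    by_contra hne
    refine hzs (hs' fun i => ?_)
    obtain ⟨m, hm⟩ := hsupp i _ (Finset.prod_ne_zero_iff.1 hne i (Finset.mem_univ i))
    have h1 := abs_lt.1 hm
    have h2 := abs_lt.1 (hz i)
    -- Inside the cube of side `1` about `a`, no other integer translate of the support is met.
    have h3 : m = 0 := by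
      have h4 : (-1 : ℝ) < m := by linarith
      have h5 : (m : ℝ) < 1 := by linarith
      have h6 : -1 < m := by exact_mod_cast h4
      have h7 : m < 1 := by exact_mod_cast h5
      omega
    simpa [h3] using hm

end Cube

/-! ### The degree at a regular value -/

section Degree

open MeasureTheory

variable {V : Type*} [NormedAddCommGroup V] [NormedSpace ℝ V] [FiniteDimensional ℝ V]
  {Γ : Submodule ℤ V} [DiscreteTopology Γ]
  {B : Type*} [TopologicalSpace B] [ChartedSpace (EuclideanHalfSpace 3) B]

theorem formCoeff_weightedForm (b : Basis (Fin 3) ℝ V) (g : B → V ⧸ Γ) (Φ : V ⧸ Γ → ℝ) (p : B)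
    (y : EuclideanSpace ℝ (Fin 3)) : formCoeff (𝓡∂ 3) (weightedForm b g Φ) p y =
      Φ (g ((extChartAt (𝓡∂ 3) p).symm y)) * (coordDeriv b g p y).det := by
  refine (formCoeff_smul_rowForm _ _ p y).trans ?_
  congr 1
  rw [ContinuousLinearMap.det,
    ← LinearMap.det_toMatrix (EuclideanSpace.basisFun (Fin 3) ℝ).toBasis, ← Matrix.det_transpose]
  congr 1

variable [IsManifold (𝓡∂ 3) ∞ B] [T2Space B] [CompactSpace B] [OrientedAtlas (𝓡∂ 3) B]

theorem t2Space_quotient {W : Type*} [NormedAddCommGroup W] (L : Submodule ℤ W)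
    [DiscreteTopology L] : T2Space (W ⧸ L) := by
  have : DiscreteTopology L.toAddSubgroup := ‹DiscreteTopology L›
  have : IsClosed (L : Set W) := AddSubgroup.isClosed_of_discrete (H := L.toAddSubgroup)
  have := Submodule.t3_quotient_of_isClosed L
  infer_instance

/-- A regular value of `g` has finitely many preimages; near each of them `g` is invertible. -/
theorem exists_isSignedLift_family {b : Basis (Fin 3) ℝ V}
    (hb : ∀ v, v ∈ Γ ↔ ∀ i, ∃ m : ℤ, b.coordL i v = m) {g : B → V ⧸ Γ}
    (hg : ContMDiff (𝓡∂ 3) 𝓘(ℝ, V) ∞ g) {v : V}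
    (hreg : ∀ x, g x = Γ.mkQ v → IsRegularPoint b g x) :
    ∃ (P : Finset B) (W : B → Set B) (κ : B → B → EuclideanSpace ℝ (Fin 3)) (ε : B → ℤ),
      (∀ x, g x = Γ.mkQ v → x ∈ P) ∧ (P : Set B).PairwiseDisjoint W ∧ ∀ x ∈ P, x ∈ W x ∧
      IsSignedLift b g (W x) (κ x) (ε x) ∧ ((ε x : ℝ) = 1 ∨ (ε x : ℝ) = -1) ∧
      κ x '' W x ⊆ openCube (b.coordEquiv v) (1 / 2) ∧ κ x '' W x ∈ 𝓝 (b.coordEquiv v) := by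
  classical
  have := t2Space_quotient Γ
  set a := b.coordEquiv v with ha
  have hlift : ∀ x, g x = Γ.mkQ v → ∃ U κ, ∃ ε : ℤ, IsSignedLift b g U κ ε ∧
      ((ε : ℝ) = 1 ∨ (ε : ℝ) = -1) ∧ x ∈ U ∧ κ x = a ∧ κ '' U ⊆ openCube a (1 / 2) ∧
      ∀ N ∈ 𝓝 x, κ '' N ∈ 𝓝 a := by
    intro x hx
    obtain ⟨U, κ, ε, h1, hε, hxU, hκx, hκc, hN⟩ := exists_isSignedLift hg (hreg x hx) hx.symm
    have hop : IsOpen (U ∩ κ ⁻¹' openCube a (1 / 2)) :=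
      hκc.isOpen_inter_preimage h1.isOpen (isOpen_openCube _ _)
    obtain ⟨e, rfl⟩ : ∃ e : ℤ, (e : ℝ) = ε := by
      rcases hε with rfl | rfl
      · exact ⟨1, by norm_num⟩
      · exact ⟨-1, by norm_num⟩
    refine ⟨U ∩ κ ⁻¹' openCube a (1 / 2), κ, e, h1.mono hop inter_subset_left, hε, ⟨hxU, ?_⟩, hκx,
      ?_, hN⟩
    · rw [mem_preimage, hκx]
      exact mem_of_mem_nhds (openCube_mem_nhds a (by norm_num))
    · rintro _ ⟨z, hz, rfl⟩
      exact hz.2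
  choose! U κ ε hsl hε hmem hκx hcube hnhds using hlift
  -- The lift of a preimage of `v` in `U x` differs from `v` by a lattice vector with integer
  -- coordinates of absolute value below `1`, hence by zero. So `U x` meets the fibre only in `x`,
  -- and a finite subcover of the compact fibre lists all of it.
  have hiso : ∀ x, g x = Γ.mkQ v → ∀ x' ∈ U x, g x' = Γ.mkQ v → x' = x := by
    intro x hx x' hx' hgx'
    refine (hsl x hx).injOn hx' (hmem x hx) ?_
    rw [hκx x hx]
    have h1 : b.coordEquiv.symm (κ x x') - v ∈ Γ := by
      rw [← Submodule.Quotient.eq]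
      exact ((hsl x hx).mkQ_eq x' hx').trans hgx'
    ext i
    obtain ⟨m, hm⟩ := (hb _).1 h1 i
    rw [map_sub, ← b.coordEquiv_apply, ← b.coordEquiv_apply,
      ContinuousLinearEquiv.apply_symm_apply] at hm
    have h2 := abs_lt.1 (hcube x hx ⟨x', hx', rfl⟩ i)
    have h3 : m = 0 := by
      have h4 : (-1 : ℝ) < m := by rw [← hm]; linarith
      have h5 : (m : ℝ) < 1 := by rw [← hm]; linarith
      have h6 : -1 < m := by exact_mod_cast h4
      have h7 : m < 1 := by exact_mod_cast h5
      omega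
    rw [h3, Int.cast_zero] at hm
    linarith
  have hcomp : IsCompact {x | g x = Γ.mkQ v} :=
    (isClosed_singleton.preimage hg.continuous).isCompact
  obtain ⟨P, hP, hPU⟩ := hcomp.elim_nhds_subcover U fun x hx =>
    (hsl x hx).isOpen.mem_nhds (hmem x hx)
  obtain ⟨O, hO, hdisj⟩ := (P.finite_toSet).t2_separation
  refine ⟨P, fun x => U x ∩ O x, κ, ε, fun x hx => ?_,
    hdisj.mono fun x => inter_subset_right, fun x hx => ⟨⟨hmem x (hP x hx), (hO x).1⟩,
    (hsl x (hP x hx)).mono ((hsl x (hP x hx)).isOpen.inter (hO x).2) inter_subset_left,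
    hε x (hP x hx), (image_mono inter_subset_left).trans (hcube x (hP x hx)),
    hnhds x (hP x hx) _ (Filter.inter_mem ((hsl x (hP x hx)).isOpen.mem_nhds (hmem x (hP x hx)))
      ((hO x).2.mem_nhds (hO x).1))⟩⟩
  obtain ⟨x', hx', hxU⟩ := mem_iUnion₂.1 (hPU hx)
  rw [hiso x' (hP x' hx') x hxU hx]
  exact hx'

/-- Near a regular value, the integral of the pullback is a multiple by an integer, the degree. -/
theorem exists_degree {b : Basis (Fin 3) ℝ V}
    (hb : ∀ v, v ∈ Γ ↔ ∀ i, ∃ m : ℤ, b.coordL i v = m) {g : B → V ⧸ Γ}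
    (hg : ContMDiff (𝓡∂ 3) 𝓘(ℝ, V) ∞ g) {v : V}
    (hreg : ∀ x, g x = Γ.mkQ v → IsRegularPoint b g x) :
    ∃ k : ℤ, ∃ δ > 0, ∀ h : Fin 3 → ℝ → ℝ, (∀ i, Function.Periodic (h i) 1) →
      (∀ i, Continuous (h i)) →
      (∀ i t, h i t ≠ 0 → ∃ m : ℤ, |t - b.coordL i v - m| < δ) →
      formIntegral (𝓡∂ 3) (weightedForm b g (prodFun Γ b h)) =
        k * ∏ i, ∫ r in (0 : ℝ)..1, h i r := by
  classical
  have := t2Space_quotient Γ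
  obtain ⟨P, W, κ, ε, hP, hdisj, hW⟩ := exists_isSignedLift_family hb hg hreg
  set a := b.coordEquiv v with ha
  -- On the compact set `K` the map misses the class of `v`, hence misses a whole cube about it. A
  -- weight concentrated in that cube is seen only by the sets `W x`.
  set K : Set B := (⋃ x ∈ P, W x)ᶜ with hK
  have hKc : IsCompact K := by
    refine IsClosed.isCompact ?_
    rw [hK, isClosed_compl_iff]
    exact isOpen_biUnion fun x hx => (hW x hx).2.1.isOpen
  have hvK : v ∈ Γ.mkQ ⁻¹' (g '' K)ᶜ := by
    rintro ⟨x, hx, hgx⟩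
    exact hx (mem_iUnion₂.2 ⟨x, hP x hgx, (hW x (hP x hgx)).1⟩)
  have hnK : Γ.mkQ ⁻¹' (g '' K)ᶜ ∈ 𝓝 v :=
    ((hKc.image hg.continuous).isClosed.isOpen_compl.preimage
      (isLocalHomeomorph_mkQ Γ).continuous).mem_nhds hvK
  have hnK' : b.coordEquiv.symm ⁻¹' (Γ.mkQ ⁻¹' (g '' K)ᶜ) ∈ 𝓝 a :=
    b.coordEquiv.symm.continuous.continuousAt.preimage_mem_nhds (by simpa [ha] using hnK)
  have hnW : ⋂ x ∈ P, κ x '' W x ∈ 𝓝 a :=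
    (Filter.biInter_finset_mem P).2 fun x hx => (hW x hx).2.2.2.2
  obtain ⟨r, hr, hrsub⟩ := exists_openCube_subset (Filter.inter_mem hnK' hnW)
  -- The degree is the sum of the local signs. The bound `r` keeps the cube off `g '' K` and inside
  -- every `κ x '' W x`; the bound `1 / 2` keeps its integer translates disjoint.
  refine ⟨∑ x ∈ P, ε x, min r (1 / 2), by positivity, fun h hp hc hsupp => ?_⟩
  have hbΓ : ∀ v ∈ Γ, ∀ i, ∃ m : ℤ, b.coordL i v = m := fun v hv => (hb v).1 hv
  have hzero : ∀ x ∈ K, prodFun Γ b h (g x) = 0 := by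
    intro x hx
    obtain ⟨u, hu⟩ := Γ.mkQ_surjective (g x)
    rw [← hu, prodFun_mkQ hbΓ hp]
    by_contra hne
    choose m hm using fun i => hsupp i _ (Finset.prod_ne_zero_iff.1 hne i (Finset.mem_univ i))
    set γ : V := b.coordEquiv.symm (WithLp.toLp 2 fun i => (m i : ℝ)) with hγ
    have hγi : ∀ i, b.coordL i γ = m i := by
      intro i
      rw [← b.coordEquiv_apply, hγ, ContinuousLinearEquiv.apply_symm_apply]
    have hγΓ : γ ∈ Γ := (hb γ).2 fun i => ⟨m i, hγi i⟩
    have h1 : b.coordEquiv (u - γ) ∈ openCube a r := by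
      intro i
      rw [b.coordEquiv_apply, ha, b.coordEquiv_apply, map_sub, hγi]
      refine lt_of_lt_of_le ?_ (min_le_left r (1 / 2))
      have h3 := hm i
      rwa [sub_right_comm] at h3
    have h2 : Γ.mkQ (b.coordEquiv.symm (b.coordEquiv (u - γ))) ∉ g '' K := (hrsub h1).1
    rw [ContinuousLinearEquiv.symm_apply_apply] at h2
    refine h2 ⟨x, hx, ?_⟩
    rw [← hu]
    refine (Submodule.Quotient.eq Γ).2 ?_
    simpa using hγΓ
  have hcont : FormContinuous (𝓡∂ 3) (weightedForm b g (prodFun Γ b h)) :=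
    formContinuous_weightedForm b hg (continuous_prodFun hbΓ hp hc)
  have hρ := (SmoothPartitionOfUnity.exists_isSubordinate_chartAt_source (𝓡∂ 3) B).choose_spec
  set ρ := (SmoothPartitionOfUnity.exists_isSubordinate_chartAt_source (𝓡∂ 3) B).choose with hρ'
  have hint := hcont.formIntegrable hρ
  have hsplit : weightedForm b g (prodFun Γ b h) = fun x => ∑ j ∈ P,
      (if x ∈ W j then (1 : ℝ) else 0) • weightedForm b g (prodFun Γ b h) x := by
    funext x
    rw [← Finset.sum_smul]
    by_cases hx : x ∈ K
    · have h0 : weightedForm b g (prodFun Γ b h) x = 0 := by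
        rw [weightedForm, hzero x hx]
        exact zero_smul ℝ _
      rw [h0]
      exact (smul_zero _).symm
    · obtain ⟨j, hj, hxj⟩ := mem_iUnion₂.1 (not_not.1 hx)
      rw [Finset.sum_eq_single_of_mem j hj, if_pos hxj]
      · exact (one_smul ℝ _).symm
      · intro i hi hij
        exact if_neg fun hxi => disjoint_left.1 (hdisj hi hj hij) hxi hxj
  rw [formIntegral, ← hρ', hsplit, formIntegralWith_finset_sum ρ P _ fun j hj =>
    hint.indicator (hW j hj).2.1.isOpen, Int.cast_sum, Finset.sum_mul]
  refine Finset.sum_congr rfl fun j hj => ?_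
  obtain ⟨-, hsl, hε, hcube, -⟩ := hW j hj
  rw [formIntegralWith_eq_integral_image hρ (hint.indicator hsl.isOpen) hsl.isOpen hsl.injOn
    hsl.mdifferentiableAt hε hsl.sign_pos (h := fun z => ∏ i, h i (z i)),
    setIntegral_prod_eq_prod_integral (min_le_right r (1 / 2)) hcube _ hp hsupp]
  · intro c hc
    have h1 := (hrsub (openCube_subset a (min_le_left r (1 / 2)) hc)).2
    exact mem_iInter₂.1 h1 j hj
  · intro p y hy hyW
    rw [formCoeff_smul, if_pos hyW, one_mul, formCoeff_weightedForm, hsl.fderivWithin_eq p y hy hyW,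
      ← hsl.mkQ_eq _ hyW, prodFun_mkQ hbΓ hp]
    simp only [← b.coordEquiv_apply, ContinuousLinearEquiv.apply_symm_apply]
  · intro x hx
    rw [if_neg hx]
    exact zero_smul ℝ _

end Degree

/-! ### Periodic bump functions -/

section Concentrated

/-- The value `cos (2πx)` depends only on the distance from `x` to the nearest integer and decreases
with it on `[0, 1/2]`. -/
theorem abs_lt_of_cos_lt_cos {x δ : ℝ} (hδ : 0 < δ) (hδ' : δ ≤ 1 / 2)
    (h : Real.cos (2 * Real.pi * δ) < Real.cos (2 * Real.pi * x)) : ∃ m : ℤ, |x - m| < δ := by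
  refine ⟨round x, ?_⟩
  by_contra! hcon
  have h1 : Real.cos (2 * Real.pi * x) = Real.cos (2 * Real.pi * |x - round x|) := by
    have h2 : 2 * Real.pi * |x - round x| = |2 * Real.pi * x - round x * (2 * Real.pi)| := by
      rw [show 2 * Real.pi * x - round x * (2 * Real.pi) = 2 * Real.pi * (x - round x) by ring,
        abs_mul, abs_of_pos Real.two_pi_pos]
    rw [h2, Real.cos_abs, Real.cos_sub_int_mul_two_pi]
  have h3 : |x - round x| ≤ 1 / 2 := abs_sub_round x
  have h4 := Real.pi_pos
  have h5 : Real.cos (2 * Real.pi * |x - round x|) ≤ Real.cos (2 * Real.pi * δ) :=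
    Real.cos_le_cos_of_nonneg_of_le_pi (by positivity) (by nlinarith) (by gcongr)
  linarith

/-- A smooth periodic function with positive mean that is concentrated near a point. -/
theorem exists_periodic_concentrated (a : ℝ) {δ : ℝ} (hδ : 0 < δ) :
    ∃ h : ℝ → ℝ, Function.Periodic h 1 ∧ ContDiff ℝ 1 h ∧ (0 < ∫ r in (0 : ℝ)..1, h r) ∧
      ∀ t, h t ≠ 0 → ∃ m : ℤ, |t - a - m| < δ := by
  wlog hδ' : δ ≤ 1 / 2 generalizing δ
  · obtain ⟨h, h1, h2, h3, h4⟩ := this (δ := 1 / 2) (by norm_num) le_rfl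
    refine ⟨h, h1, h2, h3, fun t ht => ?_⟩
    obtain ⟨m, hm⟩ := h4 t ht
    exact ⟨m, hm.trans (not_le.1 hδ')⟩
  have hπ := Real.pi_pos
  -- Positive at `t = a`, and zero unless `t` is within `δ` of `a` modulo `1`.
  set h : ℝ → ℝ := fun t =>
    Real.smoothTransition (Real.cos (2 * Real.pi * (t - a)) - Real.cos (2 * Real.pi * δ)) with hh
  have hper : Function.Periodic h 1 := by
    intro t
    simp only [hh]
    rw [show 2 * Real.pi * (t + 1 - a) = 2 * Real.pi * (t - a) + 2 * Real.pi by ring,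
      Real.cos_add_two_pi]
  have hcd : ContDiff ℝ 1 h := (Real.smoothTransition.contDiff (n := 1)).comp (by fun_prop)
  have hlt : Real.cos (2 * Real.pi * δ) < 1 := by
    rw [← Real.cos_zero]
    exact Real.cos_lt_cos_of_nonneg_of_le_pi le_rfl (by nlinarith) (by positivity)
  refine ⟨h, hper, hcd, ?_, fun t ht => ?_⟩
  · refine intervalIntegral.integral_pos one_pos hcd.continuous.continuousOn
      (fun t _ => Real.smoothTransition.nonneg _)
      ⟨Int.fract a, ⟨Int.fract_nonneg a, (Int.fract_lt_one a).le⟩, ?_⟩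
    have h1 : h (Int.fract a) = h a :=
      hper.apply_eq_of_sub_eq_int (m := -⌊a⌋) (by rw [Int.fract]; push_cast; ring)
    rw [h1]
    refine Real.smoothTransition.pos_of_pos ?_
    simp only [sub_self, mul_zero, Real.cos_zero]
    linarith
  · refine abs_lt_of_cos_lt_cos hδ hδ' ?_
    by_contra! hcon
    exact ht (Real.smoothTransition.zero_of_nonpos (by linarith))

end Concentrated

/-! ### Lattice bases and covolume -/

section Lattice

open MeasureTheory

/-- The measure is the one of the inner product, and `su2.stdBasis` is orthonormal, so its
fundamental domain has volume `1`. -/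
theorem ZLattice.covolume_eq_abs_det (Γ : Submodule ℤ su2) [DiscreteTopology Γ] [IsZLattice ℝ Γ]
    (b : Basis (Fin 3) ℤ Γ) :
    ZLattice.covolume Γ = |su2.stdBasis.det (b.ofZLatticeBasis ℝ Γ)| := by
  set e := su2.stdBasis.toOrthonormalBasis su2.orthonormal_stdBasis with he
  have h1 : (volume : Measure su2).real (ZSpan.fundamentalDomain su2.stdBasis) = 1 := by
    rw [measureReal_congr (ZSpan.fundamentalDomain_ae_parallelepiped su2.stdBasis volume),
      Measure.real, show (⇑su2.stdBasis : Fin 3 → su2) = ⇑e from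
        (Basis.coe_toOrthonormalBasis _ _).symm, e.volume_parallelepiped, ENNReal.toReal_one]
  rw [ZLattice.covolume_eq_det_mul_measureReal Γ volume b su2.stdBasis, h1, mul_one]
  congr 2
  funext i
  exact (b.ofZLatticeBasis_apply ℝ Γ i).symm

theorem exists_basis_of_isZLattice (Γ : Submodule ℤ su2) [DiscreteTopology Γ] [IsZLattice ℝ Γ] :
    ∃ b : Basis (Fin 3) ℝ su2, (∀ v, v ∈ Γ ↔ ∀ i, ∃ m : ℤ, b.coordL i v = m) ∧
      ZLattice.covolume Γ = |su2.stdBasis.det b| := by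
  have : Module.Finite ℤ Γ := ZLattice.module_finite ℝ Γ
  have : Module.Free ℤ Γ := ZLattice.module_free ℝ Γ
  have hrank : Module.finrank ℤ Γ = 3 := by
    rw [ZLattice.rank ℝ Γ, Module.finrank_eq_card_basis su2.stdBasis, Fintype.card_fin]
  set b := Module.finBasisOfFinrankEq ℤ Γ hrank
  refine ⟨b.ofZLatticeBasis ℝ Γ, fun v => ?_, ZLattice.covolume_eq_abs_det Γ b⟩
  conv_lhs => rw [← b.ofZLatticeBasis_span ℝ Γ, Basis.mem_span_iff_repr_mem]
  refine forall_congr' fun i => ?_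
  rw [Basis.coordL_apply, mem_range]
  exact exists_congr fun m => eq_comm

end Lattice

/-! ### Comparison of two fillings -/

section Main

open MeasureTheory

variable {S : Type*} [TopologicalSpace S] [ChartedSpace (EuclideanSpace ℝ (Fin 2)) S]
  [IsManifold (𝓡 2) ∞ S] [T2Space S] [CompactSpace S] [OrientedAtlas (𝓡 2) S]

/-- The volumes of two fillings with the same boundary values differ by an integral multiple of
the volume of the quotient. -/
theorem Filling.volume_coe_eq_of_isZLattice (Γ : Submodule ℤ su2) [DiscreteTopology Γ]
    [IsZLattice ℝ Γ] (F₁ : Filling S) (F₂ : Filling S) {g₁ : F₁.B → su2 ⧸ Γ}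
    {g₂ : F₂.B → su2 ⧸ Γ} (hg₁ : ContMDiff (𝓡∂ 3) 𝓘(ℝ, su2) ∞ g₁)
    (hg₂ : ContMDiff (𝓡∂ 3) 𝓘(ℝ, su2) ∞ g₂) (h : ∀ s, g₁ (F₁.incl s) = g₂ (F₂.incl s)) :
    (F₁.volume Γ g₁ : AddCircle (ZLattice.covolume Γ)) = F₂.volume Γ g₂ := by
  obtain ⟨b, hb, hcov⟩ := exists_basis_of_isZLattice Γ
  -- The two sets of irregular values are null, so one `v` is regular for both maps and a single
  -- weight serves both fillings.
  have hbad := measure_union_null (volume_irregular_values b hg₁) (volume_irregular_values b hg₂)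
  obtain ⟨c, hc⟩ := Filter.nonempty_of_mem (compl_mem_ae_iff.2 hbad)
  rw [compl_union] at hc
  obtain ⟨v, rfl⟩ := b.coordEquiv.surjective c
  have hreg₁ : ∀ x, g₁ x = Γ.mkQ v → IsRegularPoint b g₁ x := by
    intro x hx
    by_contra hcon
    exact hc.1 ⟨v, ⟨x, hx, hcon⟩, rfl⟩
  have hreg₂ : ∀ x, g₂ x = Γ.mkQ v → IsRegularPoint b g₂ x := by
    intro x hx
    by_contra hcon
    exact hc.2 ⟨v, ⟨x, hx, hcon⟩, rfl⟩
  obtain ⟨k₁, δ₁, hδ₁, hk₁⟩ := exists_degree hb hg₁ hreg₁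
  obtain ⟨k₂, δ₂, hδ₂, hk₂⟩ := exists_degree hb hg₂ hreg₂
  choose η hp hd hpos hsupp using fun i : Fin 3 =>
    exists_periodic_concentrated (b.coordL i v) (lt_min hδ₁ hδ₂)
  have h1 := hk₁ η hp (fun i => (hd i).continuous) fun i t ht =>
    (hsupp i t ht).imp fun m hm => hm.trans_le (min_le_left _ _)
  have h2 := hk₂ η hp (fun i => (hd i).continuous) fun i t ht =>
    (hsupp i t ht).imp fun m hm => hm.trans_le (min_le_right _ _)
  have h3 := formIntegral_weightedForm_sub_eq_mul F₁.isOrientedBoundary F₂.isOrientedBoundary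
    (fun v hv => (hb v).1 hv) hp hd hg₁ hg₂ (funext h)
  have hne : ∏ i, ∫ r in (0 : ℝ)..1, η i r ≠ 0 :=
    Finset.prod_ne_zero_iff.2 fun i _ => (hpos i).ne'
  -- Both sides carry the nonzero product of means; cancelling it identifies the difference of the
  -- unweighted integrals with `k₁ - k₂`.
  rw [h1, h2, ← sub_mul, mul_comm] at h3
  have h4 := mul_left_cancel₀ hne h3
  have h5 : F₁.volume Γ g₁ - F₂.volume Γ g₂ = ((k₁ - k₂ : ℤ) : ℝ) * su2.stdBasis.det b := by
    rw [F₁.volume_eq Γ b, F₂.volume_eq Γ b, ← mul_sub, ← h4, mul_comm]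
    push_cast
    rfl
  rw [← sub_eq_zero, ← AddCircle.coe_sub, AddCircle.coe_eq_zero_iff]
  -- The lattice basis may be negatively oriented, in which case the integer changes sign.
  rcases abs_choice (su2.stdBasis.det b) with habs | habs
  · refine ⟨k₁ - k₂, ?_⟩
    rw [hcov, habs, h5, zsmul_eq_mul]
  · refine ⟨-(k₁ - k₂), ?_⟩
    rw [hcov, habs, h5, zsmul_eq_mul]
    push_cast
    ring

/-- The volume of a filling in the quotient by a sublattice of rank `2` is determined by the
boundary values in the quotient by the lattice. -/
theorem Filling.volume_eq_of_factor_eq [ConnectedSpace S] {Γ Γ' : Submodule ℤ su2}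
    [DiscreteTopology Γ] [DiscreteTopology Γ'] (hΓ : Γ' ≤ Γ) (hrank : Module.finrank ℤ Γ' = 2)
    (F₁ : Filling S) (F₂ : Filling S) {g₁ : F₁.B → su2 ⧸ Γ'} {g₂ : F₂.B → su2 ⧸ Γ'}
    (hg₁ : ContMDiff (𝓡∂ 3) 𝓘(ℝ, su2) ∞ g₁) (hg₂ : ContMDiff (𝓡∂ 3) 𝓘(ℝ, su2) ∞ g₂)
    (h : ∀ s, Submodule.factor hΓ (g₁ (F₁.incl s)) = Submodule.factor hΓ (g₂ (F₂.incl s))) :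
    F₁.volume Γ' g₁ = F₂.volume Γ' g₂ := by
  -- The boundary values need agree only modulo `Γ`. In the quotient by `Γ'` they differ by a
  -- constant `c`, and translating `g₂` by `c` preserves its volume.
  obtain ⟨c, hc⟩ := sub_eq_const_of_factor_eq hΓ
    (d := fun s => g₁ (F₁.incl s) - g₂ (F₂.incl s))
    ((hg₁.continuous.comp F₁.isOrientedBoundary.contMDiff.continuous).sub
      (hg₂.continuous.comp F₂.isOrientedBoundary.contMDiff.continuous))
    fun s => by rw [map_sub, h s, sub_self]
  rw [← F₂.volume_add_const Γ' c hg₂]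
  refine Filling.volume_eq_of_finrank_eq_two hrank F₁ F₂ hg₁ (hg₂.add_const_quotient c) fun s => ?_
  rw [← hc s, add_sub_cancel]

end Main

theorem lemma2p3
    (Γ : Submodule ℤ su2) [DiscreteTopology Γ] [IsZLattice ℝ Γ]
    {S : Type*} [TopologicalSpace S] [ChartedSpace (EuclideanSpace ℝ (Fin 2)) S]
    [IsManifold (𝓡 2) ∞ S] [T2Space S] [CompactSpace S] [ConnectedSpace S]
    [OrientedAtlas (𝓡 2) S]
    (f : S → su2 ⧸ Γ) (hf : ContMDiff (𝓡 2) 𝓘(ℝ, su2) ∞ f) :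
    (∀ (F₁ : Filling S) (F₂ : Filling S) (g₁ : F₁.B → su2 ⧸ Γ) (g₂ : F₂.B → su2 ⧸ Γ),
      ContMDiff (𝓡∂ 3) 𝓘(ℝ, su2) ∞ g₁ → ContMDiff (𝓡∂ 3) 𝓘(ℝ, su2) ∞ g₂ →
      (∀ p, g₁ (F₁.incl p) = f p) → (∀ p, g₂ (F₂.incl p) = f p) →
      (F₁.volume Γ g₁ : AddCircle (ZLattice.covolume Γ)) = F₂.volume Γ g₂) ∧
    (∀ (Γ' : Submodule ℤ su2) [DiscreteTopology Γ'] (hΓ : Γ' ≤ Γ), Module.finrank ℤ Γ' = 2 →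
      ∀ (F₁ : Filling S) (F₂ : Filling S) (g₁ : F₁.B → su2 ⧸ Γ') (g₂ : F₂.B → su2 ⧸ Γ'),
      ContMDiff (𝓡∂ 3) 𝓘(ℝ, su2) ∞ g₁ → ContMDiff (𝓡∂ 3) 𝓘(ℝ, su2) ∞ g₂ →
      (∀ p, Submodule.factor hΓ (g₁ (F₁.incl p)) = f p) →
      (∀ p, Submodule.factor hΓ (g₂ (F₂.incl p)) = f p) →
      F₁.volume Γ' g₁ = F₂.volume Γ' g₂) :=
  ⟨fun F₁ F₂ _ _ hg₁ hg₂ h₁ h₂ => Filling.volume_coe_eq_of_isZLattice Γ F₁ F₂ hg₁ hg₂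
      fun p => (h₁ p).trans (h₂ p).symm,
    fun _ _ hΓ hrank F₁ F₂ _ _ hg₁ hg₂ h₁ h₂ => Filling.volume_eq_of_factor_eq hΓ hrank F₁ F₂ hg₁ hg₂
      fun p => (h₁ p).trans (h₂ p).symm⟩
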